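/- **Notation.** $\mathcal N(m,P)$ is the Gaussian law on $\mathbb R^{n_x}$. For $d\ge 1$, and with respect to Lebesgue measure on symmetric matrices restricted to the positive definite $d\times d$ matrices, $\mathcal W(X;n,S)\propto |X|^{(n-d-1)/2}e^{-\frac12\mathrm{tr}(S^{-1}X)}$, $\mathcal{IW}(X;v,V)\propto |X|^{-v/2}e^{-\frac12\mathrm{tr}(X^{-1}V)}$ ($v>2d$), and $\mathcal{GB}^{II}_d(X;a,b,\Omega,0)\propto |X|^{a-(d+1)/2}|\Omega+X|^{-(a+b)}$. **Model.** The state is $\xi=(x,X)$ with $x\in\mathbb R^{n_x}$ and $X$ positive definite. For $(j|\ell)\in\{(k|k),(k+1|k),(k+1|K)\}$ let $p(\xi_j|Z_{1:\ell})=\mathcal N(x_j;m_{j|\ell},P_{j|\ell})\,\mathcal{IW}(X_j;v_{j|\ell},V_{j|\ell})$, with $P_{k|k}$ positive semidefinite and $P_{k+1|k},P_{k+1|K}$ positive definite. The transition is $\mathcal N(x_{k+1};f(x_k),Q)\,\mathcal W(X_{k+1};n,M(x_k)X_kM(x_k)^{T}/n)$ with $Q$ positive semidefinite, $M$ measurable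 and every $M(x)$ invertible. Let $f$ be differentiable at $m_{k|k}$ with Jacobian $\tilde F$ there, and let $m_{k+1|k}=f(m_{k|k})$, $P_{k+1|k}=\tilde FP_{k|k}\tilde F^{T}+Q$; in the transition $f(x)$ is replaced by $f(m_{k|k})+\tilde F(x-m_{k|k})$ (no change if $f$ is affine). Put $w=v_{k+1|K}-v_{k+1|k}$, $W=V_{k+1|K}-V_{k+1|k}$ and assume $n>2d+2$, $w>2d+2$, $W$ positive definite (so that all moments matched below exist). The smoothed law is $$p(\xi_k|Z_{1:K})\propto p(\xi_k|Z_{1:k})\int\frac{p(\xi_{k+1}|\xi_k)\,p(\xi_{k+1}|Z_{1:K})}{p(\xi_{k+1}|Z_{1:k})}\,d\xi_{k+1}.$$ Let $L(x,X)=\int \mathcal W(Y;n,M(x)XM(x)^T/n)\frac{p(X_{k+1}=Y|Z_{1:K})}{p(X_{k+1}=Y|Z_{1:k})}dY$ be the extent message, and $$G=P_{k|k}\tilde F^TP_{k+1|k}^{-1},\quad m_{k|K}=m_{k|k}+G(m_{k+1|K}-m_{k+1|k}),\quad P_{k|K}=P_{k|k}-G(P_{k+1|k}-P_{k+1|K})G^T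 .$$ **Theorem 2.** (a) The smoothed law is normalizable, and the product of its marginals is the unique minimizer of $\mathrm{KL}(p(x_k,X_k|Z_{1:K})\,\|\,q_1\otimes q_2)$ over probability laws $q_1,q_2$. (b) Kinematic part: the law with density $p(x_k|Z_{1:k})\int \frac{p(x_{k+1}|x_k)p(x_{k+1}|Z_{1:K})}{p(x_{k+1}|Z_{1:k})}dx_{k+1}$ is exactly the RTS smoother $\mathcal N(m_{k|K},P_{k|K})$. The exact $x$-marginal is $\mathcal N(m_{k|K},P_{k|K})$ weighted by the evidence $c(x)=\int p(X|Z_{1:k})L(x,X)\,dX$ and normalized; it equals $\mathcal N(m_{k|K},P_{k|K})$ whenever $c$ is almost everywhere constant, in particular if $M$ is constant, and then the smoothed law is itself the product of its marginals. (c) Extent part, exactly: the $X$-marginal is proportional to $p(X|Z_{1:k})\int L(x,X)\,\mathcal N(dx;m_{k|K},P_{k|K})$, and, with a constant independent of $x$ and $X$, $L(x,X)\propto|\det M(x)|^{-(d+1)}\int\mathcal{IW}(X;n,nM(x)^{-1}YM(x)^{-T})\,\mathcal{IW}(Y;w,W)\,dY$. (d) The factorized smoothed law is the product of the kinematic law in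 (b), in which the factor $c(x)$ is neglected, and of the extent law obtained from (c) by the following closed form approximations, in which densities are combined up to constants and each message is normalized in $X$. (i) Each likelihood $X\mapsto\mathcal W(Y;n,M(x)XM(x)^T/n)$ is replaced by the Wishart density with the same $E[X]$, $E[X^{-1}]$. (ii) Its mixture over $Y\sim\mathcal{IW}(w,W)$, a $\mathcal{GB}^{II}_d(\cdot,\cdot,\cdot,0)$ law, is replaced by the inverse Wishart law $\mathcal{IW}(g,\Gamma(x))$ with the same $E[X]$, $E[X^{-1}]$. (iii) If $M$ is not constant, the law of $\Gamma(x)$, $x\sim\mathcal N(m_{k|K},P_{k|K})$, is replaced by the Wishart law with the same mean and the same value of $\mathrm{tr}\{C(C-I)^{-1}\}$, $C=E[\Gamma^{-1}]E[\Gamma]$, and the mixture of $\mathcal{IW}(g,\Gamma)$ over it, again a $\mathcal{GB}^{II}_d(\cdot,\cdot,\cdot,0)$ law, by the inverse Wishart law with the same $E[X]$, $E[X^{-1}]$. (iv) The result is multiplied by $p(X|Z_{1:k})$ and normalized. This procedure is well defined, and its unique result is the factorized Gaussian inverse Wishart law $\mathcal N(m_{k|K},P_{k|K})\otimes\mathcal{IW}(v_{k|K},V_{k|K})$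 with admissible parameters, namely: If $M(x)=A$ for all $x$: $$v_{k|K}=v_{k|k}+\eta^{-1}\Big(w-\tfrac{2(d+1)^2}{n}\Big),\quad V_{k|K}=V_{k|k}+\eta^{-1}A^{-1}W(A^{-1})^T,\quad \eta=1+\tfrac{w-3(d+1)}{n}.$$ In general, with $C_3=E[M(x)^TW^{-1}M(x)]$ and $C_4=E[M(x)^{-1}W(M(x)^{-1})^T]$ for $x\sim\mathcal N(m_{k|K},P_{k|K})$, provided that these expectations exist and $C_3C_4-I$ is invertible: $$v_{k|K}=v_{k|k}+\eta_2^{-1}\Big(g-\tfrac{2(d+1)^2}{h+d+1}\Big),\qquad V_{k|K}=V_{k|k}+\eta_1^{-1}\eta_3^{-1}C_4,$$ $$g=\eta_1^{-1}\Big(w-\tfrac{2(d+1)^2}{n}\Big),\quad h=\tfrac{d+1}{d}\,\mathrm{tr}\{C_3C_4(C_3C_4-I)^{-1}\},$$ $$\eta_1=1+\tfrac{w-3(d+1)}{n},\quad \eta_2=1+\tfrac{g-3d-3}{h+d+1},\quad \eta_3=1+\tfrac{g-d-1}{h-d-1}.$$ -/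

import Mathlib

open MeasureTheory ProbabilityTheory Matrix
open scoped ENNReal

noncomputable section

namespace GIWSmoothing

/-- Kinematic vectors. -/
abbrev Kin (nx : ℕ) := EuclideanSpace ℝ (Fin nx)

/-- The space of `d × d` matrices in which the extent matrices live. -/
abbrev Ext (d : ℕ) := Matrix (Fin d) (Fin d) ℝ

/-- Matrices carry the product σ-algebra of their entries. -/
instance extMeasurableSpace (d : ℕ) : MeasurableSpace (Ext d) :=
  inferInstanceAs (MeasurableSpace (Fin d → Fin d → ℝ))

/-! ### Probability laws on positive definite matrices -/

/-- The symmetric matrix with the given entries on and above the diagonal. -/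
def symOfUpper {d : ℕ} (u : {p : Fin d × Fin d // p.1 ≤ p.2} → ℝ) : Ext d :=
  Matrix.of fun i j => u ⟨(min i j, max i j), min_le_max⟩

/-- Lebesgue measure `∏_{i ≤ j} dX_{ij}` on symmetric matrices, restricted to the cone of positive
definite matrices. All matrix-variate densities below are densities with respect to it. -/
def extVolume (d : ℕ) : Measure (Ext d) :=
  (Measure.map symOfUpper (volume : Measure ({p : Fin d × Fin d // p.1 ≤ p.2} → ℝ))).restrict
    {X | X.PosDef}

/-- The measure with density `p` on the positive definite matrices. -/
def lawOf {d : ℕ} (p : Ext d → ℝ) : Measure (Ext d) :=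
  (extVolume d).withDensity fun X => ENNReal.ofReal (p X)

/-- The probability measure proportional to `μ` (meaningful if `μ` has finite nonzero mass). -/
def normalize {α : Type*} [MeasurableSpace α] (μ : Measure α) : Measure α :=
  (μ Set.univ)⁻¹ • μ

/-- Wishart density up to its constant: `|X|^((n-d-1)/2) exp(-tr(S⁻¹X)/2)`. -/
def wishartKernel {d : ℕ} (n : ℝ) (S X : Ext d) : ℝ :=
  X.det ^ ((n - d - 1) / 2) * Real.exp (-(1 / 2) * (S⁻¹ * X).trace)

/-- Density `W(X; n, S)` at a positive definite `X`; the normalizing constant is the integral of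
the kernel. -/
def wishartPdf {d : ℕ} (n : ℝ) (S X : Ext d) : ℝ :=
  wishartKernel n S X / ∫ Y, wishartKernel n S Y ∂extVolume d

/-- The Wishart law `W(n, S)`. -/
def wishartLaw {d : ℕ} (n : ℝ) (S : Ext d) : Measure (Ext d) := lawOf (wishartPdf n S)

/-- Inverse Wishart density up to its constant: `|X|^(-v/2) exp(-tr(X⁻¹V)/2)`. -/
def iwKernel {d : ℕ} (v : ℝ) (V X : Ext d) : ℝ :=
  X.det ^ (-v / 2) * Real.exp (-(1 / 2) * (X⁻¹ * V).trace)

/-- Density `IW(X; v, V)` at a positive definite `X`. -/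
def iwPdf {d : ℕ} (v : ℝ) (V X : Ext d) : ℝ :=
  iwKernel v V X / ∫ Y, iwKernel v V Y ∂extVolume d

/-- The inverse Wishart law `IW(v, V)`. -/
def iwLaw {d : ℕ} (v : ℝ) (V : Ext d) : Measure (Ext d) := lawOf (iwPdf v V)

open Classical in
/-- Generalized matrix-variate beta type II density up to its constant:
`|X-Ψ|^(a-(d+1)/2) |Ω+X|^(-(a+b))` on `X > Ψ`. -/
def gb2Kernel {d : ℕ} (a b : ℝ) (Ω Ψ X : Ext d) : ℝ :=
  if (X - Ψ).PosDef then (X - Ψ).det ^ (a - (d + 1) / 2) * (Ω + X).det ^ (-(a + b)) else 0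

/-- Density `GB_d^II(X; a, b, Ω, Ψ)` at a positive definite `X`. -/
def gb2Pdf {d : ℕ} (a b : ℝ) (Ω Ψ X : Ext d) : ℝ :=
  gb2Kernel a b Ω Ψ X / ∫ Y, gb2Kernel a b Ω Ψ Y ∂extVolume d

/-- The generalized matrix-variate beta type II law. -/
def gb2Law {d : ℕ} (a b : ℝ) (Ω Ψ : Ext d) : Measure (Ext d) := lawOf (gb2Pdf a b Ω Ψ)

/-- The law with density `X ↦ ∫ k Y X dμ(Y)`. -/
def mixtureLaw {d : ℕ} (k : Ext d → Ext d → ℝ) (μ : Measure (Ext d)) : Measure (Ext d) :=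
  (extVolume d).withDensity fun X => ∫⁻ Y, ENNReal.ofReal (k Y X) ∂μ

/-! ### Moment matching -/

/-- `E[X]`, entrywise. -/
def meanMat {d : ℕ} (μ : Measure (Ext d)) : Ext d := Matrix.of fun i j => ∫ X, X i j ∂μ

/-- `E[X⁻¹]`, entrywise. -/
def meanInv {d : ℕ} (μ : Measure (Ext d)) : Ext d := Matrix.of fun i j => ∫ X, X⁻¹ i j ∂μ

/-- `E[X]` and `E[X⁻¹]` exist. -/
def HasMoments {d : ℕ} (μ : Measure (Ext d)) : Prop :=
  ∀ i j, Integrable (fun X : Ext d => X i j) μ ∧ Integrable (fun X : Ext d => X⁻¹ i j) μ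

/-- `W(w, W)` matches `E[X]` and `E[X⁻¹]` of `μ`. A Wishart law has both moments exactly for
`w > d + 1`. -/
def IsWishartMatch {d : ℕ} (μ : Measure (Ext d)) (w : ℝ) (W : Ext d) : Prop :=
  (d : ℝ) + 1 < w ∧ W.PosDef ∧ HasMoments μ ∧
    meanMat μ = meanMat (wishartLaw w W) ∧ meanInv μ = meanInv (wishartLaw w W)

/-- `IW(v, V)` matches `E[X]` and `E[X⁻¹]` of `μ`. An inverse Wishart law has both moments exactly
for `v > 2 d + 2`. -/
def IsIWMatch {d : ℕ} (μ : Measure (Ext d)) (v : ℝ) (V : Ext d) : Prop :=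
  2 * (d : ℝ) + 2 < v ∧ V.PosDef ∧ HasMoments μ ∧
    meanMat μ = meanMat (iwLaw v V) ∧ meanInv μ = meanInv (iwLaw v V)

/-- `W(h, H)` matches `E[X]` of `μ` and, in place of the full matrix `E[X⁻¹]` (which no Wishart law
need match), the scalar `tr{C (C - I)⁻¹}` with `C = E[X⁻¹] E[X]`. -/
def IsWishartTraceMatch {d : ℕ} (μ : Measure (Ext d)) (h : ℝ) (H : Ext d) : Prop :=
  (d : ℝ) + 1 < h ∧ H.PosDef ∧ HasMoments μ ∧
    meanMat μ = meanMat (wishartLaw h H) ∧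
    IsUnit (meanInv μ * meanMat μ - 1).det ∧
    (meanInv μ * meanMat μ * (meanInv μ * meanMat μ - 1)⁻¹).trace =
      (meanInv (wishartLaw h H) * meanMat (wishartLaw h H) *
        (meanInv (wishartLaw h H) * meanMat (wishartLaw h H) - 1)⁻¹).trace

/-- `μ` is a generalized beta type II law `GB_d^II(α, β, Ω, 0)`, and `IW(v, V)` matches its
`E[X]` and `E[X⁻¹]`. -/
def IsGB2ThenIW {d : ℕ} (μ : Measure (Ext d)) (v : ℝ) (V : Ext d) : Prop :=
  ∃ (α β : ℝ) (Ω : Ext d), ((d : ℝ) - 1) / 2 < α ∧ ((d : ℝ) - 1) / 2 < β ∧ Ω.PosDef ∧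
    μ = gb2Law α β Ω 0 ∧ IsIWMatch (gb2Law α β Ω 0) v V

/-! ### The factorized Gaussian inverse Wishart model -/

/-- The Gaussian density `N(x; m, P)` for positive definite `P`. -/
def gaussianPdf {nx : ℕ} (m : Kin nx) (P : Matrix (Fin nx) (Fin nx) ℝ) (x : Kin nx) : ℝ :=
  Real.exp (-(1 / 2) * ((x - m).ofLp ⬝ᵥ (P⁻¹ *ᵥ (x - m).ofLp))) /
    Real.sqrt ((2 * Real.pi) ^ nx * P.det)

/-- Parameters `(m, P, v, V)` of a factorized Gaussian inverse Wishart density. -/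
structure GIW (nx d : ℕ) where
  m : Kin nx
  P : Matrix (Fin nx) (Fin nx) ℝ
  v : ℝ
  V : Ext d

namespace GIW

variable {nx d : ℕ}

/-- Admissible parameters. -/
def Valid (θ : GIW nx d) : Prop := θ.P.PosSemidef ∧ 2 * (d : ℝ) < θ.v ∧ θ.V.PosDef

/-- The kinematic factor `N(m, P)` (possibly degenerate). -/
def kinLaw (θ : GIW nx d) : Measure (Kin nx) := multivariateGaussian θ.m θ.P

/-- The extent factor `IW(v, V)`. -/
def extLaw (θ : GIW nx d) : Measure (Ext d) := iwLaw θ.v θ.V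

/-- The law `N(m, P) ⊗ IW(v, V)` of the state `ξ = (x, X)`. -/
def law (θ : GIW nx d) : Measure (Kin nx × Ext d) := θ.kinLaw.prod θ.extLaw

/-- The density `N(x; m, P) IW(X; v, V)`, for positive definite `P`. -/
def pdf (θ : GIW nx d) (ξ : Kin nx × Ext d) : ℝ :=
  gaussianPdf θ.m θ.P ξ.1 * iwPdf θ.v θ.V ξ.2

end GIW

/-- Data of a Gaussian Wishart transition: motion model `f`, process noise covariance `Q`, degrees
of freedom `n`, and extent transformation `M`. -/
structure Transition (nx d : ℕ) where
  f : Kin nx → Kin nx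
  Q : Matrix (Fin nx) (Fin nx) ℝ
  n : ℝ
  M : Kin nx → Ext d

namespace Transition

variable {nx d : ℕ}

/-- Kinematic transition law `N(f(x), Q)`. -/
def kinLaw (T : Transition nx d) (x : Kin nx) : Measure (Kin nx) :=
  multivariateGaussian (T.f x) T.Q

/-- Extent transition law `W(n, M(x) X M(x)ᵀ / n)`. -/
def extLaw (T : Transition nx d) (x : Kin nx) (X : Ext d) : Measure (Ext d) :=
  wishartLaw T.n (T.n⁻¹ • (T.M x * X * (T.M x)ᵀ))

/-- The transition law from the state `ξ`. -/
def law (T : Transition nx d) (ξ : Kin nx × Ext d) : Measure (Kin nx × Ext d) :=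
  (T.kinLaw ξ.1).prod (T.extLaw ξ.1 ξ.2)

/-- The Jacobian matrix of the motion model at `m`. -/
def jacobian (T : Transition nx d) (m : Kin nx) : Matrix (Fin nx) (Fin nx) ℝ :=
  Matrix.of fun i j => fderiv ℝ T.f m (EuclideanSpace.single j 1) i

/-- The transition with motion model replaced by its first order expansion at `m`, as in the
(extended) Kalman prediction and RTS smoother; nothing changes if the motion model is affine. -/
def linearizeAt (T : Transition nx d) (m : Kin nx) : Transition nx d :=
  { T with f := fun x => T.f m + fderiv ℝ T.f m (x - m) }

end Transition

/-! ### Exact backward smoothing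

`filt`, `pred`, `fin` are the parameters of `p(ξ_k | Z_{1:k})`, `p(ξ_{k+1} | Z_{1:k})` and
`p(ξ_{k+1} | Z_{1:K})`. -/

section exact

variable {nx d : ℕ} (filt pred fin : GIW nx d) (T : Transition nx d)

/-- The law of `ξ_k` with density
`p(ξ_k | Z_{1:k}) ∫ p(ξ_{k+1} | ξ_k) p(ξ_{k+1} | Z_{1:K}) / p(ξ_{k+1} | Z_{1:k}) dξ_{k+1}`,
before normalization. -/
def smoothedUnnorm : Measure (Kin nx × Ext d) :=
  filt.law.withDensity fun ξ =>
    ∫⁻ ξ', ENNReal.ofReal (fin.pdf ξ' / pred.pdf ξ') ∂T.law ξ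

/-- The smoothed law of `ξ_k`. -/
def smoothed : Measure (Kin nx × Ext d) := normalize (smoothedUnnorm filt pred fin T)

/-- The kinematic smoothing equation: density
`p(x_k | Z_{1:k}) ∫ p(x_{k+1} | x_k) p(x_{k+1} | Z_{1:K}) / p(x_{k+1} | Z_{1:k}) dx_{k+1}`. -/
def kinSmoothed : Measure (Kin nx) :=
  filt.kinLaw.withDensity fun x =>
    ∫⁻ x', ENNReal.ofReal (gaussianPdf fin.m fin.P x' / gaussianPdf pred.m pred.P x') ∂T.kinLaw x

/-- The extent message
`∫ p(X_{k+1} | x, X) p(X_{k+1} | Z_{1:K}) / p(X_{k+1} | Z_{1:k}) dX_{k+1}`. -/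
def extMessage (x : Kin nx) (X : Ext d) : ℝ≥0∞ :=
  ∫⁻ Y, ENNReal.ofReal (iwPdf fin.v fin.V Y / iwPdf pred.v pred.V Y) ∂T.extLaw x X

/-- The extent message averaged over `p(X | Z_{1:k})`, as a function of `x`. -/
def extEvidence (x : Kin nx) : ℝ≥0∞ := ∫⁻ X, extMessage pred fin T x X ∂filt.extLaw

end exact

/-! ### The closed form approximation of the extent factor

Densities are combined up to constants, that is, each is normalized in its own argument. -/

section approx

variable {nx d : ℕ}

/-- The ratio `p(X_{k+1} | Z_{1:K}) / p(X_{k+1} | Z_{1:k})` of extent densities, normalized. -/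
def ratioLaw (pred fin : GIW nx d) : Measure (Ext d) :=
  normalize (lawOf fun Y => iwPdf fin.v fin.V Y / iwPdf pred.v pred.V Y)

/-- The transition density `W(Y; n, B X Bᵀ / n)` as a function of `X`, normalized. -/
def likelihoodLaw (n : ℝ) (B Y : Ext d) : Measure (Ext d) :=
  normalize (lawOf fun X => wishartPdf n (n⁻¹ • (B * X * Bᵀ)) Y)

/-- `IW(g, Γ)` is the approximation of the normalized extent message for the extent
transformation `B`: in the mixture over `Y ∼ ρ` of the likelihoods `X ↦ W(Y; n, B X Bᵀ / n)` each
likelihood is replaced by the Wishart law with the same `E[X]` and `E[X⁻¹]`, and the resulting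
mixture, a generalized beta type II law, by the inverse Wishart law with the same `E[X]` and
`E[X⁻¹]`. -/
def IsMessageApprox (ρ : Measure (Ext d)) (n : ℝ) (B : Ext d) (g : ℝ) (Γ : Ext d) : Prop :=
  ∃ (a : ℝ) (A : Ext d → Ext d),
    (∀ Y : Ext d, Y.PosDef → IsWishartMatch (likelihoodLaw n B Y) a (A Y)) ∧
    IsGB2ThenIW (mixtureLaw (fun Y => wishartPdf a (A Y)) ρ) g Γ

/-- `IW(g₂, V₂)` is the approximation of the extent message averaged over the kinematic law `κ`:
the messages for `M(x)` are approximated by `IW(g, Γ(x))`; the law of `Γ(x)`, `x ∼ κ`, is replaced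
by a Wishart law; and the resulting mixture, a generalized beta type II law, by the
inverse Wishart law with the same `E[X]` and `E[X⁻¹]`. -/
def IsAveragedMessageApprox (ρ : Measure (Ext d)) (n : ℝ) (M : Kin nx → Ext d)
    (κ : Measure (Kin nx)) (g₂ : ℝ) (V₂ : Ext d) : Prop :=
  ∃ (g : ℝ) (Γ : Kin nx → Ext d) (h : ℝ) (H : Ext d),
    (∀ x, IsMessageApprox ρ n (M x) g (Γ x)) ∧
    IsWishartTraceMatch (κ.map Γ) h H ∧
    IsGB2ThenIW (mixtureLaw (fun G => iwPdf g G) (wishartLaw h H)) g₂ V₂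

/-- The filtered extent density times the approximate message `IW(g, G)`, normalized. -/
def extPosterior (filt : GIW nx d) (g : ℝ) (G : Ext d) : Measure (Ext d) :=
  normalize (lawOf fun X => iwPdf filt.v filt.V X * iwPdf g G X)

/-- `ν` is the factorized smoothed law obtained for a constant extent transformation `A`. -/
def IsFactorizedSmoothingConst (filt pred fin : GIW nx d) (T : Transition nx d) (A : Ext d)
    (ν : Measure (Kin nx × Ext d)) : Prop :=
  ∃ (g : ℝ) (G : Ext d), IsMessageApprox (ratioLaw pred fin) T.n A g G ∧
    ν = (kinSmoothed filt pred fin T).prod (extPosterior filt g G)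

/-- `ν` is the factorized smoothed law obtained for a state dependent extent transformation. -/
def IsFactorizedSmoothing (filt pred fin : GIW nx d) (T : Transition nx d)
    (ν : Measure (Kin nx × Ext d)) : Prop :=
  ∃ (g : ℝ) (G : Ext d),
    IsAveragedMessageApprox (ratioLaw pred fin) T.n T.M (kinSmoothed filt pred fin T) g G ∧
    ν = (kinSmoothed filt pred fin T).prod (extPosterior filt g G)

end approx

/-! ### The closed form parameters -/

section table

variable {nx d : ℕ} (filt pred fin : GIW nx d) (T : Transition nx d)

/-- The gain `G = P_{k|k} F̃ᵀ P_{k+1|k}⁻¹`. -/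
def gain : Matrix (Fin nx) (Fin nx) ℝ :=
  filt.P * (T.jacobian filt.m)ᵀ * pred.P⁻¹

/-- `m_{k|K} = m_{k|k} + G (m_{k+1|K} - m_{k+1|k})`. -/
def smoothMean : Kin nx :=
  filt.m + WithLp.toLp 2 (gain filt pred T *ᵥ (fin.m - pred.m).ofLp)

/-- `P_{k|K} = P_{k|k} - G (P_{k+1|k} - P_{k+1|K}) Gᵀ`. -/
def smoothCov : Matrix (Fin nx) (Fin nx) ℝ :=
  filt.P - gain filt pred T * (pred.P - fin.P) * (gain filt pred T)ᵀ

/-- `w = v_{k+1|K} - v_{k+1|k}`. -/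
def dofDiff : ℝ := fin.v - pred.v

/-- `W = V_{k+1|K} - V_{k+1|k}`. -/
def scaleDiff : Ext d := fin.V - pred.V

/-- `η₁ = 1 + (w - 3(d+1)) / n`; it is `η` in the constant case. -/
def eta1 : ℝ := 1 + (dofDiff pred fin - 3 * ((d : ℝ) + 1)) / T.n

/-- `g = η₁⁻¹ (w - 2(d+1)²/n)`. -/
def gPar : ℝ := (eta1 pred fin T)⁻¹ * (dofDiff pred fin - 2 * ((d : ℝ) + 1) ^ 2 / T.n)

/-- Smoothed parameters for a constant extent transformation `A`. -/
def tableConst (A : Ext d) : GIW nx d where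
  m := smoothMean filt pred fin T
  P := smoothCov filt pred fin T
  v := filt.v + (eta1 pred fin T)⁻¹ * (dofDiff pred fin - 2 * ((d : ℝ) + 1) ^ 2 / T.n)
  V := filt.V + (eta1 pred fin T)⁻¹ • (A⁻¹ * scaleDiff pred fin * (A⁻¹)ᵀ)

/-- `N(m_{k|K}, P_{k|K})`, under which `C₃` and `C₄` are computed. -/
def smoothKin : Measure (Kin nx) :=
  multivariateGaussian (smoothMean filt pred fin T) (smoothCov filt pred fin T)

/-- `M(x)ᵀ W⁻¹ M(x)`. -/
def c3Fun (x : Kin nx) : Ext d := (T.M x)ᵀ * (scaleDiff pred fin)⁻¹ * T.M x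

/-- `M(x)⁻¹ W M(x)⁻ᵀ`. -/
def c4Fun (x : Kin nx) : Ext d := (T.M x)⁻¹ * scaleDiff pred fin * ((T.M x)⁻¹)ᵀ

/-- `C₃ = E_{k|K}[M(x)ᵀ W⁻¹ M(x)]`. -/
def C3 : Ext d := Matrix.of fun i j => ∫ x, c3Fun pred fin T x i j ∂smoothKin filt pred fin T

/-- `C₄ = E_{k|K}[M(x)⁻¹ W M(x)⁻ᵀ]`. -/
def C4 : Ext d := Matrix.of fun i j => ∫ x, c4Fun pred fin T x i j ∂smoothKin filt pred fin T

/-- `h = (d+1)/d · tr{C₃ C₄ (C₃ C₄ - I)⁻¹}`. -/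
def hPar : ℝ :=
  ((d : ℝ) + 1) / d *
    (C3 filt pred fin T * C4 filt pred fin T *
      (C3 filt pred fin T * C4 filt pred fin T - 1)⁻¹).trace

/-- `η₂ = 1 + (g - 3d - 3) / (h + d + 1)`. -/
def eta2 : ℝ := 1 + (gPar pred fin T - 3 * (d : ℝ) - 3) / (hPar filt pred fin T + d + 1)

/-- `η₃ = 1 + (g - d - 1) / (h - d - 1)`. -/
def eta3 : ℝ := 1 + (gPar pred fin T - d - 1) / (hPar filt pred fin T - d - 1)

/-- Smoothed parameters for a state dependent extent transformation. -/
def tableGeneral : GIW nx d where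
  m := smoothMean filt pred fin T
  P := smoothCov filt pred fin T
  v := filt.v + (eta2 filt pred fin T)⁻¹ *
    (gPar pred fin T - 2 * ((d : ℝ) + 1) ^ 2 / (hPar filt pred fin T + d + 1))
  V := filt.V + ((eta1 pred fin T)⁻¹ * (eta3 filt pred fin T)⁻¹) • C4 filt pred fin T

end table

end GIWSmoothing

end

/-! Both the transition law and the ratio of the smoothed to the predicted density at time k+1
factor into a kinematic and an extent part. Integrating out ξ_{k+1} therefore gives a function of x
alone times the extent message L(x,X). So, up to a constant, the smoothed law is κ ⊗ IW(v_{k|k},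
V_{k|k}) with density L, where κ is the kinematic smoothed law (`smoothedUnnorm_eq`), and its
marginals follow from Tonelli. The message is the average, over a probability law, of a multiple of
a bounded inverse Wishart density (`exists_iwPdf_le`, `extMessage_le`). Hence the law is
normalizable and its mutual information is finite, and the identity KL(s‖q₁⊗q₂) = KL(s₁‖q₁) +
KL(s₂‖q₂) + KL(s‖s₁⊗s₂) (`klDiv_prod_eq`) leaves the pair of marginals as the only minimizer.

Kinematics: the filtered joint law of (x, y = Fx + noise) can be run backwards as y ∼ N(m_{k+1|k},
P_{k+1|k}), x = Gy + independent Gaussian error (`map_forward_eq_map_backward`). Weighting by the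
density ratio in y merely replaces the law of y, and the law of x becomes the RTS smoother.
Characteristic functions are used because P and Q may be singular.

Extent: whenever both E[X] and E[X⁻¹] are matched, they are multiples of Ψ and of Ψ⁻¹ for a single
positive definite Ψ. Matching then fixes the scale up to a scalar and leaves one scalar equation for
the degrees of freedom (`isIWMatch_iff`, `isWishartMatch_iff`). The mixtures are conjugate integrals
(`mixtureLaw_wishartPdf`, `mixtureLaw_iwPdf`). For the average over x, Jensen's inequality for the
matrix inverse (`posSemidef_matMean_inv_sub`) puts the matched trace above d, hence h above d+1, so
that the required Wishart law exists.

All of this rests on the first moments of X and X⁻¹ under a Wishart law. They come from three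
substitutions on the cone: congruence, inversion, and splitting off the first row by a Schur
complement (`lintegral_conj`, `lintegral_inv`, `lintegral_schur`). -/

noncomputable section

namespace GIWSmoothing

/-! ### Measurability and coordinates on the positive definite cone. -/

section Basic

variable {d : ℕ}

instance extBorelSpace (d : ℕ) : BorelSpace (Ext d) :=
  inferInstanceAs (BorelSpace (Fin d → Fin d → ℝ))

instance extSecondCountable (d : ℕ) : SecondCountableTopology (Ext d) :=
  inferInstanceAs (SecondCountableTopology (Fin d → Fin d → ℝ))

instance extStandardBorel (d : ℕ) : StandardBorelSpace (Ext d) :=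
  inferInstanceAs (StandardBorelSpace (Fin d → Fin d → ℝ))

lemma measurable_ext_iff {α : Type*} [MeasurableSpace α] {f : α → Ext d} :
    Measurable f ↔ ∀ i j, Measurable fun x => f x i j := by
  constructor
  · intro h i j
    exact (measurable_pi_apply j).comp ((measurable_pi_apply i).comp h)
  · intro h
    exact measurable_pi_lambda _ fun i => measurable_pi_lambda _ fun j => h i j

lemma measurable_entry (i j : Fin d) : Measurable fun X : Ext d => X i j :=
  measurable_ext_iff.1 measurable_id i j

lemma measurable_det : Measurable fun X : Ext d => X.det :=
  (continuous_id.matrix_det).measurable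

lemma measurable_inv : Measurable fun X : Ext d => X⁻¹ := by
  rw [measurable_ext_iff]
  intro i j
  have h : (fun X : Ext d => X⁻¹ i j) = fun X : Ext d => (X.det)⁻¹ * X.adjugate i j := by
    ext X
    rw [Matrix.inv_def, Ring.inverse_eq_inv']
    rfl
  rw [h]
  exact measurable_det.inv.mul ((continuous_id.matrix_adjugate.matrix_elem i j).measurable)

lemma measurable_conj (B : Ext d) : Measurable fun X : Ext d => B * X * Bᵀ :=
  (by fun_prop : Continuous fun X : Ext d => B * X * Bᵀ).measurable

lemma isClosed_posSemidef : IsClosed {X : Ext d | X.PosSemidef} := by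
  have : {X : Ext d | X.PosSemidef} =
      {X | Xᴴ = X} ∩ ⋂ u : Fin d → ℝ, {X | 0 ≤ star u ⬝ᵥ X *ᵥ u} := by
    ext X
    simp [Matrix.posSemidef_iff_dotProduct_mulVec, Matrix.IsHermitian]
  rw [this]
  refine (isClosed_eq (by fun_prop) continuous_id).inter (isClosed_iInter fun u => ?_)
  exact isClosed_le continuous_const (by fun_prop)

lemma posDef_iff_posSemidef_det {X : Ext d} : X.PosDef ↔ X.PosSemidef ∧ X.det ≠ 0 := by
  constructor
  · exact fun h => ⟨h.posSemidef, h.det_pos.ne'⟩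
  · rintro ⟨h1, h2⟩
    exact h1.posDef_iff_isUnit.2 ((Matrix.isUnit_iff_isUnit_det _).2 (isUnit_iff_ne_zero.2 h2))

lemma measurableSet_posDef : MeasurableSet {X : Ext d | X.PosDef} := by
  have : {X : Ext d | X.PosDef} = {X | X.PosSemidef} ∩ {X | X.det ≠ 0} := by
    ext X; exact posDef_iff_posSemidef_det
  rw [this]
  exact isClosed_posSemidef.measurableSet.inter
    (measurable_det (measurableSet_singleton 0).compl)

/-- The entries on and above the diagonal. -/
def upper (X : Ext d) : {p : Fin d × Fin d // p.1 ≤ p.2} → ℝ := fun p => X p.1.1 p.1.2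

lemma upper_symOfUpper (u : {p : Fin d × Fin d // p.1 ≤ p.2} → ℝ) : upper (symOfUpper u) = u := by
  ext ⟨⟨i, j⟩, h⟩
  simp only [upper, symOfUpper, Matrix.of_apply]
  congr 2
  exact Prod.ext (min_eq_left h) (max_eq_right h)

lemma symOfUpper_upper {X : Ext d} (hX : X.IsSymm) : symOfUpper (upper X) = X := by
  ext i j
  simp only [upper, symOfUpper, Matrix.of_apply]
  rcases le_total i j with h | h
  · rw [min_eq_left h, max_eq_right h]
  · rw [min_eq_right h, max_eq_left h, hX.apply]

lemma isSymm_symOfUpper (u : {p : Fin d × Fin d // p.1 ≤ p.2} → ℝ) : (symOfUpper u).IsSymm := by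
  ext i j
  simp only [symOfUpper, Matrix.transpose_apply, Matrix.of_apply]
  congr 2
  exact Prod.ext (min_comm _ _) (max_comm _ _)

lemma _root_.Matrix.PosDef.isSymm {X : Ext d} (hX : X.PosDef) : X.IsSymm := by
  have := hX.isHermitian
  rwa [Matrix.IsHermitian, Matrix.conjTranspose_eq_transpose_of_trivial] at this

lemma measurable_symOfUpper : Measurable (symOfUpper (d := d)) :=
  measurable_ext_iff.2 fun _ _ => measurable_pi_apply _

/-- By Lusin–Souslin, an injective measurable map between standard Borel spaces is an embedding.
This lets integrals over the cone be read in coordinates, even for a nonmeasurable integrand. -/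
lemma measurableEmbedding_symOfUpper : MeasurableEmbedding (symOfUpper (d := d)) := by
  refine measurable_symOfUpper.measurableEmbedding fun u v h => ?_
  rw [← upper_symOfUpper u, h, upper_symOfUpper]

/-- The coordinates of positive definite matrices. -/
def posSet (d : ℕ) : Set ({p : Fin d × Fin d // p.1 ≤ p.2} → ℝ) := {u | (symOfUpper u).PosDef}

lemma measurableSet_posSet : MeasurableSet (posSet d) := measurable_symOfUpper measurableSet_posDef

lemma lintegral_extVolume (g : Ext d → ℝ≥0∞) :
    ∫⁻ X, g X ∂extVolume d = ∫⁻ u in posSet d, g (symOfUpper u) := by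
  rw [extVolume, measurableEmbedding_symOfUpper.restrict_map,
    measurableEmbedding_symOfUpper.lintegral_map]
  rfl

lemma ae_extVolume_posDef : ∀ᵐ X ∂extVolume d, X.PosDef :=
  ae_restrict_mem measurableSet_posDef

instance sFinite_extVolume : SFinite (extVolume d) := by
  unfold extVolume; infer_instance

end Basic

/-! ### The Jacobian |det B|^(d+1) of a congruence on symmetric matrices. -/

section Jacobian

variable {d : ℕ}

/-- `X ↦ B X Bᵀ` in the coordinates of symmetric matrices. -/
def conjUpper (B : Ext d) :
    ({p : Fin d × Fin d // p.1 ≤ p.2} → ℝ) →ₗ[ℝ] ({p : Fin d × Fin d // p.1 ≤ p.2} → ℝ) where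
  toFun u := upper (B * symOfUpper u * Bᵀ)
  map_add' u v := by
    have : symOfUpper (u + v) = symOfUpper u + symOfUpper v := rfl
    rw [this, mul_add, add_mul]; rfl
  map_smul' c u := by
    have : symOfUpper (c • u) = c • symOfUpper u := rfl
    rw [this, Matrix.mul_smul, Matrix.smul_mul]; rfl

lemma isSymm_conj (B : Ext d) {X : Ext d} (hX : X.IsSymm) : (B * X * Bᵀ).IsSymm := by
  rw [Matrix.IsSymm, Matrix.transpose_mul, Matrix.transpose_mul, Matrix.transpose_transpose,
    hX.eq, mul_assoc]

lemma symOfUpper_conjUpper (B : Ext d) (u) :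
    symOfUpper (conjUpper B u) = B * symOfUpper u * Bᵀ :=
  symOfUpper_upper (isSymm_conj B (isSymm_symOfUpper u))

lemma conjUpper_mul (A B : Ext d) : conjUpper (A * B) = conjUpper A ∘ₗ conjUpper B := by
  refine LinearMap.ext fun u => ?_
  change upper (A * B * symOfUpper u * (A * B)ᵀ) = upper (A * symOfUpper (conjUpper B u) * Aᵀ)
  rw [symOfUpper_conjUpper, Matrix.transpose_mul]
  simp only [mul_assoc]

/-- A fixed index i meets every j once among the pairs with i ≤ j or j ≤ i, and the diagonal pair
counts twice. So it occurs d + 1 times. -/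
lemma prod_upper (l : Fin d → ℝ) :
    ∏ p : {p : Fin d × Fin d // p.1 ≤ p.2}, l p.1.1 * l p.1.2 = (∏ i, l i) ^ (d + 1) := by
  classical
  have h1 : ∏ p : {p : Fin d × Fin d // p.1 ≤ p.2}, l p.1.1 * l p.1.2 =
      ∏ p : Fin d × Fin d, if p.1 ≤ p.2 then l p.1 * l p.2 else 1 := by
    rw [← Finset.prod_filter]
    exact (Finset.prod_subtype _ (by simp) (fun p : Fin d × Fin d => l p.1 * l p.2)).symm
  have h2 : ∀ i j : Fin d, (if i ≤ j then l i * l j else 1) =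
      (if i ≤ j then l i else 1) * (if i ≤ j then l j else 1) := by
    intro i j; split_ifs <;> simp
  have h3 : ∀ i j : Fin d, (if i ≤ j then l i else 1) * (if j ≤ i then l i else 1) =
      l i * if i = j then l i else 1 := by
    intro i j
    rcases lt_trichotomy i j with h | h | h
    · simp [h.le, h.not_ge, h.ne]
    · simp [h]
    · simp [h.le, h.not_ge, h.ne']
  rw [h1, Fintype.prod_prod_type]
  simp only [h2, Finset.prod_mul_distrib]
  rw [Finset.prod_comm (f := fun i j : Fin d => if i ≤ j then l j else 1),
    ← Finset.prod_mul_distrib]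
  simp only [← Finset.prod_mul_distrib, h3]
  simp only [Finset.prod_mul_distrib, Finset.prod_ite_eq, Finset.mem_univ, if_true,
    Finset.prod_const, Finset.card_univ, Fintype.card_fin, pow_succ, Finset.prod_pow]

lemma det_conjUpper_diagonal (l : Fin d → ℝ) :
    LinearMap.det (conjUpper (Matrix.diagonal l)) = (∏ i, l i) ^ (d + 1) := by
  have : LinearMap.toMatrix' (conjUpper (Matrix.diagonal l)) =
      Matrix.diagonal fun p => l p.1.1 * l p.1.2 := by
    ext p q
    rw [LinearMap.toMatrix'_apply]
    have h : ∀ u p, conjUpper (Matrix.diagonal l) u p = l p.1.1 * l p.1.2 * u p := by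
      intro u p
      show (Matrix.diagonal l * symOfUpper u * (Matrix.diagonal l)ᵀ) p.1.1 p.1.2 = _
      rw [Matrix.diagonal_transpose, Matrix.mul_diagonal, Matrix.diagonal_mul]
      have := congrFun (upper_symOfUpper u) p
      rw [upper] at this
      rw [this]; ring
    rw [h, Matrix.diagonal_apply, Pi.single_apply]
    split_ifs <;> simp
  rw [← LinearMap.det_toMatrix', this, Matrix.det_diagonal, prod_upper]

/-- Both sides are multiplicative in B, so diagonal matrices and transvections suffice. The former
act diagonally on the coordinates; the latter must be shown to act with determinant one. -/
lemma det_conjUpper {B : Ext d} (hB : B.det ≠ 0) :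
    LinearMap.det (conjUpper B) = B.det ^ (d + 1) := by
  refine Matrix.diagonal_transvection_induction_of_det_ne_zero
    (fun B => LinearMap.det (conjUpper B) = B.det ^ (d + 1)) B hB (fun D _ => ?_) (fun t => ?_)
    (fun A B _ _ hA hB => ?_)
  · rw [det_conjUpper_diagonal, Matrix.det_diagonal]
  · classical
    -- Rescaling row i by 2 conjugates a transvection into its square. Its determinant on symmetric
    -- matrices thus equals its own square and, being nonzero, is 1.
    set E : Ext d := Matrix.diagonal fun k => if k = t.i then 2 else 1
    have hE : E * t.toMatrix = t.toMatrix * t.toMatrix * E := by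
      have h1 : t.toMatrix * t.toMatrix = Matrix.transvection t.i t.j (t.c + t.c) :=
        Matrix.transvection_mul_transvection_same _ _ t.hij _ _
      rw [h1]
      ext a b
      simp only [E, Matrix.TransvectionStruct.toMatrix, Matrix.transvection, Matrix.diagonal_mul,
        Matrix.mul_diagonal, Matrix.add_apply, Matrix.single_apply, Matrix.one_apply]
      have := t.hij
      grind
    have hdet := congrArg (fun A => LinearMap.det (conjUpper A)) hE
    simp only [conjUpper_mul, LinearMap.det_comp] at hdet
    have hE0 : LinearMap.det (conjUpper E) ≠ 0 := by
      rw [det_conjUpper_diagonal]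
      refine pow_ne_zero _ (Finset.prod_ne_zero_iff.2 fun i _ => ?_)
      split_ifs <;> norm_num
    have ht0 : LinearMap.det (conjUpper t.toMatrix) ≠ 0 := by
      have h1 : t.toMatrix * t.inv.toMatrix = 1 := t.mul_inv
      have h2 := congrArg (fun A => LinearMap.det (conjUpper A)) h1
      simp only [conjUpper_mul, LinearMap.det_comp] at h2
      have h3 : LinearMap.det (conjUpper (1 : Ext d)) = 1 := by
        have := det_conjUpper_diagonal (d := d) (fun _ => 1)
        rw [Matrix.diagonal_one] at this
        simpa using this
      rw [h3] at h2
      exact left_ne_zero_of_mul_eq_one h2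
    have : LinearMap.det (conjUpper t.toMatrix) = 1 := by
      apply mul_left_cancel₀ (mul_ne_zero hE0 ht0)
      linear_combination -hdet
    rw [this, t.det, one_pow]
  · rw [conjUpper_mul, LinearMap.det_comp, hA, hB, Matrix.det_mul, mul_pow]

lemma posDef_conj_iff {B X : Ext d} (hB : B.det ≠ 0) : (B * X * Bᵀ).PosDef ↔ X.PosDef := by
  have hu : IsUnit B := (Matrix.isUnit_iff_isUnit_det _).2 (isUnit_iff_ne_zero.2 hB)
  have := Matrix.IsUnit.posDef_star_right_conjugate_iff (x := X) hu
  rwa [Matrix.star_eq_conjTranspose, Matrix.conjTranspose_eq_transpose_of_trivial] at this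

lemma injective_of_det_ne_zero {ι : Type*} [Fintype ι] {f : (ι → ℝ) →ₗ[ℝ] (ι → ℝ)}
    (h : LinearMap.det f ≠ 0) : Function.Injective f :=
  (LinearMap.equivOfDetNeZero f h).injective

/-- Change of variables for a bijection of the cone onto itself; it serves both congruence and
inversion. -/
lemma lintegral_coordinates {φ : ({p : Fin d × Fin d // p.1 ≤ p.2} → ℝ) → _}
    {φ' : ({p : Fin d × Fin d // p.1 ≤ p.2} → ℝ) → _ →L[ℝ] _}
    (hφ' : ∀ u ∈ posSet d, HasFDerivWithinAt φ (φ' u) (posSet d) u)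
    (hinj : Set.InjOn φ (posSet d)) (himg : φ '' posSet d = posSet d) (g : Ext d → ℝ≥0∞) :
    ∫⁻ X, g X ∂extVolume d =
      ∫⁻ u in posSet d, ENNReal.ofReal |(φ' u).det| * g (symOfUpper (φ u)) := by
  rw [lintegral_extVolume]
  conv_lhs => rw [← himg]
  exact lintegral_image_eq_lintegral_abs_det_fderiv_mul volume measurableSet_posSet hφ' hinj
    (fun u => g (symOfUpper u))

lemma lintegral_conj {B : Ext d} (hB : B.det ≠ 0) (g : Ext d → ℝ≥0∞) :
    ∫⁻ X, g X ∂extVolume d =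
      ENNReal.ofReal (|B.det| ^ (d + 1)) * ∫⁻ X, g (B * X * Bᵀ) ∂extVolume d := by
  have hdet := det_conjUpper hB
  have hdet0 : LinearMap.det (conjUpper B) ≠ 0 := by rw [hdet]; exact pow_ne_zero _ hB
  rw [lintegral_coordinates (φ := conjUpper B)
    (φ' := fun _ => LinearMap.toContinuousLinearMap (conjUpper B))
    (fun u _ => (LinearMap.toContinuousLinearMap (conjUpper B)).hasFDerivWithinAt)
    (injective_of_det_ne_zero hdet0).injOn]
  · rw [lintegral_extVolume, ← lintegral_const_mul' _ _ ENNReal.ofReal_ne_top]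
    simp only [symOfUpper_conjUpper, LinearMap.det_toContinuousLinearMap, hdet, abs_pow]
  · have hpre : conjUpper B ⁻¹' posSet d = posSet d := by
      ext u
      simp only [posSet, Set.mem_preimage, Set.mem_ofPred_eq, symOfUpper_conjUpper,
        posDef_conj_iff hB]
    conv_lhs => rw [← hpre]
    exact Set.image_preimage_eq _ (LinearMap.equivOfDetNeZero _ hdet0).surjective

end Jacobian

/-! ### The Jacobian det(X)^(-(d+1)) of matrix inversion. -/

section Inversion

variable {d : ℕ}

-- The norm serves only to differentiate the ring inverse.
attribute [local instance] Matrix.linftyOpNormedRing Matrix.linftyOpNormedAlgebra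

/-- The derivative of inversion at X is V ↦ -X⁻¹VX⁻¹. By symmetry of X⁻¹ this is minus a congruence,
whose determinant is already known. -/
lemma hasFDerivAt_inv_upper {u : {p : Fin d × Fin d // p.1 ≤ p.2} → ℝ} (hu : u ∈ posSet d) :
    HasFDerivAt (fun u => upper (symOfUpper u)⁻¹)
      (-LinearMap.toContinuousLinearMap (conjUpper (symOfUpper u)⁻¹)) u := by
  let sym : ({p : Fin d × Fin d // p.1 ≤ p.2} → ℝ) →ₗ[ℝ] Ext d :=
    { toFun := symOfUpper, map_add' := fun _ _ => rfl, map_smul' := fun _ _ => rfl }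
  let up : Ext d →ₗ[ℝ] ({p : Fin d × Fin d // p.1 ≤ p.2} → ℝ) :=
    { toFun := upper, map_add' := fun _ _ => rfl, map_smul' := fun _ _ => rfl }
  obtain ⟨x, hx⟩ : IsUnit (symOfUpper u) := Matrix.PosDef.isUnit hu
  have h1 : HasFDerivAt (fun u => symOfUpper u) (LinearMap.toContinuousLinearMap sym) u :=
    (LinearMap.toContinuousLinearMap sym).hasFDerivAt
  have h2 := hasFDerivAt_ringInverse (𝕜 := ℝ) x
  rw [hx] at h2
  have h3 := (LinearMap.toContinuousLinearMap up).hasFDerivAt.comp u (h2.comp u h1)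
  have hxi : ((x⁻¹ : (Ext d)ˣ) : Ext d) = (symOfUpper u)⁻¹ := by
    rw [Matrix.coe_units_inv, hx]
  refine (h3.congr_fderiv ?_).congr_of_eventuallyEq ?_
  · ext1 v
    have hs : (symOfUpper u)⁻¹ᵀ = (symOfUpper u)⁻¹ := by
      rw [Matrix.transpose_nonsing_inv, (isSymm_symOfUpper u).eq]
    change upper (-(((x⁻¹ : (Ext d)ˣ) : Ext d) * symOfUpper v * ((x⁻¹ : (Ext d)ˣ) : Ext d))) =
      -upper ((symOfUpper u)⁻¹ * symOfUpper v * (symOfUpper u)⁻¹ᵀ)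
    rw [hxi, hs]; rfl
  · refine Filter.Eventually.of_forall fun v => ?_
    change upper _ = upper _
    rw [Matrix.nonsing_inv_eq_ringInverse]; rfl

lemma lintegral_inv (g : Ext d → ℝ≥0∞) :
    ∫⁻ X, g X ∂extVolume d =
      ∫⁻ X, ENNReal.ofReal ((X.det ^ (d + 1))⁻¹) * g X⁻¹ ∂extVolume d := by
  have key : ∀ u ∈ posSet d, symOfUpper (upper (symOfUpper u)⁻¹) = (symOfUpper u)⁻¹ :=
    fun u hu => symOfUpper_upper (Matrix.PosDef.inv hu).isSymm
  have hmaps : ∀ u ∈ posSet d, upper (symOfUpper u)⁻¹ ∈ posSet d := fun u hu => by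
    change (symOfUpper _).PosDef
    rw [key u hu]; exact Matrix.PosDef.inv hu
  have hinvol : ∀ u ∈ posSet d, upper (symOfUpper (upper (symOfUpper u)⁻¹))⁻¹ = u :=
    fun u hu => by
      rw [key u hu, Matrix.nonsing_inv_nonsing_inv _
        ((Matrix.isUnit_iff_isUnit_det _).1 (Matrix.PosDef.isUnit hu)), upper_symOfUpper]
  rw [lintegral_coordinates (fun u hu => (hasFDerivAt_inv_upper hu).hasFDerivWithinAt),
    lintegral_extVolume]
  · refine setLIntegral_congr_fun measurableSet_posSet fun u hu => ?_
    have hpos : 0 < (symOfUpper u).det := Matrix.PosDef.det_pos hu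
    have hdet : (symOfUpper u)⁻¹.det = ((symOfUpper u).det)⁻¹ := by
      rw [Matrix.det_nonsing_inv, Ring.inverse_eq_inv']
    rw [key u hu]
    congr 2
    rw [ContinuousLinearMap.det, ContinuousLinearMap.toLinearMap_neg, ← neg_one_smul ℝ,
      LinearMap.det_smul, LinearMap.coe_toContinuousLinearMap,
      det_conjUpper (by rw [hdet]; exact inv_ne_zero hpos.ne'), hdet, abs_mul, abs_pow, abs_neg,
      abs_one, one_pow, one_mul, inv_pow, abs_of_pos (by positivity)]
  · intro u hu v hv h
    rw [← hinvol u hu, ← hinvol v hv]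
    simp only at h
    rw [h]
  · ext u
    constructor
    · rintro ⟨v, hv, rfl⟩; exact hmaps v hv
    · exact fun hu => ⟨_, hmaps u hu, hinvol u hu⟩

end Inversion

/-! ### Splitting off the first row by the Schur complement. -/

section Schur

variable {d : ℕ}

/-- The symmetric matrix with first row `(x, b)` and remaining block `C`. -/
def bordered (x : ℝ) (b : Fin d → ℝ) (C : Ext d) : Ext (d + 1) :=
  Matrix.of (Fin.cons (Fin.cons x b) fun i => Fin.cons (b i) (C i))

@[simp] lemma bordered_zero_zero (x : ℝ) (b : Fin d → ℝ) (C : Ext d) : bordered x b C 0 0 = x := rfl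

@[simp] lemma bordered_zero_succ (x : ℝ) (b : Fin d → ℝ) (C : Ext d) (j : Fin d) :
    bordered x b C 0 j.succ = b j := rfl

@[simp] lemma bordered_succ_zero (x : ℝ) (b : Fin d → ℝ) (C : Ext d) (i : Fin d) :
    bordered x b C i.succ 0 = b i := rfl

@[simp] lemma bordered_succ_succ (x : ℝ) (b : Fin d → ℝ) (C : Ext d) (i j : Fin d) :
    bordered x b C i.succ j.succ = C i j := rfl

/-- `Fin (d + 1)` as a sum, with `0` split off. -/
def finSuccSum (d : ℕ) : Fin (d + 1) ≃ Unit ⊕ Fin d where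
  toFun := Fin.cases (Sum.inl ()) Sum.inr
  invFun := Sum.elim (fun _ => 0) Fin.succ
  left_inv i := by cases i using Fin.cases <;> rfl
  right_inv i := by rcases i with i | i <;> rfl

lemma bordered_eq_submatrix (x : ℝ) (b : Fin d → ℝ) (C : Ext d) :
    bordered x b C = (Matrix.fromBlocks (Matrix.of fun _ _ : Unit => x)
      (Matrix.replicateCol Unit b)ᴴ (Matrix.replicateCol Unit b) C).submatrix
        (finSuccSum d) (finSuccSum d) := by
  ext i j
  cases i using Fin.cases <;> cases j using Fin.cases <;>
    simp [finSuccSum]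

lemma schur_entry (x : ℝ) (b : Fin d → ℝ) (C : Ext d) :
    (Matrix.of fun _ _ : Unit => x) - (Matrix.replicateCol Unit b)ᴴ * C⁻¹ *
      Matrix.replicateCol Unit b = Matrix.of fun _ _ : Unit => x - b ⬝ᵥ C⁻¹ *ᵥ b := by
  ext i j
  rw [Matrix.mul_assoc]
  simp [Matrix.mul_apply, dotProduct, Matrix.mulVec]

lemma det_bordered {C : Ext d} (hC : C.PosDef) (x : ℝ) (b : Fin d → ℝ) :
    (bordered x b C).det = C.det * (x - b ⬝ᵥ C⁻¹ *ᵥ b) := by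
  have : Invertible C := hC.isUnit.invertible
  rw [bordered_eq_submatrix, Matrix.det_submatrix_equiv_self, Matrix.det_fromBlocks₂₂,
    Matrix.invOf_eq_nonsing_inv, schur_entry]
  simp

/-- The block criterion gives semidefiniteness with a weak inequality. Definiteness adds a nonzero
determinant, which by `det_bordered` makes the inequality strict. -/
lemma posDef_bordered_iff (x : ℝ) (b : Fin d → ℝ) (C : Ext d) :
    (bordered x b C).PosDef ↔ C.PosDef ∧ b ⬝ᵥ C⁻¹ *ᵥ b < x := by
  by_cases hC : C.PosDef
  · have : Invertible C := hC.isUnit.invertible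
    have h1 : (bordered x b C).PosSemidef ↔ b ⬝ᵥ C⁻¹ *ᵥ b ≤ x := by
      rw [bordered_eq_submatrix, Matrix.posSemidef_submatrix_equiv,
        show (Matrix.replicateCol Unit b) = ((Matrix.replicateCol Unit b)ᴴ)ᴴ from
          (Matrix.conjTranspose_conjTranspose _).symm, Matrix.conjTranspose_conjTranspose,
        Matrix.PosDef.fromBlocks₂₂ _ _ hC, Matrix.conjTranspose_conjTranspose, schur_entry]
      have : (Matrix.of fun _ _ : Unit => x - b ⬝ᵥ C⁻¹ *ᵥ b) =
          Matrix.diagonal fun _ : Unit => x - b ⬝ᵥ C⁻¹ *ᵥ b := by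
        ext i j; simp
      rw [this, Matrix.posSemidef_diagonal_iff]
      simp
    rw [posDef_iff_posSemidef_det, h1, det_bordered hC]
    simp only [hC, true_and, ne_eq, mul_eq_zero, hC.det_pos.ne', false_or, sub_eq_zero]
    exact ⟨fun h => lt_of_le_of_ne h.1 (Ne.symm h.2), fun h => ⟨h.le, h.ne'⟩⟩
  · refine iff_of_false (fun h => hC ?_) (fun h => hC h.1)
    exact h.submatrix (Fin.succ_injective d)

/-- The cofactor of the corner entry is det C, which cancels against the factor in `det_bordered`.
-/
lemma inv_bordered_zero_zero {C : Ext d} (hC : C.PosDef) {x : ℝ} {b : Fin d → ℝ} :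
    (bordered x b C)⁻¹ 0 0 = (x - b ⬝ᵥ C⁻¹ *ᵥ b)⁻¹ := by
  rw [Matrix.inv_def, Ring.inverse_eq_inv', det_bordered hC, Matrix.smul_apply,
    Matrix.adjugate_fin_succ_eq_det_submatrix]
  have : (bordered x b C).submatrix (Fin.succAbove 0) (Fin.succAbove 0) = C := by
    ext i j; simp
  rw [this, mul_inv]
  have := hC.det_pos.ne'
  simp only [Fin.val_zero, add_zero, pow_zero, one_mul, smul_eq_mul]
  field_simp

/-- The upper triangular index set with its first row split off. -/
def upperIndex (d : ℕ) : Unit ⊕ (Fin d ⊕ {p : Fin d × Fin d // p.1 ≤ p.2}) ≃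
    {p : Fin (d + 1) × Fin (d + 1) // p.1 ≤ p.2} where
  toFun := Sum.elim (fun _ => ⟨(0, 0), le_rfl⟩) (Sum.elim (fun j => ⟨(0, j.succ), Fin.zero_le _⟩)
    fun p => ⟨(p.1.1.succ, p.1.2.succ), Fin.succ_le_succ_iff.2 p.2⟩)
  invFun := fun ⟨⟨i, j⟩, h⟩ => by
    refine Fin.cases (motive := fun i => i ≤ j → _) (fun _ => ?_) (fun i h => ?_) i h
    · exact Fin.cases (Sum.inl ()) (fun j => Sum.inr (Sum.inl j)) j
    · refine Fin.cases (motive := fun j => i.succ ≤ j → _) (fun _ => Sum.inl ()) (fun j h => ?_) j h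
      exact Sum.inr (Sum.inr ⟨(i, j), Fin.succ_le_succ_iff.1 h⟩)
  left_inv := by rintro (_ | _ | _) <;> rfl
  right_inv := by
    rintro ⟨⟨i, j⟩, h⟩
    cases i using Fin.cases with
    | zero => cases j using Fin.cases <;> rfl
    | succ i =>
      cases j using Fin.cases with
      | zero => exact absurd h (by simp)
      | succ j => rfl

/-- Splitting off the first row in the coordinates of symmetric matrices. -/
def borderEquiv (d : ℕ) :
    (ℝ × ((Fin d → ℝ) × ({p : Fin d × Fin d // p.1 ≤ p.2} → ℝ))) ≃ᵐ
      ({p : Fin (d + 1) × Fin (d + 1) // p.1 ≤ p.2} → ℝ) :=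
  ((MeasurableEquiv.funUnique Unit ℝ).symm.prodCongr
    (MeasurableEquiv.sumPiEquivProdPi fun _ => ℝ).symm).trans
    ((MeasurableEquiv.sumPiEquivProdPi fun _ => ℝ).symm.trans
      (MeasurableEquiv.piCongrLeft (fun _ => ℝ) (upperIndex d)))

lemma measurePreserving_borderEquiv (d : ℕ) : MeasurePreserving (borderEquiv d) := by
  refine (volume_measurePreserving_piCongrLeft (fun _ => ℝ) (upperIndex d)).comp
    ((volume_measurePreserving_sumPiEquivProdPi_symm fun _ => ℝ).comp ?_)
  exact ((volume_preserving_funUnique Unit ℝ).symm _).prod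
    (volume_measurePreserving_sumPiEquivProdPi_symm fun _ => ℝ)

lemma borderEquiv_apply (x : ℝ) (b : Fin d → ℝ) (c) (i) :
    borderEquiv d (x, b, c) (upperIndex d i) = Sum.elim (fun _ => x) (Sum.elim b c) i := by
  change Equiv.piCongrLeft (fun _ => ℝ) (upperIndex d) _ (upperIndex d i) = _
  rw [Equiv.piCongrLeft_apply_apply]
  rcases i with i | i | i <;> rfl

lemma symOfUpper_borderEquiv (x : ℝ) (b : Fin d → ℝ) (c) :
    symOfUpper (borderEquiv d (x, b, c)) = bordered x b (symOfUpper c) := by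
  have hb : (bordered x b (symOfUpper c)).IsSymm := by
    ext i j
    have := isSymm_symOfUpper c
    cases i using Fin.cases <;> cases j using Fin.cases <;> simp [this.apply]
  rw [← symOfUpper_upper hb]
  congr 1
  ext p
  obtain ⟨i, rfl⟩ := (upperIndex d).surjective p
  rw [borderEquiv_apply]
  rcases i with i | i | i
  · rfl
  · rfl
  · exact (congrFun (upper_symOfUpper c) i).symm

/-- Over a fixed positive definite block C and row b, the cone is the half line of corner entries x
above bᵀC⁻¹b. Integrals over the cone thus reduce, one dimension at a time, to integrals of gamma
type in x. -/
lemma lintegral_schur {g : Ext (d + 1) → ℝ≥0∞} (hg : Measurable g) :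
    ∫⁻ X, g X ∂extVolume (d + 1) = ∫⁻ C, (∫⁻ b : Fin d → ℝ,
      ∫⁻ x in Set.Ioi (b ⬝ᵥ C⁻¹ *ᵥ b), g (bordered x b C)) ∂extVolume d := by
  have hF : Measurable ((posSet (d + 1)).indicator fun u => g (symOfUpper u)) :=
    (hg.comp measurable_symOfUpper).indicator measurableSet_posSet
  have hG : Measurable fun z => (posSet (d + 1)).indicator (fun u => g (symOfUpper u))
      (borderEquiv d z) := hF.comp (borderEquiv d).measurable
  rw [lintegral_extVolume, ← lintegral_indicator measurableSet_posSet,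
    ← (measurePreserving_borderEquiv d).lintegral_comp hF, Measure.volume_eq_prod,
    lintegral_prod_symm _ hG.aemeasurable, Measure.volume_eq_prod,
    lintegral_prod_symm _ (hG.lintegral_prod_left').aemeasurable, lintegral_extVolume,
    ← lintegral_indicator measurableSet_posSet]
  refine lintegral_congr fun c => ?_
  by_cases hc : c ∈ posSet d
  · rw [Set.indicator_of_mem hc]
    refine lintegral_congr fun b => ?_
    rw [← lintegral_indicator measurableSet_Ioi]
    refine lintegral_congr fun x => ?_
    have hiff : borderEquiv d (x, b, c) ∈ posSet (d + 1) ↔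
        b ⬝ᵥ (symOfUpper c)⁻¹ *ᵥ b < x := by
      change (symOfUpper _).PosDef ↔ _
      rw [symOfUpper_borderEquiv, posDef_bordered_iff]
      exact and_iff_right hc
    by_cases hx : b ⬝ᵥ (symOfUpper c)⁻¹ *ᵥ b < x
    · rw [Set.indicator_of_mem (Set.mem_Ioi.2 hx),
        Set.indicator_of_mem (hiff.2 hx), symOfUpper_borderEquiv]
    · rw [Set.indicator_of_notMem (fun h => hx (hiff.1 h)),
        Set.indicator_of_notMem (fun h => hx (Set.mem_Ioi.1 h))]
  · rw [Set.indicator_of_notMem hc]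
    have : ∀ b x, (posSet (d + 1)).indicator (fun u => g (symOfUpper u))
        (borderEquiv d (x, b, c)) = 0 := by
      intro b x
      refine Set.indicator_of_notMem (fun h => hc ?_) _
      change (symOfUpper _).PosDef at h
      rw [symOfUpper_borderEquiv, posDef_bordered_iff] at h
      exact h.1
    simp [this]

end Schur

/-! ### One dimensional gamma and Gaussian integrals. -/

section GammaIntegral

lemma lintegral_Ioi_rpow_mul_exp {a r : ℝ} (ha : 0 < a) (hr : 0 < r) (q : ℝ) :
    ∫⁻ x in Set.Ioi q, ENNReal.ofReal ((x - q) ^ (a - 1) * Real.exp (-(r * (x - q)))) =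
      ENNReal.ofReal ((1 / r) ^ a * Real.Gamma a) := by
  have h0 : ∫⁻ x in Set.Ioi q, ENNReal.ofReal ((x - q) ^ (a - 1) * Real.exp (-(r * (x - q)))) =
      ∫⁻ x in Set.Ioi (0 : ℝ), ENNReal.ofReal (x ^ (a - 1) * Real.exp (-(r * x))) := by
    rw [← lintegral_indicator measurableSet_Ioi, ← lintegral_indicator measurableSet_Ioi,
      ← lintegral_sub_right_eq_self (Set.indicator (Set.Ioi (0 : ℝ)) _) q]
    refine lintegral_congr fun x => ?_
    simp only [Set.indicator, Set.mem_Ioi, sub_pos]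
  have hint : IntegrableOn (fun x : ℝ => x ^ (a - 1) * Real.exp (-(r * x))) (Set.Ioi 0) := by
    have := integrableOn_rpow_mul_exp_neg_mul_rpow (p := 1) (s := a - 1) (b := r) (by linarith)
      one_pos hr
    simpa [neg_mul] using this
  rw [h0, ← Real.integral_rpow_mul_exp_neg_mul_Ioi ha hr, ofReal_integral_eq_lintegral_ofReal hint]
  filter_upwards [ae_restrict_mem measurableSet_Ioi] with x hx
  exact mul_nonneg (Real.rpow_nonneg (le_of_lt hx) _) (Real.exp_pos _).le

lemma lintegral_pi_exp_neg_sq {d : ℕ} {c : ℝ} (hc : 0 < c) :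
    ∫⁻ b : Fin d → ℝ, ENNReal.ofReal (Real.exp (-(c * (b ⬝ᵥ b)))) =
      ENNReal.ofReal (√(Real.pi / c) ^ d) := by
  have h1 : ∀ b : Fin d → ℝ, Real.exp (-(c * (b ⬝ᵥ b))) = ∏ i, Real.exp (-c * b i ^ 2) := by
    intro b
    rw [← Real.exp_sum]
    congr 1
    simp only [dotProduct, Finset.mul_sum, ← Finset.sum_neg_distrib]
    exact Finset.sum_congr rfl fun i _ => by ring
  simp only [h1]
  rw [← ofReal_integral_eq_lintegral_ofReal]
  · rw [integral_fintype_prod_volume_eq_prod (fun (_ : Fin d) x => Real.exp (-c * x ^ 2))]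
    rw [Finset.prod_const, integral_gaussian, Finset.card_univ, Fintype.card_fin]
  · exact Integrable.fintype_prod (f := fun (_ : Fin d) x => Real.exp (-c * x ^ 2))
      fun _ => integrable_exp_neg_mul_sq hc
  · exact Filter.Eventually.of_forall fun b => Finset.prod_nonneg fun i _ => (Real.exp_pos _).le

end GammaIntegral

/-! ### Finiteness of the Wishart integral, by induction on the dimension. -/

section Finite

variable {d : ℕ}

/-- Cauchy–Schwarz for the form C gives b_i² ≤ C_ii · bᵀC⁻¹b; sum over i. It allows the Gaussian
integral over b to be bounded by an isotropic one. -/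
lemma sq_le_trace_mul {C : Ext d} (hC : C.PosDef) (b : Fin d → ℝ) :
    b ⬝ᵥ b ≤ C.trace * (b ⬝ᵥ C⁻¹ *ᵥ b) := by
  have hdet : IsUnit C.det := isUnit_iff_ne_zero.2 hC.det_pos.ne'
  set y := C⁻¹ *ᵥ b with hy
  have hb : C *ᵥ y = b := by
    rw [hy, Matrix.mulVec_mulVec, Matrix.mul_nonsing_inv _ hdet, Matrix.one_mulVec]
  have key : ∀ i, b i * b i ≤ C i i * (b ⬝ᵥ y) := by
    intro i
    have hq : ∀ s : ℝ, 0 ≤ C i i * (s * s) + 2 * b i * s + b ⬝ᵥ y := by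
      intro s
      -- Expanding this square gives a polynomial in s that is never negative; its discriminant
      -- yields the bound.
      have h := hC.posSemidef.dotProduct_mulVec_nonneg (y + s • Pi.single i 1)
      have hs : y ⬝ᵥ C *ᵥ Pi.single i 1 = b i := by
        rw [Matrix.dotProduct_mulVec, ← Matrix.mulVec_transpose, hC.isSymm.eq, hb]
        simp
      rw [star_trivial, Matrix.mulVec_add, Matrix.mulVec_smul, hb, add_dotProduct, dotProduct_add,
        dotProduct_add, smul_dotProduct, smul_dotProduct, dotProduct_smul, dotProduct_smul, hs,
        dotProduct_comm y b] at h
      simp only [single_one_dotProduct, smul_eq_mul, Matrix.mulVec_single_one, Matrix.col_apply]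
        at h
      linarith
    have := discrim_le_zero hq
    rw [discrim] at this
    nlinarith
  rw [Matrix.trace, Finset.sum_mul]
  exact Finset.sum_le_sum fun i _ => key i

lemma trace_bordered (x : ℝ) (b : Fin d → ℝ) (C : Ext d) :
    (bordered x b C).trace = x + C.trace := by
  simp [Matrix.trace, Fin.sum_univ_succ]

lemma measurable_trace : Measurable fun X : Ext d => X.trace :=
  (by fun_prop : Continuous fun X : Ext d => X.trace).measurable

/-- The Gaussian integral over b grows only polynomially in τ = tr C, so half of the available
exponential decay absorbs it. The rate t/(2(d+1)) is chosen so that its d-th power costs at most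
t/2, also for d = 0. -/
lemma sqrt_pow_le_exp {t : ℝ} (ht : 0 < t) (d : ℕ) :
    ∃ A : ℝ, 0 ≤ A ∧ ∀ τ : ℝ, 0 ≤ τ → √(Real.pi / (t / τ)) ^ d ≤ A * Real.exp (t / 2 * τ) := by
  set a := Real.pi / t
  set s := t / (2 * (d + 1))
  have ha : 0 < a := by positivity
  have hs : 0 < s := by positivity
  refine ⟨max 1 (a / s) ^ d, by positivity, fun τ hτ => ?_⟩
  have h1 : √(Real.pi / (t / τ)) ≤ max 1 (a / s) * Real.exp (s * τ) := by
    have e1 : Real.pi / (t / τ) = a * τ := by simp only [a]; field_simp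
    rw [e1]
    have e2 : √(a * τ) ≤ 1 + a * τ := by
      rw [Real.sqrt_le_left (by positivity)]
      nlinarith [mul_nonneg ha.le hτ]
    have e3 := Real.add_one_le_exp (s * τ)
    have e4 : (1 : ℝ) ≤ max 1 (a / s) := le_max_left _ _
    have e5 : a ≤ max 1 (a / s) * s := by
      rw [← div_le_iff₀ hs]; exact le_max_right _ _
    calc √(a * τ) ≤ 1 + a * τ := e2
      _ ≤ max 1 (a / s) * (s * τ + 1) := by nlinarith
      _ ≤ _ := by gcongr
  calc √(Real.pi / (t / τ)) ^ d ≤ (max 1 (a / s) * Real.exp (s * τ)) ^ d := by gcongr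
    _ = max 1 (a / s) ^ d * Real.exp (d * (s * τ)) := by rw [mul_pow, ← Real.exp_nat_mul]
    _ ≤ _ := by
      refine mul_le_mul_of_nonneg_left (Real.exp_le_exp.2 ?_) (by positivity)
      have : (d : ℝ) * s ≤ t / 2 := by
        simp only [s]
        rw [mul_div_assoc', div_le_div_iff₀ (by positivity) (by positivity)]
        nlinarith
      calc (d : ℝ) * (s * τ) = d * s * τ := by ring
        _ ≤ _ := by gcongr

/-- In Schur coordinates the x integral is a gamma integral and leaves det(C)^(a-1) unchanged. The b
integral costs a power of tr C, paid for by halving t, so the induction must hold for every t. -/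
lemma lintegral_det_rpow_lt_top (d : ℕ) {a t : ℝ} (ha : 0 < a) (ht : 0 < t) :
    ∫⁻ X, ENNReal.ofReal (X.det ^ (a - 1) * Real.exp (-(t * X.trace))) ∂extVolume d < ∞ := by
  induction d generalizing t with
  | zero =>
    have : IsFiniteMeasure (extVolume 0) := by
      unfold extVolume
      have : IsEmpty {p : Fin 0 × Fin 0 // p.1 ≤ p.2} := ⟨fun p => p.1.1.elim0⟩
      rw [volume_pi, Measure.pi_of_empty (x := fun i => 0)]
      infer_instance
    simp
  | succ d ih =>
    obtain ⟨A, hA, hAexp⟩ := sqrt_pow_le_exp ht d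
    set K := (1 / t) ^ a * Real.Gamma a
    have hmeas : Measurable fun X : Ext (d + 1) =>
        ENNReal.ofReal (X.det ^ (a - 1) * Real.exp (-(t * X.trace))) :=
      ((measurable_det.pow_const _).mul
        (measurable_trace.const_mul t).neg.exp).ennreal_ofReal
    rw [lintegral_schur hmeas]
    calc _ ≤ ∫⁻ C, ENNReal.ofReal (K * A) *
          ENNReal.ofReal (C.det ^ (a - 1) * Real.exp (-(t / 2 * C.trace))) ∂extVolume d := by
          refine lintegral_mono_ae ?_
          filter_upwards [ae_extVolume_posDef] with C hC
          have hdet := hC.det_pos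
          have htr : 0 ≤ C.trace := hC.posSemidef.trace_nonneg
          have inner : ∀ b : Fin d → ℝ, ∫⁻ x in Set.Ioi (b ⬝ᵥ C⁻¹ *ᵥ b), ENNReal.ofReal
              ((bordered x b C).det ^ (a - 1) * Real.exp (-(t * (bordered x b C).trace))) =
              ENNReal.ofReal (K * (C.det ^ (a - 1) * Real.exp (-(t * C.trace))) *
                Real.exp (-(t * (b ⬝ᵥ C⁻¹ *ᵥ b)))) := by
            intro b
            set q := b ⬝ᵥ C⁻¹ *ᵥ b
            have : ∀ x ∈ Set.Ioi q, ENNReal.ofReal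
                ((bordered x b C).det ^ (a - 1) * Real.exp (-(t * (bordered x b C).trace))) =
                ENNReal.ofReal (C.det ^ (a - 1) * Real.exp (-(t * C.trace)) *
                  Real.exp (-(t * q))) *
                ENNReal.ofReal ((x - q) ^ (a - 1) * Real.exp (-(t * (x - q)))) := by
              intro x hx
              rw [← ENNReal.ofReal_mul (by positivity), det_bordered hC, trace_bordered,
                Real.mul_rpow hdet.le (sub_nonneg.2 (le_of_lt hx)),
                show -(t * (x + C.trace)) = -(t * C.trace) + -(t * q) + -(t * (x - q)) by ring,
                Real.exp_add, Real.exp_add]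
              congr 1; ring
            rw [setLIntegral_congr_fun measurableSet_Ioi this,
              lintegral_const_mul' _ _ ENNReal.ofReal_ne_top,
              lintegral_Ioi_rpow_mul_exp ha ht, ← ENNReal.ofReal_mul (by positivity)]
            congr 1; ring
          have hK : 0 ≤ K := mul_nonneg (by positivity) (Real.Gamma_nonneg_of_nonneg ha.le)
          simp only [inner]
          rcases htr.eq_or_lt with h0 | h0
          · -- the trace vanishes only in dimension zero
            have hd : C = 0 := (Matrix.PosSemidef.trace_eq_zero_iff hC.posSemidef).1 h0.symm
            have hempty : IsEmpty (Fin d) := by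
              by_contra hne
              rw [not_isEmpty_iff] at hne
              rw [hd, Matrix.det_zero] at hdet
              exact lt_irrefl _ hdet
            have hA1 : 1 ≤ A := by
              -- In dimension zero the left side of the bound is a zeroth power, so it says 1 ≤ A.
              have := hAexp 0 le_rfl
              have hd0 : d = 0 :=
                (Fintype.card_fin d).symm.trans (Fintype.card_eq_zero_iff.2 hempty)
              simpa [hd0] using this
            have hb : ∀ b : Fin d → ℝ, b ⬝ᵥ C⁻¹ *ᵥ b = 0 := fun b => by simp [dotProduct]
            simp only [hb, mul_zero, neg_zero, Real.exp_zero, mul_one, lintegral_const, ← h0]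
            rw [← ENNReal.ofReal_mul (by positivity)]
            have hv : (volume : Measure (Fin d → ℝ)) Set.univ = 1 := by
              rw [volume_pi, Measure.pi_of_empty (x := fun i => 0)]
              simp
            rw [hv, mul_one]
            refine ENNReal.ofReal_le_ofReal ?_
            have : 0 ≤ K * C.det ^ (a - 1) := by positivity
            nlinarith
          · have hle : ∀ b : Fin d → ℝ, ENNReal.ofReal
                (K * (C.det ^ (a - 1) * Real.exp (-(t * C.trace))) *
                Real.exp (-(t * (b ⬝ᵥ C⁻¹ *ᵥ b)))) ≤
                ENNReal.ofReal (K * (C.det ^ (a - 1) * Real.exp (-(t * C.trace)))) *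
                ENNReal.ofReal (Real.exp (-(t / C.trace * (b ⬝ᵥ b)))) := by
              intro b
              rw [← ENNReal.ofReal_mul (by positivity)]
              refine ENNReal.ofReal_le_ofReal ?_
              refine mul_le_mul_of_nonneg_left (Real.exp_le_exp.2 (neg_le_neg ?_)) (by positivity)
              have := sq_le_trace_mul hC b
              rw [div_mul_eq_mul_div, div_le_iff₀ h0]
              nlinarith
            refine (lintegral_mono hle).trans ?_
            rw [lintegral_const_mul' _ _ ENNReal.ofReal_ne_top,
              lintegral_pi_exp_neg_sq (by positivity), ← ENNReal.ofReal_mul (by positivity),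
              ← ENNReal.ofReal_mul (by positivity)]
            refine ENNReal.ofReal_le_ofReal ?_
            have e : Real.exp (-(t / 2 * C.trace)) =
                Real.exp (-(t * C.trace)) * Real.exp (t / 2 * C.trace) := by
              rw [← Real.exp_add]; congr 1; ring
            rw [e]
            calc _ ≤ K * (C.det ^ (a - 1) * Real.exp (-(t * C.trace))) *
                  (A * Real.exp (t / 2 * C.trace)) := by
                  gcongr; exact hAexp _ htr
              _ = _ := by ring
      _ < ∞ := by
        rw [lintegral_const_mul' _ _ ENNReal.ofReal_ne_top]
        exact ENNReal.mul_lt_top ENNReal.ofReal_lt_top (ih (by positivity))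

/-- In Schur coordinates every half line has infinite length, so positivity of the volume passes
from C to the bordered matrix. Dimension zero is a single point of mass one. -/
lemma extVolume_ne_zero (d : ℕ) : extVolume d Set.univ ≠ 0 := by
  induction d with
  | zero =>
    have hu : {X : Ext 0 | X.PosDef} = Set.univ :=
      Set.eq_univ_of_forall fun X => Subsingleton.elim (1 : Ext 0) X ▸ Matrix.PosDef.one
    have : IsEmpty {p : Fin 0 × Fin 0 // p.1 ≤ p.2} := ⟨fun p => p.1.1.elim0⟩
    rw [extVolume, hu, Measure.restrict_univ,
      Measure.map_apply measurable_symOfUpper MeasurableSet.univ, Set.preimage_univ, volume_pi,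
      Measure.pi_of_empty (x := fun i => 0)]
    simp
  | succ d ih =>
    rw [← setLIntegral_one, setLIntegral_univ, lintegral_schur measurable_const]
    simpa [NeZero.ne] using ih

end Finite

/-! ### Symmetric factorization of positive matrices. -/

section Factor

open scoped MatrixOrder

lemma exists_eq_mul_transpose {ι : Type*} [Fintype ι] [DecidableEq ι] {S : Matrix ι ι ℝ}
    (hS : S.PosSemidef) : ∃ B : Matrix ι ι ℝ, S = B * Bᵀ := by
  refine ⟨CFC.sqrt S, ?_⟩
  have h := (CFC.sqrt_nonneg S).isSelfAdjoint
  rw [IsSelfAdjoint, Matrix.star_eq_conjTranspose,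
    Matrix.conjTranspose_eq_transpose_of_trivial] at h
  rw [h, CFC.sqrt_mul_sqrt_self S hS.nonneg]

lemma _root_.Matrix.PosDef.exists_eq_mul_transpose {d : ℕ} {S : Ext d} (hS : S.PosDef) :
    ∃ B : Ext d, B.det ≠ 0 ∧ S = B * Bᵀ := by
  obtain ⟨B, hB⟩ := GIWSmoothing.exists_eq_mul_transpose hS.posSemidef
  refine ⟨B, fun h => hS.det_pos.ne' ?_, hB⟩
  rw [hB, Matrix.det_mul, h, zero_mul]

end Factor

/-! ### Normalizing constants and transformation rules of Wishart and inverse Wishart laws. -/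

section Laws

variable {d : ℕ}

lemma measurable_wishartKernel (n : ℝ) (S : Ext d) : Measurable (wishartKernel n S) := by
  unfold wishartKernel
  have : Measurable fun X : Ext d => (S⁻¹ * X).trace :=
    (by fun_prop : Continuous fun X : Ext d => (S⁻¹ * X).trace).measurable
  exact (measurable_det.pow_const _).mul (this.const_mul _).exp

lemma measurable_iwKernel (v : ℝ) (V : Ext d) : Measurable (iwKernel v V) := by
  unfold iwKernel
  have : Measurable fun X : Ext d => (X⁻¹ * V).trace :=
    (by fun_prop : Continuous fun X : Ext d => (X * V).trace).measurable.comp measurable_inv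
  exact (measurable_det.pow_const _).mul (this.const_mul _).exp

lemma wishartKernel_pos (n : ℝ) (S : Ext d) {X : Ext d} (hX : X.PosDef) :
    0 < wishartKernel n S X :=
  mul_pos (Real.rpow_pos_of_pos hX.det_pos _) (Real.exp_pos _)

lemma iwKernel_pos (v : ℝ) (V : Ext d) {X : Ext d} (hX : X.PosDef) : 0 < iwKernel v V X :=
  mul_pos (Real.rpow_pos_of_pos hX.det_pos _) (Real.exp_pos _)

lemma rpow_abs_sq (x e : ℝ) : (x * x) ^ (e / 2) = |x| ^ e := by
  rw [← abs_mul_abs_self, ← sq, ← Real.rpow_natCast, ← Real.rpow_mul (abs_nonneg x)]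
  congr 1; push_cast; ring

lemma inv_conj {B X : Ext d} : (B * X * Bᵀ)⁻¹ = B⁻¹ᵀ * X⁻¹ * B⁻¹ := by
  rw [Matrix.mul_inv_rev, Matrix.mul_inv_rev, Matrix.transpose_nonsing_inv, mul_assoc]

lemma det_conj (B X : Ext d) : (B * X * Bᵀ).det = B.det * B.det * X.det := by
  rw [Matrix.det_mul, Matrix.det_mul, Matrix.det_transpose]; ring

lemma wishartKernel_conj (n : ℝ) (S : Ext d) {B X : Ext d} (hB : B.det ≠ 0) (hX : X.PosDef) :
    wishartKernel n (B * S * Bᵀ) (B * X * Bᵀ) =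
      |B.det| ^ (n - d - 1) * wishartKernel n S X := by
  have hu : IsUnit B.det := isUnit_iff_ne_zero.2 hB
  rw [wishartKernel, wishartKernel, det_conj, Real.mul_rpow (mul_self_nonneg _) hX.det_pos.le,
    rpow_abs_sq, inv_conj, mul_assoc]
  congr 4
  have : B⁻¹ᵀ * S⁻¹ * B⁻¹ * (B * X * Bᵀ) = B⁻¹ᵀ * (S⁻¹ * X * Bᵀ) := by
    simp only [Matrix.mul_assoc, Matrix.nonsing_inv_mul_cancel_left _ _ hu]
  rw [this, Matrix.trace_mul_comm, Matrix.mul_assoc, ← Matrix.transpose_mul,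
    Matrix.nonsing_inv_mul _ hu, Matrix.transpose_one, Matrix.mul_one]

/-- The integral of the Wishart kernel with unit scale. -/
def wishartZ (d : ℕ) (n : ℝ) : ℝ := ∫ Y : Ext d, wishartKernel n 1 Y ∂extVolume d

/-- The exponent (n-d-1)/2 equals a - 1 with a = (n-d+1)/2, and a > 0 is exactly n > d - 1.
Positivity holds because the kernel is positive on the cone, which has nonzero volume. The value, a
multivariate gamma function, is never needed. -/
lemma lintegral_wishartKernel_one {n : ℝ} (hn : (d : ℝ) - 1 < n) :
    ∫⁻ X, ENNReal.ofReal (wishartKernel n 1 X) ∂extVolume d = ENNReal.ofReal (wishartZ d n) ∧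
      0 < wishartZ d n := by
  have hfin : ∫⁻ X, ENNReal.ofReal (wishartKernel n (1 : Ext d) X) ∂extVolume d < ∞ := by
    have := lintegral_det_rpow_lt_top d (a := (n - d + 1) / 2) (t := 1 / 2) (by linarith)
      (by norm_num)
    refine lt_of_eq_of_lt (lintegral_congr fun X => ?_) this
    rw [wishartKernel, inv_one, one_mul, neg_mul]
    congr 3; ring
  have hnn : 0 ≤ᵐ[extVolume d] wishartKernel n (1 : Ext d) := by
    filter_upwards [ae_extVolume_posDef] with X hX
    exact (wishartKernel_pos n 1 hX).le
  have hint : Integrable (wishartKernel n (1 : Ext d)) (extVolume d) :=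
    ⟨(measurable_wishartKernel n 1).aestronglyMeasurable, by
      rwa [hasFiniteIntegral_iff_ofReal hnn]⟩
  refine ⟨(ofReal_integral_eq_lintegral_ofReal hint hnn).symm, ?_⟩
  rw [wishartZ, integral_pos_iff_support_of_nonneg_ae hnn hint]
  refine lt_of_lt_of_le (pos_iff_ne_zero.2 (extVolume_ne_zero d)) ?_
  rw [← measure_inter_add_sdiff Set.univ measurableSet_posDef]
  have h0 : extVolume d (Set.univ \ {X | X.PosDef}) = 0 :=
    measure_mono_null (fun X hX => hX.2) (ae_iff.1 (ae_extVolume_posDef (d := d)))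
  rw [h0, add_zero]
  exact measure_mono fun X hX => (wishartKernel_pos n 1 hX.2).ne'

/-- With S = BBᵀ, the congruence by B reduces to unit scale. The Jacobian |det B|^(d+1) and the
factor |det B|^(n-d-1) of the kernel combine to |det B|^n = det(S)^(n/2). -/
lemma lintegral_wishartKernel {n : ℝ} (hn : (d : ℝ) - 1 < n) {S : Ext d} (hS : S.PosDef) :
    ∫⁻ X, ENNReal.ofReal (wishartKernel n S X) ∂extVolume d =
      ENNReal.ofReal (S.det ^ (n / 2) * wishartZ d n) := by
  obtain ⟨B, hB, rfl⟩ := hS.exists_eq_mul_transpose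
  have h0 : 0 < |B.det| := abs_pos.2 hB
  rw [lintegral_conj hB]
  have : ∀ᵐ X ∂extVolume d, ENNReal.ofReal (wishartKernel n (B * Bᵀ) (B * X * Bᵀ)) =
      ENNReal.ofReal (|B.det| ^ (n - d - 1)) * ENNReal.ofReal (wishartKernel n 1 X) := by
    filter_upwards [ae_extVolume_posDef] with X hX
    rw [← ENNReal.ofReal_mul (by positivity), ← wishartKernel_conj n 1 hB hX, Matrix.mul_one]
  rw [lintegral_congr_ae this, lintegral_const_mul' _ _ ENNReal.ofReal_ne_top,
    (lintegral_wishartKernel_one hn).1, ← ENNReal.ofReal_mul (by positivity),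
    ← ENNReal.ofReal_mul (by positivity), Matrix.det_mul, Matrix.det_transpose, rpow_abs_sq,
    ← mul_assoc, ← Real.rpow_natCast, ← Real.rpow_add h0]
  congr 3; push_cast; ring

lemma integral_wishartKernel {n : ℝ} (hn : (d : ℝ) - 1 < n) {S : Ext d} (hS : S.PosDef) :
    ∫ X, wishartKernel n S X ∂extVolume d = S.det ^ (n / 2) * wishartZ d n := by
  have hnn : 0 ≤ᵐ[extVolume d] wishartKernel n S := by
    filter_upwards [ae_extVolume_posDef] with X hX
    exact (wishartKernel_pos n S hX).le
  rw [integral_eq_lintegral_of_nonneg_ae hnn (measurable_wishartKernel n S).aestronglyMeasurable,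
    lintegral_wishartKernel hn hS, ENNReal.toReal_ofReal]
  exact mul_nonneg (Real.rpow_nonneg hS.det_pos.le _) (lintegral_wishartKernel_one hn).2.le

lemma wishartPdf_eq {n : ℝ} (hn : (d : ℝ) - 1 < n) {S : Ext d} (hS : S.PosDef) (X : Ext d) :
    wishartPdf n S X = wishartKernel n S X / (S.det ^ (n / 2) * wishartZ d n) := by
  rw [wishartPdf, integral_wishartKernel hn hS]

/-- With the Jacobian of inversion, the exponent v/2 - (d+1) equals ((v-d-1)-d-1)/2. This is the
source of the shift v ↦ v - d - 1 between the two families. -/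
lemma iwKernel_inv (v : ℝ) (V : Ext d) {X : Ext d} (hX : X.PosDef) (hV : V.PosDef) :
    (X.det ^ (d + 1))⁻¹ * iwKernel v V X⁻¹ = wishartKernel (v - d - 1) V⁻¹ X := by
  have hdet := hX.det_pos
  rw [iwKernel, wishartKernel, Matrix.det_nonsing_inv, Ring.inverse_eq_inv',
    Matrix.nonsing_inv_nonsing_inv _ (isUnit_iff_ne_zero.2 hdet.ne'),
    Matrix.nonsing_inv_nonsing_inv _ (isUnit_iff_ne_zero.2 hV.det_pos.ne'),
    Matrix.trace_mul_comm, ← mul_assoc, Real.inv_rpow hdet.le, ← Real.rpow_neg hdet.le,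
    ← Real.rpow_natCast, ← Real.rpow_neg hdet.le, ← Real.rpow_add hdet]
  congr 2; push_cast; ring

lemma lintegral_iwKernel_mul (v : ℝ) {V : Ext d} (hV : V.PosDef) (F : Ext d → ℝ≥0∞) :
    ∫⁻ X, ENNReal.ofReal (iwKernel v V X) * F X ∂extVolume d =
      ∫⁻ X, ENNReal.ofReal (wishartKernel (v - d - 1) V⁻¹ X) * F X⁻¹ ∂extVolume d := by
  rw [lintegral_inv]
  refine lintegral_congr_ae ?_
  filter_upwards [ae_extVolume_posDef] with X hX
  have hdet := hX.det_pos
  rw [← mul_assoc, ← ENNReal.ofReal_mul (by positivity), iwKernel_inv v V hX hV]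

lemma lintegral_iwKernel {v : ℝ} (hv : 2 * (d : ℝ) < v) {V : Ext d} (hV : V.PosDef) :
    ∫⁻ X, ENNReal.ofReal (iwKernel v V X) ∂extVolume d =
      ENNReal.ofReal (V⁻¹.det ^ ((v - d - 1) / 2) * wishartZ d (v - d - 1)) := by
  have := lintegral_iwKernel_mul v hV fun _ => 1
  simp only [mul_one] at this
  rw [this, lintegral_wishartKernel (by linarith) hV.inv]

lemma integral_iwKernel {v : ℝ} (hv : 2 * (d : ℝ) < v) {V : Ext d} (hV : V.PosDef) :
    ∫ X, iwKernel v V X ∂extVolume d =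
      V⁻¹.det ^ ((v - d - 1) / 2) * wishartZ d (v - d - 1) := by
  have hnn : 0 ≤ᵐ[extVolume d] iwKernel v V := by
    filter_upwards [ae_extVolume_posDef] with X hX
    exact (iwKernel_pos v V hX).le
  rw [integral_eq_lintegral_of_nonneg_ae hnn (measurable_iwKernel v V).aestronglyMeasurable,
    lintegral_iwKernel hv hV, ENNReal.toReal_ofReal]
  exact mul_nonneg (Real.rpow_nonneg hV.inv.det_pos.le _)
    (lintegral_wishartKernel_one (by linarith)).2.le

lemma iwPdf_eq {v : ℝ} (hv : 2 * (d : ℝ) < v) {V : Ext d} (hV : V.PosDef) (X : Ext d) :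
    iwPdf v V X = iwKernel v V X / (V⁻¹.det ^ ((v - d - 1) / 2) * wishartZ d (v - d - 1)) := by
  rw [iwPdf, integral_iwKernel hv hV]

lemma wishart_const_pos {n : ℝ} (hn : (d : ℝ) - 1 < n) {S : Ext d} (hS : S.PosDef) :
    0 < S.det ^ (n / 2) * wishartZ d n :=
  mul_pos (Real.rpow_pos_of_pos hS.det_pos _) (lintegral_wishartKernel_one hn).2

lemma iw_const_pos {v : ℝ} (hv : 2 * (d : ℝ) < v) {V : Ext d} (hV : V.PosDef) :
    0 < V⁻¹.det ^ ((v - d - 1) / 2) * wishartZ d (v - d - 1) :=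
  wishart_const_pos (by linarith) hV.inv

lemma measurable_wishartPdf (n : ℝ) (S : Ext d) : Measurable (wishartPdf n S) :=
  (measurable_wishartKernel n S).div_const _

lemma measurable_iwPdf (v : ℝ) (V : Ext d) : Measurable (iwPdf v V) :=
  (measurable_iwKernel v V).div_const _

lemma wishartPdf_pos {n : ℝ} (hn : (d : ℝ) - 1 < n) {S : Ext d} (hS : S.PosDef) {X : Ext d}
    (hX : X.PosDef) : 0 < wishartPdf n S X := by
  rw [wishartPdf_eq hn hS]
  exact div_pos (wishartKernel_pos n S hX) (wishart_const_pos hn hS)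

lemma iwPdf_pos {v : ℝ} (hv : 2 * (d : ℝ) < v) {V : Ext d} (hV : V.PosDef) {X : Ext d}
    (hX : X.PosDef) : 0 < iwPdf v V X := by
  rw [iwPdf_eq hv hV]
  exact div_pos (iwKernel_pos v V hX) (iw_const_pos hv hV)

lemma lintegral_lawOf {p : Ext d → ℝ} (hp : Measurable p) {F : Ext d → ℝ≥0∞}
    (hF : Measurable F) :
    ∫⁻ X, F X ∂lawOf p = ∫⁻ X, ENNReal.ofReal (p X) * F X ∂extVolume d :=
  lintegral_withDensity_eq_lintegral_mul _ hp.ennreal_ofReal hF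

lemma isProbabilityMeasure_wishartLaw {n : ℝ} (hn : (d : ℝ) - 1 < n) {S : Ext d}
    (hS : S.PosDef) : IsProbabilityMeasure (wishartLaw n S) := by
  have hc := wishart_const_pos hn hS
  constructor
  rw [wishartLaw, ← setLIntegral_one, setLIntegral_univ,
    lintegral_lawOf (measurable_wishartPdf n S) measurable_const]
  simp only [mul_one, wishartPdf_eq hn hS, div_eq_mul_inv _ (_ * _ : ℝ),
    ENNReal.ofReal_mul' (inv_nonneg.2 hc.le)]
  rw [lintegral_mul_const' _ _ ENNReal.ofReal_ne_top, lintegral_wishartKernel hn hS,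
    ← ENNReal.ofReal_mul hc.le, mul_inv_cancel₀ hc.ne', ENNReal.ofReal_one]

lemma ae_lawOf_posDef (p : Ext d → ℝ) : ∀ᵐ X ∂lawOf p, X.PosDef :=
  (withDensity_absolutelyContinuous _ _).ae_le ae_extVolume_posDef

lemma lintegral_iwLaw {v : ℝ} (hv : 2 * (d : ℝ) < v) {V : Ext d} (hV : V.PosDef)
    {F : Ext d → ℝ≥0∞} (hF : Measurable F) :
    ∫⁻ X, F X ∂iwLaw v V = ∫⁻ X, F X⁻¹ ∂wishartLaw (v - d - 1) V⁻¹ := by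
  have hc := iw_const_pos hv hV
  rw [iwLaw, lintegral_lawOf (measurable_iwPdf v V) hF, wishartLaw,
    lintegral_lawOf (F := fun X => F X⁻¹) (measurable_wishartPdf _ _) (hF.comp measurable_inv)]
  simp only [iwPdf_eq hv hV, wishartPdf_eq (show (d : ℝ) - 1 < v - d - 1 by linarith) hV.inv,
    div_eq_inv_mul _ (_ * _ : ℝ), ENNReal.ofReal_mul (inv_nonneg.2 hc.le),
    mul_assoc (ENNReal.ofReal _)]
  rw [lintegral_const_mul' _ _ ENNReal.ofReal_ne_top,
    lintegral_const_mul' _ _ ENNReal.ofReal_ne_top, lintegral_iwKernel_mul v hV F]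

lemma isProbabilityMeasure_iwLaw {v : ℝ} (hv : 2 * (d : ℝ) < v) {V : Ext d} (hV : V.PosDef) :
    IsProbabilityMeasure (iwLaw v V) := by
  have := isProbabilityMeasure_wishartLaw (show (d : ℝ) - 1 < v - d - 1 by linarith) hV.inv
  constructor
  rw [← setLIntegral_one, setLIntegral_univ, lintegral_iwLaw hv hV measurable_const]
  simp

lemma lintegral_wishartLaw_conj {n : ℝ} (hn : (d : ℝ) - 1 < n) {S : Ext d} (hS : S.PosDef)
    {B : Ext d} (hB : B.det ≠ 0) {F : Ext d → ℝ≥0∞} (hF : Measurable F) :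
    ∫⁻ X, F X ∂wishartLaw n (B * S * Bᵀ) = ∫⁻ X, F (B * X * Bᵀ) ∂wishartLaw n S := by
  have hBS : (B * S * Bᵀ).PosDef := (posDef_conj_iff hB).2 hS
  have h0 : 0 < |B.det| := abs_pos.2 hB
  rw [wishartLaw, lintegral_lawOf (measurable_wishartPdf _ _) hF, wishartLaw,
    lintegral_lawOf (F := fun X => F (B * X * Bᵀ)) (measurable_wishartPdf _ _)
      (hF.comp (measurable_conj B)), lintegral_conj hB,
    ← lintegral_const_mul' _ _ ENNReal.ofReal_ne_top]
  refine lintegral_congr_ae ?_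
  filter_upwards [ae_extVolume_posDef] with X hX
  rw [← mul_assoc, ← ENNReal.ofReal_mul (by positivity)]
  congr 2
  rw [wishartPdf_eq hn hBS, wishartPdf_eq hn hS, wishartKernel_conj n S hB hX, det_conj,
    Real.mul_rpow (mul_self_nonneg _) hS.det_pos.le, rpow_abs_sq]
  have hsplit : |B.det| ^ n = |B.det| ^ (d + 1) * |B.det| ^ (n - d - 1) := by
    rw [← Real.rpow_natCast, ← Real.rpow_add h0]; congr 1; push_cast; ring
  have hc := (wishart_const_pos hn hS).ne'
  have h1 : |B.det| ^ (n - d - 1) ≠ 0 := (Real.rpow_pos_of_pos h0 _).ne'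
  rw [hsplit]
  have h2 := left_ne_zero_of_mul hc
  have h3 := right_ne_zero_of_mul hc
  field_simp

end Laws

/-! ### Matrix means from quadratic forms. -/

section QMean

variable {d : ℕ}

/-- The positive semidefinite random matrix `F` has mean `S`, in terms of quadratic forms. -/
structure QMean (μ : Measure (Ext d)) (F : Ext d → Ext d) (S : Ext d) : Prop where
  measurable : Measurable F
  psd : ∀ᵐ X ∂μ, (F X).PosSemidef
  posSemidef : S.PosSemidef
  quad : ∀ u : Fin d → ℝ,
    ∫⁻ X, ENNReal.ofReal (u ⬝ᵥ F X *ᵥ u) ∂μ = ENNReal.ofReal (u ⬝ᵥ S *ᵥ u)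

lemma measurable_quad (u : Fin d → ℝ) : Measurable fun X : Ext d => u ⬝ᵥ X *ᵥ u :=
  (by fun_prop : Continuous fun X : Ext d => u ⬝ᵥ X *ᵥ u).measurable

lemma measurable_quad_inv (u : Fin d → ℝ) : Measurable fun X : Ext d => u ⬝ᵥ X⁻¹ *ᵥ u :=
  (measurable_quad u).comp measurable_inv

lemma measurable_entry_inv (i j : Fin d) : Measurable fun X : Ext d => X⁻¹ i j :=
  (measurable_entry i j).comp measurable_inv

lemma quad_nonneg {A : Ext d} (hA : A.PosSemidef) (u : Fin d → ℝ) : 0 ≤ u ⬝ᵥ A *ᵥ u := by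
  simpa using hA.dotProduct_mulVec_nonneg u

lemma quad_single (A : Ext d) (i j : Fin d) :
    Pi.single i 1 ⬝ᵥ A *ᵥ Pi.single j 1 = A i j := by
  rw [single_one_dotProduct, Matrix.mulVec_single_one, Matrix.col_apply]

/-- Polarization. Nonnegative integrals of quadratic forms then yield both integrability and the
value of every entry. -/
lemma entry_eq_quad {A : Ext d} (hA : A.IsSymm) (i j : Fin d) :
    A i j = 2⁻¹ * ((Pi.single i 1 + Pi.single j 1) ⬝ᵥ A *ᵥ (Pi.single i 1 + Pi.single j 1) -
      Pi.single i 1 ⬝ᵥ A *ᵥ Pi.single i 1 - Pi.single j 1 ⬝ᵥ A *ᵥ Pi.single j 1) := by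
  rw [Matrix.mulVec_add, add_dotProduct, dotProduct_add, dotProduct_add]
  simp only [quad_single]
  rw [hA.apply j i]
  ring

lemma _root_.Matrix.PosSemidef.isSymm {A : Ext d} (hA : A.PosSemidef) : A.IsSymm := by
  have := hA.isHermitian
  rwa [Matrix.IsHermitian, Matrix.conjTranspose_eq_transpose_of_trivial] at this

namespace QMean

variable {μ : Measure (Ext d)} {F : Ext d → Ext d} {S : Ext d}

lemma integrable_quad (h : QMean μ F S) (u : Fin d → ℝ) :
    Integrable (fun X => u ⬝ᵥ F X *ᵥ u) μ := by
  refine ⟨((measurable_quad u).comp h.measurable).aestronglyMeasurable, ?_⟩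
  rw [hasFiniteIntegral_iff_ofReal, h.quad]
  · exact ENNReal.ofReal_lt_top
  · filter_upwards [h.psd] with X hX using quad_nonneg hX u

lemma integral_quad (h : QMean μ F S) (u : Fin d → ℝ) :
    ∫ X, u ⬝ᵥ F X *ᵥ u ∂μ = u ⬝ᵥ S *ᵥ u := by
  rw [integral_eq_lintegral_of_nonneg_ae, h.quad,
    ENNReal.toReal_ofReal (quad_nonneg h.posSemidef u)]
  · filter_upwards [h.psd] with X hX using quad_nonneg hX u
  · exact ((measurable_quad u).comp h.measurable).aestronglyMeasurable

lemma ae_entry (h : QMean μ F S) (i j : Fin d) : (fun X => F X i j) =ᵐ[μ] fun X =>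
    2⁻¹ * ((Pi.single i 1 + Pi.single j 1) ⬝ᵥ F X *ᵥ (Pi.single i 1 + Pi.single j 1) -
      Pi.single i 1 ⬝ᵥ F X *ᵥ Pi.single i 1 - Pi.single j 1 ⬝ᵥ F X *ᵥ Pi.single j 1) := by
  filter_upwards [h.psd] with X hX using entry_eq_quad hX.isSymm i j

lemma integrable (h : QMean μ F S) (i j : Fin d) : Integrable (fun X => F X i j) μ :=
  ((((h.integrable_quad _).sub (h.integrable_quad _)).sub
    (h.integrable_quad _)).const_mul _).congr (h.ae_entry i j).symm

lemma integral (h : QMean μ F S) (i j : Fin d) : ∫ X, F X i j ∂μ = S i j := by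
  rw [integral_congr_ae (h.ae_entry i j), integral_const_mul, integral_sub, integral_sub,
    h.integral_quad, h.integral_quad, h.integral_quad, ← entry_eq_quad h.posSemidef.isSymm]
  · exact h.integrable_quad _
  · exact h.integrable_quad _
  · exact (h.integrable_quad _).sub (h.integrable_quad _)
  · exact h.integrable_quad _

end QMean

lemma QMean.hasMoments {μ : Measure (Ext d)} {S T : Ext d} (h1 : QMean μ (fun X => X) S)
    (h2 : QMean μ (fun X => X⁻¹) T) : HasMoments μ ∧ meanMat μ = S ∧ meanInv μ = T :=
  ⟨fun i j => ⟨h1.integrable i j, h2.integrable i j⟩, by ext i j; exact h1.integral i j,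
    by ext i j; exact h2.integral i j⟩

end QMean

/-! ### The mean of a Wishart law. -/

section WishartMean

variable {d : ℕ}

lemma posDef_one_sub_vecMulVec {v : Fin d → ℝ} {t : ℝ} (ht : 0 < 1 - 2 * t * (v ⬝ᵥ v)) :
    (1 - (2 * t) • Matrix.vecMulVec v v : Ext d).PosDef := by
  refine Matrix.PosDef.of_dotProduct_mulVec_pos ?_ fun x hx => ?_
  · rw [Matrix.IsHermitian, Matrix.conjTranspose_eq_transpose_of_trivial, Matrix.transpose_sub,
      Matrix.transpose_smul, Matrix.transpose_vecMulVec, Matrix.transpose_one]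
  · have h1 : star x ⬝ᵥ (1 - (2 * t) • Matrix.vecMulVec v v : Ext d) *ᵥ x =
        x ⬝ᵥ x - 2 * t * (v ⬝ᵥ x) ^ 2 := by
      rw [star_trivial, Matrix.sub_mulVec, Matrix.one_mulVec, Matrix.smul_mulVec,
        Matrix.vecMulVec_mulVec, dotProduct_sub, dotProduct_smul]
      simp only [op_smul_eq_smul, dotProduct_smul, smul_eq_mul]
      rw [dotProduct_comm x v]; ring
    have h2 : (v ⬝ᵥ x) ^ 2 ≤ (v ⬝ᵥ v) * (x ⬝ᵥ x) := by
      simp only [dotProduct, ← sq]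
      exact Finset.sum_mul_sq_le_sq_mul_sq _ _ _
    have h3 : 0 < x ⬝ᵥ x := by
      simpa using (dotProduct_star_self_pos_iff (v := x)).2 hx
    rw [h1]
    rcases le_total t 0 with h | h
    · nlinarith [sq_nonneg (v ⬝ᵥ x)]
    · nlinarith

lemma det_one_sub_vecMulVec (v : Fin d → ℝ) (t : ℝ) :
    (1 - (2 * t) • Matrix.vecMulVec v v : Ext d).det = 1 - 2 * t * (v ⬝ᵥ v) := by
  have : (1 - (2 * t) • Matrix.vecMulVec v v : Ext d) =
      1 + Matrix.replicateCol Unit (-(2 * t) • v) * Matrix.replicateRow Unit v := by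
    ext i j
    simp [Matrix.mul_apply, Matrix.vecMulVec_apply, sub_eq_add_neg, mul_assoc]
  rw [this, Matrix.det_one_add_replicateCol_mul_replicateRow, dotProduct_smul, smul_eq_mul]
  ring

/-- Exponential tilting: the factor exp(t vᵀXv) turns the unit scale kernel into the kernel of scale
(1 - 2t vvᵀ)⁻¹, whose integral is known. -/
lemma lintegral_exp_quad {n : ℝ} (hn : (d : ℝ) - 1 < n) {v : Fin d → ℝ} {t : ℝ}
    (ht : 0 < 1 - 2 * t * (v ⬝ᵥ v)) :
    ∫⁻ X, ENNReal.ofReal (Real.exp (t * (v ⬝ᵥ X *ᵥ v))) ∂wishartLaw n (1 : Ext d) =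
      ENNReal.ofReal ((1 - 2 * t * (v ⬝ᵥ v)) ^ (-n / 2)) := by
  have hT := posDef_one_sub_vecMulVec ht
  have hZ := (lintegral_wishartKernel_one (d := d) hn).2
  rw [wishartLaw, lintegral_lawOf (measurable_wishartPdf _ _)
    ((measurable_quad v).const_mul t).exp.ennreal_ofReal]
  have h1 : ∀ X : Ext d, ENNReal.ofReal (wishartPdf n 1 X) *
      ENNReal.ofReal (Real.exp (t * (v ⬝ᵥ X *ᵥ v))) = ENNReal.ofReal (wishartZ d n)⁻¹ *
        ENNReal.ofReal (wishartKernel n (1 - (2 * t) • Matrix.vecMulVec v v)⁻¹ X) := by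
    intro X
    rw [← ENNReal.ofReal_mul' (Real.exp_pos _).le, ← ENNReal.ofReal_mul (by positivity),
      wishartPdf_eq hn Matrix.PosDef.one, Matrix.det_one, Real.one_rpow, one_mul, wishartKernel,
      wishartKernel, Matrix.nonsing_inv_nonsing_inv _ (isUnit_iff_ne_zero.2 hT.det_pos.ne'),
      inv_one, one_mul]
    have h2 : ((1 - (2 * t) • Matrix.vecMulVec v v : Ext d) * X).trace =
        X.trace - 2 * t * (v ⬝ᵥ X *ᵥ v) := by
      rw [sub_mul, one_mul, Matrix.trace_sub, Matrix.smul_mul, Matrix.trace_smul,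
        Matrix.vecMulVec_mul, Matrix.trace_vecMulVec, Matrix.dotProduct_mulVec, smul_eq_mul,
        dotProduct_comm v]
    rw [h2, show -(1 / 2) * (X.trace - 2 * t * (v ⬝ᵥ X *ᵥ v)) =
      -(1 / 2) * X.trace + t * (v ⬝ᵥ X *ᵥ v) by ring, Real.exp_add]
    congr 1; ring
  simp only [h1]
  rw [lintegral_const_mul' _ _ ENNReal.ofReal_ne_top, lintegral_wishartKernel hn hT.inv,
    ← ENNReal.ofReal_mul (by positivity), Matrix.det_nonsing_inv, Ring.inverse_eq_inv',
    det_one_sub_vecMulVec, Real.inv_rpow ht.le, ← Real.rpow_neg ht.le, neg_div]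
  congr 1
  field_simp

/-- The moment generating function is (1 - 2t|v|²)^(-n/2) near zero, and its derivative there is
n|v|². -/
lemma lintegral_quad_wishartLaw_one {n : ℝ} (hn : (d : ℝ) - 1 < n) (v : Fin d → ℝ) :
    ∫⁻ X, ENNReal.ofReal (v ⬝ᵥ X *ᵥ v) ∂wishartLaw n (1 : Ext d) =
      ENNReal.ofReal (n * (v ⬝ᵥ v)) := by
  have := isProbabilityMeasure_wishartLaw hn (Matrix.PosDef.one (n := Fin d) (R := ℝ))
  set μ := wishartLaw n (1 : Ext d)
  set Y : Ext d → ℝ := fun X => v ⬝ᵥ X *ᵥ v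
  have hnear : ∀ᶠ t : ℝ in nhds 0, 0 < 1 - 2 * t * (v ⬝ᵥ v) := by
    have : Filter.Tendsto (fun t : ℝ => 1 - 2 * t * (v ⬝ᵥ v)) (nhds 0)
        (nhds (1 - 2 * 0 * (v ⬝ᵥ v))) := (by fun_prop : Continuous _).tendsto 0
    refine this.eventually (lt_mem_nhds ?_)
    norm_num
  have hmeas : ∀ t : ℝ, Measurable fun X => Real.exp (t * Y X) :=
    fun t => ((measurable_quad v).const_mul t).exp
  have hint : ∀ᶠ t : ℝ in nhds 0, Integrable (fun X => Real.exp (t * Y X)) μ := by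
    filter_upwards [hnear] with t ht
    refine ⟨(hmeas t).aestronglyMeasurable, ?_⟩
    rw [hasFiniteIntegral_iff_ofReal (Filter.Eventually.of_forall fun X => (Real.exp_pos _).le),
      lintegral_exp_quad hn ht]
    exact ENNReal.ofReal_lt_top
  have hmgf : mgf Y μ =ᶠ[nhds 0] fun t => (1 - 2 * t * (v ⬝ᵥ v)) ^ (-n / 2) := by
    filter_upwards [hnear] with t ht
    rw [mgf, integral_eq_lintegral_of_nonneg_ae
      (Filter.Eventually.of_forall fun X => (Real.exp_pos _).le) (hmeas t).aestronglyMeasurable,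
      lintegral_exp_quad hn ht, ENNReal.toReal_ofReal (Real.rpow_nonneg ht.le _)]
  have h0 : (0 : ℝ) ∈ interior (integrableExpSet Y μ) := mem_interior_iff_mem_nhds.2 hint
  have hd1 : deriv (mgf Y μ) 0 = n * (v ⬝ᵥ v) := by
    rw [hmgf.deriv_eq]
    have h1 : HasDerivAt (fun t : ℝ => 1 - 2 * t * (v ⬝ᵥ v)) (-(2 * (v ⬝ᵥ v))) 0 := by
      have := (((hasDerivAt_id (0 : ℝ)).const_mul 2).mul_const (v ⬝ᵥ v)).const_sub 1
      simpa using this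
    have h2 := h1.rpow_const (p := -n / 2) (Or.inl (by norm_num))
    rw [h2.deriv]
    norm_num
    ring
  rw [deriv_mgf_zero h0] at hd1
  have hYint : Integrable Y μ := integrable_of_mem_interior_integrableExpSet h0
  rw [← hd1, ofReal_integral_eq_lintegral_ofReal hYint]
  filter_upwards [ae_lawOf_posDef _] with X hX using quad_nonneg hX.posSemidef v

lemma quad_conj (B X : Ext d) (u : Fin d → ℝ) :
    u ⬝ᵥ (B * X * Bᵀ) *ᵥ u = (Bᵀ *ᵥ u) ⬝ᵥ X *ᵥ (Bᵀ *ᵥ u) := by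
  rw [← Matrix.mulVec_mulVec, ← Matrix.mulVec_mulVec, Matrix.dotProduct_mulVec,
    ← Matrix.mulVec_transpose]

lemma qMean_wishartLaw {n : ℝ} (hn : (d : ℝ) - 1 < n) (hn0 : 0 ≤ n) {S : Ext d}
    (hS : S.PosDef) : QMean (wishartLaw n S) (fun X => X) (n • S) where
  measurable := measurable_id
  psd := by filter_upwards [ae_lawOf_posDef _] with X hX using hX.posSemidef
  posSemidef := hS.posSemidef.smul hn0
  quad u := by
    obtain ⟨B, hB, rfl⟩ := hS.exists_eq_mul_transpose
    have h := lintegral_wishartLaw_conj hn Matrix.PosDef.one hB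
      (measurable_quad u).ennreal_ofReal
    rw [Matrix.mul_one] at h
    rw [h]
    simp only [quad_conj]
    rw [lintegral_quad_wishartLaw_one hn, Matrix.smul_mulVec, dotProduct_smul, smul_eq_mul]
    congr 2
    have := quad_conj B 1 u
    rw [Matrix.mul_one, Matrix.one_mulVec] at this
    exact this.symm

end WishartMean

/-! ### The mean of the inverse of a Wishart matrix, and inverse Wishart moments. -/

section WishartInverseMean

variable {d : ℕ}

lemma bordered_eq_add (x : ℝ) (b : Fin d → ℝ) (C : Ext d) :
    bordered x b C = bordered 0 b C + Matrix.single 0 0 x := by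
  ext i j
  cases i using Fin.cases <;> cases j using Fin.cases <;> 
    simp [(Fin.succ_ne_zero _).symm]

lemma trace_mul_bordered (T : Ext (d + 1)) (x : ℝ) (b : Fin d → ℝ) (C : Ext d) :
    (T * bordered x b C).trace = T 0 0 * x + (T * bordered 0 b C).trace := by
  rw [bordered_eq_add, mul_add, Matrix.trace_add, Matrix.trace_mul_comm T (Matrix.single 0 0 x),
    Matrix.trace_single_mul, add_comm, smul_eq_mul, mul_comm x]

/-- In Schur coordinates (X⁻¹)₀₀ = (x - q)⁻¹. For each fixed C and b both sides are gamma integrals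
in x with rate r = (S⁻¹)₀₀/2, of shapes s and s + 1. Their ratio r/s is the same for all C and b. -/
lemma lintegral_inv_zero_zero_mul_wishartKernel {n : ℝ} (hn : ((d + 1 : ℕ) : ℝ) + 1 < n)
    {S : Ext (d + 1)} (hS : S.PosDef) :
    ∫⁻ X, ENNReal.ofReal (wishartKernel n S X) * ENNReal.ofReal (X⁻¹ 0 0) ∂extVolume (d + 1) =
      ENNReal.ofReal (S⁻¹ 0 0 / (n - (d + 1 : ℕ) - 1)) *
        ∫⁻ X, ENNReal.ofReal (wishartKernel n S X) ∂extVolume (d + 1) := by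
  have hT0 : 0 < S⁻¹ 0 0 := hS.inv.diag_pos
  have hk := (measurable_wishartKernel n S).ennreal_ofReal
  rw [lintegral_schur hk, lintegral_schur
    (g := fun X => ENNReal.ofReal (wishartKernel n S X) * ENNReal.ofReal (X⁻¹ 0 0))
    (hk.mul (measurable_entry_inv 0 0).ennreal_ofReal),
    ← lintegral_const_mul' _ _ ENNReal.ofReal_ne_top]
  refine lintegral_congr_ae ?_
  filter_upwards [ae_extVolume_posDef] with C hC
  rw [← lintegral_const_mul' _ _ ENNReal.ofReal_ne_top]
  refine lintegral_congr fun b => ?_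
  set q := b ⬝ᵥ C⁻¹ *ᵥ b
  set s := (n - (d + 1 : ℕ) - 1) / 2 with hs
  have hs0 : 0 < s := by rw [hs]; linarith
  set c := C.det ^ s * Real.exp (-(1 / 2) * ((S⁻¹ * bordered 0 b C).trace + S⁻¹ 0 0 * q))
  have hc : 0 ≤ c := mul_nonneg (Real.rpow_nonneg hC.det_pos.le _) (Real.exp_pos _).le
  have hker : ∀ x ∈ Set.Ioi q, wishartKernel n S (bordered x b C) =
      c * ((x - q) ^ s * Real.exp (-(S⁻¹ 0 0 / 2 * (x - q)))) := by
    intro x hx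
    rw [wishartKernel, det_bordered hC, trace_mul_bordered,
      Real.mul_rpow hC.det_pos.le (sub_nonneg.2 (le_of_lt hx)),
      show -(1 / 2) * (S⁻¹ 0 0 * x + (S⁻¹ * bordered 0 b C).trace) =
        -(1 / 2) * ((S⁻¹ * bordered 0 b C).trace + S⁻¹ 0 0 * q) +
          -(S⁻¹ 0 0 / 2 * (x - q)) by ring, Real.exp_add]
    simp only [c, hs, q]
    ring
  have e1 : ∫⁻ x in Set.Ioi q, ENNReal.ofReal (wishartKernel n S (bordered x b C)) =
      ENNReal.ofReal (c * ((1 / (S⁻¹ 0 0 / 2)) ^ (s + 1) * Real.Gamma (s + 1))) := by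
    rw [ENNReal.ofReal_mul hc,
      ← lintegral_Ioi_rpow_mul_exp (by linarith : 0 < s + 1) (half_pos hT0) q,
      ← lintegral_const_mul' _ _ ENNReal.ofReal_ne_top]
    refine setLIntegral_congr_fun measurableSet_Ioi fun x hx => ?_
    rw [← ENNReal.ofReal_mul hc, hker x hx, add_sub_cancel_right]
  have e2 : ∫⁻ x in Set.Ioi q, ENNReal.ofReal (wishartKernel n S (bordered x b C)) *
      ENNReal.ofReal ((bordered x b C)⁻¹ 0 0) =
      ENNReal.ofReal (c * ((1 / (S⁻¹ 0 0 / 2)) ^ s * Real.Gamma s)) := by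
    rw [ENNReal.ofReal_mul hc, ← lintegral_Ioi_rpow_mul_exp hs0 (half_pos hT0) q,
      ← lintegral_const_mul' _ _ ENNReal.ofReal_ne_top]
    refine setLIntegral_congr_fun measurableSet_Ioi fun x hx => ?_
    have hx' : 0 < x - q := sub_pos.2 hx
    rw [← ENNReal.ofReal_mul hc, hker x hx, inv_bordered_zero_zero hC,
      ← ENNReal.ofReal_mul (by positivity), Real.rpow_sub_one hx'.ne']
    congr 1
    simp only [q]
    ring
  rw [e1, e2, ← ENNReal.ofReal_mul (div_nonneg hT0.le (by linarith)), Real.Gamma_add_one hs0.ne',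
    Real.rpow_add_one (by positivity)]
  congr 1
  have : n - (d + 1 : ℕ) - 1 = 2 * s := by rw [hs]; ring
  rw [this]
  field_simp

lemma exists_mulVec_single_eq {u : Fin (d + 1) → ℝ} (hu : u ≠ 0) :
    ∃ B : Ext (d + 1), B.det ≠ 0 ∧ B *ᵥ Pi.single 0 1 = u := by
  have h1 : (Pi.single 0 1 : Fin (d + 1) → ℝ) ≠ 0 := by simp
  obtain ⟨A, hA⟩ := SeparatingDual.exists_continuousLinearEquiv_apply_eq (R := ℝ) h1 hu
  refine ⟨LinearMap.toMatrix' A.toLinearEquiv.toLinearMap, ?_, ?_⟩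
  · rw [LinearMap.det_toMatrix']
    exact (LinearEquiv.isUnit_det' A.toLinearEquiv).ne_zero
  · rw [LinearMap.toMatrix'_mulVec]
    exact hA

lemma quad_inv_conj {B X : Ext d} (hB : B.det ≠ 0) (e : Fin d → ℝ) :
    (B *ᵥ e) ⬝ᵥ (B * X * Bᵀ)⁻¹ *ᵥ (B *ᵥ e) = e ⬝ᵥ X⁻¹ *ᵥ e := by
  have h := quad_conj B⁻¹ᵀ X⁻¹ (B *ᵥ e)
  have hBe : B⁻¹ *ᵥ B *ᵥ e = e := by
    rw [Matrix.mulVec_mulVec, Matrix.nonsing_inv_mul _ (isUnit_iff_ne_zero.2 hB),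
      Matrix.one_mulVec]
  rw [Matrix.transpose_transpose, hBe] at h
  rw [inv_conj, h]

/-- A congruence carries any u ≠ 0 to the first basis vector, so the corner entry of the inverse
decides every quadratic form. -/
lemma qMean_inv_wishartLaw {n : ℝ} (hd : 0 < d) (hn : (d : ℝ) + 1 < n) {S : Ext d}
    (hS : S.PosDef) :
    QMean (wishartLaw n S) (fun X => X⁻¹) ((n - d - 1)⁻¹ • S⁻¹) where
  measurable := measurable_inv
  psd := by filter_upwards [ae_lawOf_posDef _] with X hX using hX.inv.posSemidef
  posSemidef := hS.inv.posSemidef.smul (inv_nonneg.2 (by linarith))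
  quad u := by
    obtain ⟨d, rfl⟩ := Nat.exists_eq_succ_of_ne_zero hd.ne'
    have hn' : ((d + 1 : ℕ) : ℝ) - 1 < n := by linarith
    by_cases hu : u = 0
    · simp [hu]
    obtain ⟨B, hB, rfl⟩ := exists_mulVec_single_eq hu
    have hBu : IsUnit B.det := isUnit_iff_ne_zero.2 hB
    obtain ⟨S', rfl⟩ : ∃ S', S = B * S' * Bᵀ := by
      refine ⟨B⁻¹ * S * B⁻¹ᵀ, ?_⟩
      rw [Matrix.mul_assoc, Matrix.mul_assoc, ← Matrix.transpose_mul, Matrix.mul_nonsing_inv _ hBu,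
        Matrix.transpose_one, Matrix.mul_one, ← Matrix.mul_assoc, Matrix.mul_nonsing_inv _ hBu,
        Matrix.one_mul]
    have hS' := (posDef_conj_iff hB).1 hS
    have hc := wishart_const_pos hn' hS'
    rw [lintegral_wishartLaw_conj hn' hS' hB
      (measurable_quad_inv _).ennreal_ofReal]
    simp only [quad_inv_conj hB, Matrix.smul_mulVec, dotProduct_smul,
      quad_single, smul_eq_mul]
    rw [wishartLaw, lintegral_lawOf (measurable_wishartPdf _ _)
      (measurable_entry_inv 0 0).ennreal_ofReal]
    simp only [wishartPdf_eq hn' hS', div_eq_inv_mul _ (_ * _ : ℝ),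
      ENNReal.ofReal_mul (inv_nonneg.2 hc.le), mul_assoc (ENNReal.ofReal _)]
    rw [lintegral_const_mul' _ _ ENNReal.ofReal_ne_top,
      lintegral_inv_zero_zero_mul_wishartKernel hn hS', lintegral_wishartKernel hn' hS',
      mul_left_comm, ← ENNReal.ofReal_mul (inv_nonneg.2 hc.le), inv_mul_cancel₀ hc.ne',
      ENNReal.ofReal_one, mul_one, div_eq_inv_mul]

lemma qMean_iwLaw {v : ℝ} (hd : 0 < d) (hv : 2 * (d : ℝ) + 2 < v) {V : Ext d} (hV : V.PosDef) :
    QMean (iwLaw v V) (fun X => X) ((v - 2 * d - 2)⁻¹ • V) where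
  measurable := measurable_id
  psd := by filter_upwards [ae_lawOf_posDef _] with X hX using hX.posSemidef
  posSemidef := hV.posSemidef.smul (inv_nonneg.2 (by linarith))
  quad u := by
    rw [lintegral_iwLaw (by linarith) hV (measurable_quad u).ennreal_ofReal,
      (qMean_inv_wishartLaw hd (by linarith) hV.inv).quad,
      Matrix.nonsing_inv_nonsing_inv _ (isUnit_iff_ne_zero.2 hV.det_pos.ne')]
    congr 5; ring

lemma qMean_inv_iwLaw {v : ℝ} (hd : 0 < d) (hv : 2 * (d : ℝ) < v) {V : Ext d} (hV : V.PosDef) :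
    QMean (iwLaw v V) (fun X => X⁻¹) ((v - d - 1) • V⁻¹) where
  measurable := measurable_inv
  psd := by filter_upwards [ae_lawOf_posDef _] with X hX using hX.inv.posSemidef
  posSemidef := hV.inv.posSemidef.smul (by
    have : (1 : ℝ) ≤ d := by exact_mod_cast hd
    linarith)
  quad u := by
    have h0 : 0 ≤ v - d - 1 := by
      have : (1 : ℝ) ≤ d := by exact_mod_cast hd
      linarith
    rw [lintegral_iwLaw (by linarith) hV (measurable_quad_inv u).ennreal_ofReal,
      ← (qMean_wishartLaw (by linarith) h0 hV.inv).quad]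
    refine lintegral_congr_ae ?_
    filter_upwards [ae_lawOf_posDef _] with X hX
    rw [Matrix.nonsing_inv_nonsing_inv _ (isUnit_iff_ne_zero.2 hX.det_pos.ne')]

end WishartInverseMean

/-! ### Normalization of densities known up to a constant. -/

section Normalize

variable {d : ℕ}

lemma normalize_smul {α : Type*} [MeasurableSpace α] {μ : Measure α} [IsProbabilityMeasure μ]
    {c : ℝ≥0∞} (h0 : c ≠ 0) (ht : c ≠ ∞) : normalize (c • μ) = μ := by
  rw [normalize, Measure.smul_apply, measure_univ, smul_eq_mul, mul_one, smul_smul,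
    ENNReal.inv_mul_cancel h0 ht, one_smul]

lemma lawOf_congr {p q : Ext d → ℝ} (h : ∀ X : Ext d, X.PosDef → p X = q X) :
    lawOf p = lawOf q := by
  refine withDensity_congr_ae ?_
  filter_upwards [ae_extVolume_posDef] with X hX
  rw [h X hX]

lemma lawOf_const_mul {c : ℝ} (hc : 0 ≤ c) {q : Ext d → ℝ} (hq : Measurable q) :
    lawOf (fun X => c * q X) = ENNReal.ofReal c • lawOf q := by
  rw [lawOf, lawOf, ← withDensity_smul _ hq.ennreal_ofReal]
  congr 1
  ext X
  rw [ENNReal.ofReal_mul hc]; rfl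

lemma normalize_lawOf {p q : Ext d → ℝ} (hq : Measurable q) [IsProbabilityMeasure (lawOf q)]
    {c : ℝ} (hc : 0 < c) (h : ∀ X : Ext d, X.PosDef → p X = c * q X) :
    normalize (lawOf p) = lawOf q := by
  rw [lawOf_congr h, lawOf_const_mul hc.le hq]
  exact normalize_smul (by simpa using hc) ENNReal.ofReal_ne_top

/-- A probability density proportional to a kernel is the kernel divided by its integral. -/
lemma lawOf_div_integral {k : Ext d → ℝ} {q : Ext d → ℝ} (hq : Measurable q)
    [IsProbabilityMeasure (lawOf q)] {c : ℝ} (hc : 0 < c)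
    (h : ∀ X : Ext d, X.PosDef → q X = c * k X) (hk : ∀ X : Ext d, X.PosDef → 0 ≤ k X) :
    lawOf (fun X => k X / ∫ Y, k Y ∂extVolume d) = lawOf q := by
  have hk' : ∀ᵐ X ∂extVolume d, k X = c⁻¹ * q X := by
    filter_upwards [ae_extVolume_posDef] with X hX
    rw [h X hX, inv_mul_cancel_left₀ hc.ne']
  have h1 : ∫ Y, q Y ∂extVolume d = 1 := by
    rw [integral_eq_lintegral_of_nonneg_ae _ hq.aestronglyMeasurable]
    · have : ∫⁻ X, ENNReal.ofReal (q X) ∂extVolume d = 1 := by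
        have := measure_univ (μ := lawOf q)
        rwa [lawOf, withDensity_apply _ MeasurableSet.univ, setLIntegral_univ] at this
      rw [this, ENNReal.toReal_one]
    · filter_upwards [ae_extVolume_posDef] with X hX
      rw [h X hX]
      exact mul_nonneg hc.le (hk X hX)
  rw [integral_congr_ae hk', integral_const_mul, h1, mul_one]
  refine lawOf_congr fun X hX => ?_
  rw [h X hX, div_inv_eq_mul, mul_comm]

lemma inv_smul_real (c : ℝ) {A : Ext d} (hA : A.det ≠ 0) (hc : c ≠ 0) :
    (c • A)⁻¹ = c⁻¹ • A⁻¹ := by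
  refine Matrix.inv_eq_right_inv ?_
  rw [Matrix.smul_mul, Matrix.mul_smul, smul_smul, mul_inv_cancel₀ hc,
    Matrix.mul_nonsing_inv _ (isUnit_iff_ne_zero.2 hA), one_smul]

lemma smul_left_cancel_posDef (hd : 0 < d) {A : Ext d} (hA : A.PosDef) {a b : ℝ}
    (h : a • A = b • A) : a = b := by
  have := congrFun (congrFun h ⟨0, hd⟩) ⟨0, hd⟩
  simp only [Matrix.smul_apply, smul_eq_mul] at this
  exact mul_right_cancel₀ (hA.diag_pos (i := ⟨0, hd⟩)).ne' this

end Normalize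

/-! ### The Wishart likelihood in its scale argument, and quotients and products of inverse Wishart
densities. -/

section Likelihood

variable {d : ℕ}

lemma posDef_inv_conj {B Y : Ext d} (hB : B.det ≠ 0) (hY : Y.PosDef) :
    (B⁻¹ * Y * B⁻¹ᵀ).PosDef :=
  (posDef_conj_iff (by rw [Matrix.det_nonsing_inv, Ring.inverse_eq_inv']; exact inv_ne_zero hB)).2 hY

lemma trace_inv_conj_mul {B : Ext d} (X Y : Ext d) :
    ((B * X * Bᵀ)⁻¹ * Y).trace = (X⁻¹ * (B⁻¹ * Y * B⁻¹ᵀ)).trace := by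
  rw [inv_conj, Matrix.trace_mul_comm, ← Matrix.mul_assoc, ← Matrix.mul_assoc,
    Matrix.trace_mul_comm, Matrix.trace_mul_comm X⁻¹]
  simp only [Matrix.mul_assoc]

/-- The Wishart likelihood as an inverse Wishart density in its scale argument. -/
lemma wishartPdf_eq_iwPdf {n : ℝ} (hd : 0 < d) (hn : 2 * (d : ℝ) < n) :
    ∃ c : ℝ, 0 < c ∧ ∀ B X Y : Ext d, B.det ≠ 0 → X.PosDef → Y.PosDef →
      wishartPdf n (n⁻¹ • (B * X * Bᵀ)) Y =
        c * (|B.det| ^ (d + 1))⁻¹ * iwPdf n (n • (B⁻¹ * Y * B⁻¹ᵀ)) X := by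
  have hd1 : (1 : ℝ) ≤ d := by exact_mod_cast hd
  have hn0 : 0 < n := by linarith
  have hZ1 := (lintegral_wishartKernel_one (d := d) (show (d : ℝ) - 1 < n by linarith)).2
  have hZ2 := (lintegral_wishartKernel_one (d := d) (show (d : ℝ) - 1 < n - d - 1 by linarith)).2
  -- The constant collects the powers of n from the scales n⁻¹BXBᵀ and nB⁻¹YB⁻ᵀ and the two unit
  -- scale normalizers.
  refine ⟨(n ^ d) ^ (n / 2) * (n ^ d) ^ (-((n - d - 1) / 2)) * wishartZ d (n - d - 1) /
    wishartZ d n, by positivity, fun B X Y hB hX hY => ?_⟩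
  have hBX := (posDef_conj_iff hB).2 hX
  have hS : (n⁻¹ • (B * X * Bᵀ)).PosDef := hBX.smul (inv_pos.2 hn0)
  have hBY := posDef_inv_conj hB hY
  have hV : (n • (B⁻¹ * Y * B⁻¹ᵀ)).PosDef := hBY.smul hn0
  have hb : 0 < |B.det| := abs_pos.2 hB
  have hX0 := hX.det_pos
  have hY0 := hY.det_pos
  rw [wishartPdf_eq (by linarith) hS, iwPdf_eq hn hV, wishartKernel, iwKernel,
    inv_smul_real _ hBX.det_pos.ne' (inv_ne_zero hn0.ne'), inv_inv, Matrix.smul_mul,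
    Matrix.trace_smul, trace_inv_conj_mul, Matrix.mul_smul, Matrix.trace_smul,
    inv_smul_real _ hBY.det_pos.ne' hn0.ne', Matrix.det_smul, Matrix.det_smul,
    Matrix.det_nonsing_inv, det_conj, det_conj, Matrix.det_nonsing_inv]
  simp only [Ring.inverse_eq_inv', Fintype.card_fin]
  set E := Real.exp (-(1 / 2) * n • (X⁻¹ * (B⁻¹ * Y * B⁻¹ᵀ)).trace)
  rw [show B.det⁻¹ * B.det⁻¹ * Y.det = (B.det * B.det)⁻¹ * Y.det by rw [mul_inv],
    Real.mul_rpow (by positivity) (by have := mul_self_nonneg B.det; positivity),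
    Real.mul_rpow (mul_self_nonneg _) hX0.le, rpow_abs_sq,
    show n⁻¹ ^ d * ((B.det * B.det)⁻¹ * Y.det)⁻¹ = (n ^ d)⁻¹ * ((B.det * B.det) * Y.det⁻¹) by
      rw [mul_inv, inv_inv, inv_pow],
    Real.mul_rpow (by positivity) (by have := mul_self_nonneg B.det; positivity),
    Real.mul_rpow (mul_self_nonneg _) (by positivity), rpow_abs_sq, inv_pow,
    Real.inv_rpow (by positivity), Real.inv_rpow (by positivity), Real.inv_rpow hY0.le,
    Real.rpow_neg (by positivity : (0 : ℝ) ≤ n ^ d),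
    -- The Wishart normalizer contributes |det B|^n, the inverse Wishart one only |det B|^(n-d-1);
    -- the difference is the factor |det B|^(-(d+1)) of the message.
    show |B.det| ^ n = |B.det| ^ (d + 1) * |B.det| ^ (n - d - 1) by
      rw [← Real.rpow_natCast, ← Real.rpow_add hb]; congr 1; push_cast; ring, neg_div,
    Real.rpow_neg hX0.le]
  have p1 : 0 < (n ^ d) ^ (n / 2) := by positivity
  have p2 : 0 < (n ^ d) ^ ((n - d - 1) / 2) := by positivity
  have p3 : 0 < |B.det| ^ (n - d - 1) := by positivity
  have p4 : 0 < X.det ^ (n / 2) := by positivity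
  have p5 : 0 < Y.det ^ ((n - d - 1) / 2) := by positivity
  field_simp

lemma likelihoodLaw_eq {n : ℝ} (hd : 0 < d) (hn : 2 * (d : ℝ) < n) {B Y : Ext d}
    (hB : B.det ≠ 0) (hY : Y.PosDef) :
    likelihoodLaw n B Y = iwLaw n (n • (B⁻¹ * Y * B⁻¹ᵀ)) := by
  have hd1 : (1 : ℝ) ≤ d := by exact_mod_cast hd
  obtain ⟨c, hc, h⟩ := wishartPdf_eq_iwPdf hd hn
  have hV : (n • (B⁻¹ * Y * B⁻¹ᵀ)).PosDef := (posDef_inv_conj hB hY).smul (by linarith)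
  have : IsProbabilityMeasure (lawOf (iwPdf n (n • (B⁻¹ * Y * B⁻¹ᵀ)))) :=
    isProbabilityMeasure_iwLaw hn hV
  rw [likelihoodLaw]
  exact normalize_lawOf (c := c * (|B.det| ^ (d + 1))⁻¹) (measurable_iwPdf _ _) (by positivity)
    fun X hX => h B X Y hB hX hY

/-- The exponents are linear in (v, V), so products and quotients of densities add and subtract
parameters. This yields w, W and the final update. -/
lemma iwKernel_mul (v₁ v₂ : ℝ) (V₁ V₂ : Ext d) {X : Ext d} (hX : X.PosDef) :
    iwKernel v₁ V₁ X * iwKernel v₂ V₂ X = iwKernel (v₁ + v₂) (V₁ + V₂) X := by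
  rw [iwKernel, iwKernel, iwKernel, mul_add, Matrix.trace_add, mul_add, Real.exp_add,
    show -(v₁ + v₂) / 2 = -v₁ / 2 + -v₂ / 2 by ring, Real.rpow_add hX.det_pos]
  ring

/-- The ratio of two inverse Wishart densities. -/
lemma iwPdf_div_iwPdf {v₁ v₂ : ℝ} {V₁ V₂ : Ext d} (h₁ : 2 * (d : ℝ) < v₁) (h₂ : 2 * (d : ℝ) < v₂)
    (h : 2 * (d : ℝ) < v₁ - v₂) (hV₁ : V₁.PosDef) (hV₂ : V₂.PosDef) (hV : (V₁ - V₂).PosDef) :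
    ∃ c : ℝ, 0 < c ∧ ∀ X : Ext d, X.PosDef →
      iwPdf v₁ V₁ X / iwPdf v₂ V₂ X = c * iwPdf (v₁ - v₂) (V₁ - V₂) X := by
  have c₁ := iw_const_pos h₁ hV₁
  have c₂ := iw_const_pos h₂ hV₂
  have c := iw_const_pos h hV
  refine ⟨_, div_pos (mul_pos c₂ c) c₁, fun X hX => ?_⟩
  have hk := iwKernel_mul (v₁ - v₂) v₂ (V₁ - V₂) V₂ hX
  rw [sub_add_cancel, sub_add_cancel] at hk
  rw [iwPdf_eq h₁ hV₁, iwPdf_eq h₂ hV₂, iwPdf_eq h hV, ← hk]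
  have := iwKernel_pos v₂ V₂ hX
  generalize V₁⁻¹.det ^ ((v₁ - d - 1) / 2) * wishartZ d (v₁ - d - 1) = k₁ at *
  generalize V₂⁻¹.det ^ ((v₂ - d - 1) / 2) * wishartZ d (v₂ - d - 1) = k₂ at *
  generalize (V₁ - V₂)⁻¹.det ^ ((v₁ - v₂ - d - 1) / 2) * wishartZ d (v₁ - v₂ - d - 1) = k at *
  field_simp

lemma iwPdf_mul_iwPdf {v₁ v₂ : ℝ} {V₁ V₂ : Ext d} (h₁ : 2 * (d : ℝ) < v₁) (h₂ : 2 * (d : ℝ) < v₂)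
    (hV₁ : V₁.PosDef) (hV₂ : V₂.PosDef) :
    ∃ c : ℝ, 0 < c ∧ ∀ X : Ext d, X.PosDef →
      iwPdf v₁ V₁ X * iwPdf v₂ V₂ X = c * iwPdf (v₁ + v₂) (V₁ + V₂) X := by
  have h : 2 * (d : ℝ) < v₁ + v₂ := by have : (0 : ℝ) ≤ d := d.cast_nonneg; linarith
  have hV := hV₁.add hV₂
  have c₁ := iw_const_pos h₁ hV₁
  have c₂ := iw_const_pos h₂ hV₂
  have c := iw_const_pos h hV
  refine ⟨_, div_pos c (mul_pos c₁ c₂), fun X hX => ?_⟩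
  rw [iwPdf_eq h₁ hV₁, iwPdf_eq h₂ hV₂, iwPdf_eq h hV, ← iwKernel_mul v₁ v₂ V₁ V₂ hX]
  generalize V₁⁻¹.det ^ ((v₁ - d - 1) / 2) * wishartZ d (v₁ - d - 1) = k₁ at *
  generalize V₂⁻¹.det ^ ((v₂ - d - 1) / 2) * wishartZ d (v₂ - d - 1) = k₂ at *
  generalize (V₁ + V₂)⁻¹.det ^ ((v₁ + v₂ - d - 1) / 2) * wishartZ d (v₁ + v₂ - d - 1) = k at *
  field_simp

lemma extPosterior_eq {nx : ℕ} {filt : GIW nx d} (hf : filt.Valid) {g : ℝ} {G : Ext d}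
    (hg : 2 * (d : ℝ) < g) (hG : G.PosDef) :
    extPosterior filt g G = iwLaw (filt.v + g) (filt.V + G) := by
  obtain ⟨c, hc, h⟩ := iwPdf_mul_iwPdf hf.2.1 hg hf.2.2 hG
  have h' : 2 * (d : ℝ) < filt.v + g := by
    have : (0 : ℝ) ≤ d := d.cast_nonneg
    linarith [hf.2.1]
  have : IsProbabilityMeasure (lawOf (iwPdf (filt.v + g) (filt.V + G))) :=
    isProbabilityMeasure_iwLaw h' (hf.2.2.add hG)
  exact normalize_lawOf (measurable_iwPdf _ _) hc h

lemma ratioLaw_eq {nx : ℕ} {pred fin : GIW nx d} (hp : pred.Valid) (hf : fin.Valid)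
    (hw : 2 * (d : ℝ) < dofDiff pred fin) (hW : (scaleDiff pred fin).PosDef) :
    ratioLaw pred fin = iwLaw (dofDiff pred fin) (scaleDiff pred fin) := by
  obtain ⟨c, hc, h⟩ := iwPdf_div_iwPdf hf.2.1 hp.2.1 hw hf.2.2 hp.2.2 hW
  have : IsProbabilityMeasure (lawOf (iwPdf (dofDiff pred fin) (scaleDiff pred fin))) :=
    isProbabilityMeasure_iwLaw hw hW
  exact normalize_lawOf (measurable_iwPdf _ _) hc h

end Likelihood

/-! ### Moment matching as scalar equations. -/

section Matching

variable {d : ℕ} {μ : Measure (Ext d)} {α β : ℝ} {Ψ : Ext d}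

/-- The first moment forces V onto the ray of Ψ. The second then compares two multiples of Ψ⁻¹, and
one scalar equation for v remains. -/
lemma isIWMatch_iff (hd : 0 < d) (hΨ : Ψ.PosDef) (hα : 0 < α)
    (h1 : QMean μ (fun X => X) (α • Ψ)) (h2 : QMean μ (fun X => X⁻¹) (β • Ψ⁻¹)) {v : ℝ}
    {V : Ext d} : IsIWMatch μ v V ↔ 2 * (d : ℝ) + 2 < v ∧ V = (α * (v - 2 * d - 2)) • Ψ ∧
      v - d - 1 = α * β * (v - 2 * d - 2) := by
  obtain ⟨hm, hM, hI⟩ := h1.hasMoments h2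
  rw [IsIWMatch, hM, hI]
  have key : ∀ c : ℝ, c ≠ 0 → (c • Ψ)⁻¹ = c⁻¹ • Ψ⁻¹ :=
    fun c hc => inv_smul_real c hΨ.det_pos.ne' hc
  constructor
  · rintro ⟨hv, hV, -, e1, e2⟩
    obtain ⟨-, hM', hI'⟩ := (qMean_iwLaw hd hv hV).hasMoments (qMean_inv_iwLaw hd (by linarith) hV)
    have hv0 : v - 2 * d - 2 ≠ 0 := by linarith
    rw [hM'] at e1
    rw [hI'] at e2
    have hVe : V = (α * (v - 2 * d - 2)) • Ψ := by
      rw [mul_comm, ← smul_smul, e1, smul_smul, mul_inv_cancel₀ hv0, one_smul]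
    refine ⟨hv, hVe, ?_⟩
    rw [hVe, key _ (mul_ne_zero hα.ne' hv0), smul_smul] at e2
    have := smul_left_cancel_posDef hd hΨ.inv e2
    rw [this]
    generalize v - 2 * d - 2 = r at hv0
    field_simp
  · rintro ⟨hv, hV, e⟩
    have hv0 : 0 < v - 2 * d - 2 := by linarith
    have hVp : V.PosDef := by rw [hV]; exact hΨ.smul (by positivity)
    obtain ⟨-, hM', hI'⟩ := (qMean_iwLaw hd hv hVp).hasMoments
      (qMean_inv_iwLaw hd (by linarith) hVp)
    refine ⟨hv, hVp, hm, ?_, ?_⟩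
    · rw [hM', hV, smul_smul]
      congr 1; field_simp
    · rw [hI', hV, key _ (mul_pos hα hv0).ne', smul_smul, e]
      congr 1; field_simp

lemma isWishartMatch_iff (hd : 0 < d) (hΨ : Ψ.PosDef) (hα : 0 < α)
    (h1 : QMean μ (fun X => X) (α • Ψ)) (h2 : QMean μ (fun X => X⁻¹) (β • Ψ⁻¹)) {a : ℝ}
    {A : Ext d} : IsWishartMatch μ a A ↔ (d : ℝ) + 1 < a ∧ A = (α / a) • Ψ ∧
      a = α * β * (a - d - 1) := by
  obtain ⟨hm, hM, hI⟩ := h1.hasMoments h2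
  rw [IsWishartMatch, hM, hI]
  have hd0 : (0 : ℝ) ≤ d := d.cast_nonneg
  have key : ∀ c : ℝ, c ≠ 0 → (c • Ψ)⁻¹ = c⁻¹ • Ψ⁻¹ :=
    fun c hc => inv_smul_real c hΨ.det_pos.ne' hc
  constructor
  · rintro ⟨ha, hA, -, e1, e2⟩
    have ha0 : 0 < a := by linarith
    have ha1 : a - d - 1 ≠ 0 := by linarith
    obtain ⟨-, hM', hI'⟩ := (qMean_wishartLaw (by linarith) ha0.le hA).hasMoments
      (qMean_inv_wishartLaw hd ha hA)
    rw [hM'] at e1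
    rw [hI'] at e2
    have hAe : A = (α / a) • Ψ := by
      rw [div_eq_inv_mul, ← smul_smul, e1, smul_smul, inv_mul_cancel₀ ha0.ne', one_smul]
    refine ⟨ha, hAe, ?_⟩
    rw [hAe, key _ (div_ne_zero hα.ne' ha0.ne'), smul_smul] at e2
    have := smul_left_cancel_posDef hd hΨ.inv e2
    rw [this]
    field_simp
  · rintro ⟨ha, hA, e⟩
    have ha0 : 0 < a := by linarith
    have ha1 : 0 < a - d - 1 := by linarith
    have hAp : A.PosDef := by rw [hA]; exact hΨ.smul (by positivity)
    obtain ⟨-, hM', hI'⟩ := (qMean_wishartLaw (by linarith) ha0.le hAp).hasMoments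
      (qMean_inv_wishartLaw hd ha hAp)
    refine ⟨ha, hAp, hm, ?_, ?_⟩
    · rw [hM', hA, smul_smul]
      congr 1; field_simp
    · rw [hI', hA, key _ (div_pos hα ha0).ne', smul_smul]
      congr 1
      rw [inv_div, ← div_eq_inv_mul, div_div, eq_div_iff (mul_pos hα ha1).ne']
      linarith

/-- The target is IW(n, nΨ) with Ψ = B⁻¹YB⁻ᵀ. The scalar equation (n-d-1)(a-d-1) = a(n-2d-2) reduces
to (d+1)(a-(n-d-1)) = 0, so a does not depend on Y. -/
lemma isWishartMatch_likelihoodLaw_iff (hd : 0 < d) {n : ℝ} (hn : 2 * (d : ℝ) + 2 < n)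
    {B Y : Ext d} (hB : B.det ≠ 0) (hY : Y.PosDef) {a : ℝ} {A : Ext d} :
    IsWishartMatch (likelihoodLaw n B Y) a A ↔ a = n - d - 1 ∧
      A = (n / ((n - d - 1) * (n - 2 * d - 2))) • (B⁻¹ * Y * B⁻¹ᵀ) := by
  have hd0 : (0 : ℝ) ≤ d := d.cast_nonneg
  have hΨ := posDef_inv_conj hB hY
  have hV : (n • (B⁻¹ * Y * B⁻¹ᵀ)).PosDef := hΨ.smul (by linarith)
  have h1 := qMean_iwLaw hd hn hV
  have h2 := qMean_inv_iwLaw hd (show 2 * (d : ℝ) < n by linarith) hV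
  have n0 : 0 < n := by linarith
  have n1 : 0 < n - d - 1 := by linarith
  have n2 : 0 < n - 2 * d - 2 := by linarith
  rw [smul_smul] at h1
  rw [inv_smul_real _ hΨ.det_pos.ne' n0.ne', smul_smul] at h2
  rw [likelihoodLaw_eq hd (by linarith) hB hY, isWishartMatch_iff hd hΨ (by positivity) h1 h2]
  have e : ∀ a : ℝ, (a = (n - 2 * d - 2)⁻¹ * n * ((n - d - 1) * n⁻¹) * (a - d - 1)) ↔
      a = n - d - 1 := by
    intro a
    rw [show (n - 2 * d - 2)⁻¹ * n * ((n - d - 1) * n⁻¹) * (a - d - 1) =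
      (n - d - 1) * (a - d - 1) / (n - 2 * d - 2) by field_simp, eq_div_iff n2.ne']
    constructor
    · intro h
      have : (d + 1) * (a - (n - d - 1)) = (0 : ℝ) := by linarith
      rcases mul_eq_zero.1 this with h | h <;> linarith
    · rintro rfl; ring
  rw [e]
  constructor
  · rintro ⟨-, hA, rfl⟩
    refine ⟨rfl, hA.trans ?_⟩
    congr 1; field_simp
  · rintro ⟨rfl, hA⟩
    refine ⟨by linarith, hA.trans ?_, rfl⟩
    congr 1; field_simp

end Matching

/-! ### Conjugate mixtures, generalized beta type II laws and their moments. -/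

section Mixture

variable {d : ℕ}

lemma measurable_trace_inv_mul :
    Measurable fun p : Ext d × Ext d => (p.1⁻¹ * p.2).trace := by
  simp only [Matrix.trace, Matrix.diag_apply, Matrix.mul_apply]
  refine Finset.measurable_sum _ fun i _ => Finset.measurable_sum _ fun j _ => ?_
  exact ((measurable_entry_inv i j).comp measurable_fst).mul
    ((measurable_entry j i).comp measurable_snd)

lemma measurable_wishartKernel_uncurry (n : ℝ) :
    Measurable (Function.uncurry (wishartKernel (d := d) n)) := by
  unfold wishartKernel Function.uncurry
  exact ((measurable_det.comp measurable_snd).pow_const _).mul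
    (measurable_trace_inv_mul.const_mul _).exp

lemma measurable_iwKernel_uncurry (v : ℝ) :
    Measurable (Function.uncurry (iwKernel (d := d) v)) := by
  unfold iwKernel Function.uncurry
  exact ((measurable_det.comp measurable_snd).pow_const _).mul
    ((measurable_trace_inv_mul.comp measurable_swap).const_mul _).exp

lemma measurable_wishartPdf_uncurry (n : ℝ) :
    Measurable (Function.uncurry (wishartPdf (d := d) n)) :=
  (measurable_wishartKernel_uncurry n).div
    ((measurable_wishartKernel_uncurry n).stronglyMeasurable.integral_prod_right.measurable.comp
      measurable_fst)

lemma measurable_iwPdf_uncurry (v : ℝ) :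
    Measurable (Function.uncurry (iwPdf (d := d) v)) :=
  (measurable_iwKernel_uncurry v).div
    ((measurable_iwKernel_uncurry v).stronglyMeasurable.integral_prod_right.measurable.comp
      measurable_fst)

lemma lintegral_mixtureLaw {k : Ext d → Ext d → ℝ} (hk : Measurable (Function.uncurry k))
    {ρ : Measure (Ext d)} [SFinite ρ] {F : Ext d → ℝ≥0∞} (hF : Measurable F) :
    ∫⁻ X, F X ∂mixtureLaw k ρ = ∫⁻ Y, ∫⁻ X, F X ∂lawOf (k Y) ∂ρ := by
  have hk1 : ∀ Y, Measurable (k Y) := fun Y => hk.comp measurable_prodMk_left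
  have hk2 : ∀ X, Measurable fun Y => k Y X := fun X => hk.comp measurable_prodMk_right
  rw [mixtureLaw, lintegral_withDensity_eq_lintegral_mul _ _ hF]
  · simp only [Pi.mul_apply, lintegral_lawOf (hk1 _) hF]
    rw [lintegral_lintegral_swap]
    · refine lintegral_congr fun X => ?_
      rw [lintegral_mul_const _ (hk2 X).ennreal_ofReal]
    · exact (hk.ennreal_ofReal.mul (hF.comp measurable_snd)).aemeasurable
  · exact (hk.comp measurable_swap).ennreal_ofReal.lintegral_prod_right'

/-- The tower property: average the conditional means G(Y) over Y. -/
lemma qMean_mixtureLaw {k : Ext d → Ext d → ℝ} (hk : Measurable (Function.uncurry k))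
    {ρ : Measure (Ext d)} [SFinite ρ] {F G : Ext d → Ext d} {S : Ext d} (hF : Measurable F)
    (hpsd : ∀ X : Ext d, X.PosDef → (F X).PosSemidef)
    (hkF : ∀ᵐ Y ∂ρ, QMean (lawOf (k Y)) F (G Y)) (hG : QMean ρ G S) :
    QMean (mixtureLaw k ρ) F S where
  measurable := hF
  psd := by
    refine (withDensity_absolutelyContinuous _ _).ae_le ?_
    filter_upwards [ae_extVolume_posDef] with X hX using hpsd X hX
  posSemidef := hG.posSemidef
  quad u := by
    rw [lintegral_mixtureLaw (F := fun X => ENNReal.ofReal (u ⬝ᵥ F X *ᵥ u)) hk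
      ((measurable_quad u).comp hF).ennreal_ofReal, ← hG.quad u]
    refine lintegral_congr_ae ?_
    filter_upwards [hkF] with Y hY using hY.quad u

/-- The generalized beta type II kernel with zero lower bound, on positive definite matrices. -/
def gb2Fun (a b : ℝ) (Ω X : Ext d) : ℝ := X.det ^ (a - (d + 1) / 2) * (Ω + X).det ^ (-(a + b))

lemma measurable_gb2Fun (a b : ℝ) (Ω : Ext d) : Measurable (gb2Fun a b Ω) := by
  unfold gb2Fun
  have : Measurable fun X : Ext d => (Ω + X).det :=
    (by fun_prop : Continuous fun X : Ext d => (Ω + X).det).measurable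
  exact (measurable_det.pow_const _).mul (this.pow_const _)

lemma gb2Kernel_eq (a b : ℝ) (Ω : Ext d) {X : Ext d} (hX : X.PosDef) :
    gb2Kernel a b Ω 0 X = gb2Fun a b Ω X := by
  rw [gb2Kernel, gb2Fun, sub_zero, if_pos hX]

/-- A mixture of probability densities has total mass one. Proportionality to the kernel therefore
identifies the law without evaluating a multivariate beta function. -/
lemma mixtureLaw_eq_gb2Law {k : Ext d → Ext d → ℝ} (hk : Measurable (Function.uncurry k))
    {ρ : Measure (Ext d)} [IsProbabilityMeasure ρ]
    (hprob : ∀ᵐ Y ∂ρ, IsProbabilityMeasure (lawOf (k Y))) {a b c : ℝ} {Ω : Ext d}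
    (hΩ : Ω.PosDef) (hc : 0 < c)
    (h : ∀ X : Ext d, X.PosDef → ∫⁻ Y, ENNReal.ofReal (k Y X) ∂ρ =
      ENNReal.ofReal (c * gb2Fun a b Ω X)) : mixtureLaw k ρ = gb2Law a b Ω 0 := by
  have h1 : mixtureLaw k ρ = lawOf fun X => c * gb2Fun a b Ω X := by
    refine withDensity_congr_ae ?_
    filter_upwards [ae_extVolume_posDef] with X hX using h X hX
  have h2 : IsProbabilityMeasure (lawOf fun X => c * gb2Fun a b Ω X) := by
    constructor
    rw [← h1, ← setLIntegral_one, setLIntegral_univ, lintegral_mixtureLaw hk measurable_const]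
    have : ∀ᵐ Y ∂ρ, ∫⁻ _, 1 ∂lawOf (k Y) = 1 := by
      filter_upwards [hprob] with Y hY
      simp
    rw [lintegral_congr_ae this]
    simp
  rw [h1]
  refine (lawOf_div_integral ((measurable_gb2Fun a b Ω).const_mul c) hc
    (fun X hX => by rw [gb2Kernel_eq a b Ω hX]) fun X hX => ?_).symm
  rw [gb2Kernel_eq a b Ω hX]
  exact mul_nonneg (Real.rpow_nonneg hX.det_pos.le _) (Real.rpow_nonneg (hΩ.add hX).det_pos.le _)

/-- As a function of the scale Y, the Wishart density is an inverse Wishart kernel with parameters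
(a, X). The integrand is thus a kernel with parameters (a + w, X + Ω), whose integral supplies the
power of |Ω + X|. -/
lemma mixtureLaw_wishartPdf {a w : ℝ} (hd : 0 < d) (ha : (d : ℝ) - 1 < a) (hw : 2 * (d : ℝ) < w)
    {Ω : Ext d} (hΩ : Ω.PosDef) :
    mixtureLaw (wishartPdf a) (iwLaw w Ω) = gb2Law (a / 2) ((w - d - 1) / 2) Ω 0 := by
  have hd1 : (1 : ℝ) ≤ d := by exact_mod_cast hd
  have hZ := (lintegral_wishartKernel_one (d := d) ha).2
  have hZ' := (lintegral_wishartKernel_one (d := d) (show (d : ℝ) - 1 < a + w - d - 1 by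
    linarith)).2
  have hcw := iw_const_pos hw hΩ
  have := isProbabilityMeasure_iwLaw hw hΩ
  have hpdf := iwPdf_eq hw hΩ
  generalize Ω⁻¹.det ^ ((w - d - 1) / 2) * wishartZ d (w - d - 1) = cw at hcw hpdf
  refine mixtureLaw_eq_gb2Law (measurable_wishartPdf_uncurry a) ?_ hΩ
    (c := wishartZ d (a + w - d - 1) / (wishartZ d a * cw)) (by positivity) fun X hX => ?_
  · filter_upwards [ae_lawOf_posDef _] with Y hY using isProbabilityMeasure_wishartLaw ha hY
  have hX0 := hX.det_pos
  have hXΩ := hX.add hΩ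
  rw [iwLaw, lintegral_lawOf (F := fun Y => ENNReal.ofReal (wishartPdf a Y X))
    (measurable_iwPdf w Ω)
    ((measurable_wishartPdf_uncurry a).comp measurable_prodMk_right).ennreal_ofReal]
  have key : ∀ᵐ Y ∂extVolume d, ENNReal.ofReal (iwPdf w Ω Y) * ENNReal.ofReal (wishartPdf a Y X) =
      ENNReal.ofReal (X.det ^ ((a - d - 1) / 2) / (wishartZ d a * cw)) *
        ENNReal.ofReal (iwKernel (a + w) (X + Ω) Y) := by
    filter_upwards [ae_extVolume_posDef] with Y hY
    have hY0 := hY.det_pos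
    rw [← ENNReal.ofReal_mul (iwPdf_pos hw hΩ hY).le, ← ENNReal.ofReal_mul (by positivity),
      ← iwKernel_mul _ _ _ _ hY, wishartPdf_eq ha hY, hpdf]
    have : wishartKernel a Y X / (Y.det ^ (a / 2) * wishartZ d a) =
        X.det ^ ((a - d - 1) / 2) / wishartZ d a * iwKernel a X Y := by
      rw [wishartKernel, iwKernel, neg_div, Real.rpow_neg hY0.le]
      field_simp
    rw [this]
    congr 1
    field_simp
  rw [lintegral_congr_ae key, lintegral_const_mul' _ _ ENNReal.ofReal_ne_top,
    lintegral_iwKernel (by linarith) hXΩ,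
    ← ENNReal.ofReal_mul (by positivity), Matrix.det_nonsing_inv, Ring.inverse_eq_inv',
    Real.inv_rpow hXΩ.det_pos.le, gb2Fun, Real.rpow_neg (hΩ.add hX).det_pos.le, add_comm X Ω,
    show a / 2 + (w - d - 1) / 2 = (a + w - d - 1) / 2 by ring,
    show a / 2 - ((d : ℝ) + 1) / 2 = (a - d - 1) / 2 by ring]
  congr 1
  ring

lemma det_inv_add_inv {X H : Ext d} (hX : X.PosDef) (hH : H.PosDef) :
    (X⁻¹ + H⁻¹).det = (H + X).det / (X.det * H.det) := by
  have hXu : IsUnit X.det := isUnit_iff_ne_zero.2 hX.det_pos.ne'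
  have hHu : IsUnit H.det := isUnit_iff_ne_zero.2 hH.det_pos.ne'
  have : X⁻¹ + H⁻¹ = X⁻¹ * (H + X) * H⁻¹ := by
    rw [mul_add, add_mul, Matrix.nonsing_inv_mul _ hXu, Matrix.one_mul,
      Matrix.mul_nonsing_inv_cancel_right _ _ hHu]
  rw [this, Matrix.det_mul, Matrix.det_mul, Matrix.det_nonsing_inv, Matrix.det_nonsing_inv,
    Ring.inverse_eq_inv']
  field_simp

/-- The integrand in Y is a Wishart kernel with inverse scale X⁻¹ + H⁻¹, and `det_inv_add_inv`
produces |H + X|. The parameters have the same form as in `mixtureLaw_wishartPdf`, so one matching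
lemma serves both mixtures. -/
lemma mixtureLaw_iwPdf {h g : ℝ} (hd : 0 < d) (hh : (d : ℝ) - 1 < h) (hg : 2 * (d : ℝ) < g)
    {H : Ext d} (hH : H.PosDef) :
    mixtureLaw (iwPdf g) (wishartLaw h H) = gb2Law (h / 2) ((g - d - 1) / 2) H 0 := by
  have hd1 : (1 : ℝ) ≤ d := by exact_mod_cast hd
  have hg' : (d : ℝ) - 1 < g - d - 1 := by linarith
  have hs : (d : ℝ) - 1 < h + g - d - 1 := by linarith
  have hZ := (lintegral_wishartKernel_one (d := d) hg').2
  have hZ' := (lintegral_wishartKernel_one (d := d) hs).2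
  have hch := wishart_const_pos hh hH
  have := isProbabilityMeasure_wishartLaw hh hH
  have hH0 := hH.det_pos
  have hpdf := wishartPdf_eq hh hH
  generalize H.det ^ (h / 2) * wishartZ d h = ch at hch hpdf
  refine mixtureLaw_eq_gb2Law (measurable_iwPdf_uncurry g) ?_ hH
    (c := H.det ^ ((h + g - d - 1) / 2) * wishartZ d (h + g - d - 1) /
      (wishartZ d (g - d - 1) * ch)) (by positivity) fun X hX => ?_
  · filter_upwards [ae_lawOf_posDef _] with Y hY using isProbabilityMeasure_iwLaw hg hY
  have hX0 := hX.det_pos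
  have hT := hX.inv.add hH.inv
  rw [wishartLaw, lintegral_lawOf (F := fun Y => ENNReal.ofReal (iwPdf g Y X))
    (measurable_wishartPdf h H)
    ((measurable_iwPdf_uncurry g).comp measurable_prodMk_right).ennreal_ofReal]
  have key : ∀ᵐ Y ∂extVolume d, ENNReal.ofReal (wishartPdf h H Y) * ENNReal.ofReal (iwPdf g Y X) =
      ENNReal.ofReal (X.det ^ (-g / 2) / (wishartZ d (g - d - 1) * ch)) *
        ENNReal.ofReal (wishartKernel (h + g - d - 1) (X⁻¹ + H⁻¹)⁻¹ Y) := by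
    filter_upwards [ae_extVolume_posDef] with Y hY
    have hY0 := hY.det_pos
    rw [← ENNReal.ofReal_mul (wishartPdf_pos hh hH hY).le, ← ENNReal.ofReal_mul (by positivity),
      hpdf, iwPdf_eq hg hY, wishartKernel, iwKernel, wishartKernel,
      Matrix.nonsing_inv_nonsing_inv _ (isUnit_iff_ne_zero.2 hT.det_pos.ne'), add_mul,
      Matrix.trace_add, mul_add, Real.exp_add, Matrix.det_nonsing_inv, Ring.inverse_eq_inv',
      Real.inv_rpow hY0.le, show (h + g - d - 1 - d - 1) / 2 = (h - d - 1) / 2 + (g - d - 1) / 2 by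
        ring, Real.rpow_add hY0]
    congr 1
    have p1 : 0 < Y.det ^ ((g - d - 1) / 2) := by positivity
    generalize Y.det ^ ((g - d - 1) / 2) = y at *
    field_simp
  have hHX := (hH.add hX).det_pos
  rw [lintegral_congr_ae key, lintegral_const_mul' _ _ ENNReal.ofReal_ne_top,
    lintegral_wishartKernel hs hT.inv, ← ENNReal.ofReal_mul (by positivity),
    Matrix.det_nonsing_inv, Ring.inverse_eq_inv', det_inv_add_inv hX hH, inv_div,
    Real.div_rpow (by positivity) hHX.le, Real.mul_rpow hX0.le hH0.le, gb2Fun, Real.rpow_neg hHX.le,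
    show h / 2 + (g - d - 1) / 2 = (h + g - d - 1) / 2 by ring,
    show h / 2 - ((d : ℝ) + 1) / 2 = -g / 2 + (h + g - d - 1) / 2 by ring, Real.rpow_add hX0]
  congr 1
  ring

/-- Read as a Wishart mixture over an inverse Wishart scale, the law has moments that are products
of the corresponding scalars of the two families. -/
lemma qMean_gb2Law {a w : ℝ} (hd : 0 < d) (ha : (d : ℝ) + 1 < a) (hw : 2 * (d : ℝ) + 2 < w)
    {Ω : Ext d} (hΩ : Ω.PosDef) :
    QMean (gb2Law (a / 2) ((w - d - 1) / 2) Ω 0) (fun X => X) ((a / (w - 2 * d - 2)) • Ω) ∧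
    QMean (gb2Law (a / 2) ((w - d - 1) / 2) Ω 0) (fun X => X⁻¹)
      (((w - d - 1) / (a - d - 1)) • Ω⁻¹) := by
  have hd0 : (0 : ℝ) ≤ d := d.cast_nonneg
  have ha' : (d : ℝ) - 1 < a := by linarith
  have hw' : 2 * (d : ℝ) < w := by linarith
  rw [← mixtureLaw_wishartPdf hd ha' hw' hΩ]
  have := isProbabilityMeasure_iwLaw hw' hΩ
  have smul_q : ∀ {F : Ext d → Ext d} {S : Ext d} (c : ℝ), 0 ≤ c → QMean (iwLaw w Ω) F S →
      QMean (iwLaw w Ω) (fun X => c • F X) (c • S) := by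
    intro F S c hc h
    refine ⟨h.measurable.const_smul c, h.psd.mono fun X hX => hX.smul hc, h.posSemidef.smul hc,
      fun u => ?_⟩
    simp only [Matrix.smul_mulVec, dotProduct_smul, smul_eq_mul, ENNReal.ofReal_mul hc]
    rw [lintegral_const_mul' _ _ ENNReal.ofReal_ne_top, h.quad]
  constructor
  · refine qMean_mixtureLaw (measurable_wishartPdf_uncurry a) measurable_id
      (fun X hX => hX.posSemidef) (G := fun Y => a • Y) ?_ ?_
    · filter_upwards [ae_lawOf_posDef _] with Y hY using
        qMean_wishartLaw ha' (by linarith) hY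
    · rw [div_eq_mul_inv, ← smul_smul]
      exact smul_q a (by linarith) (qMean_iwLaw hd hw hΩ)
  · refine qMean_mixtureLaw (measurable_wishartPdf_uncurry a) measurable_inv
      (fun X hX => hX.inv.posSemidef) (G := fun Y => (a - d - 1)⁻¹ • Y⁻¹) ?_ ?_
    · filter_upwards [ae_lawOf_posDef _] with Y hY using qMean_inv_wishartLaw hd ha hY
    · rw [div_eq_inv_mul, ← smul_smul]
      exact smul_q _ (inv_nonneg.2 (by linarith)) (qMean_inv_iwLaw hd hw' hΩ)

/-- Matching an inverse Wishart law to a generalized beta type II law. -/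
lemma isGB2ThenIW_iff {a w : ℝ} (hd : 0 < d) (ha : (d : ℝ) + 1 < a) (hw : 2 * (d : ℝ) + 2 < w)
    {Ω : Ext d} (hΩ : Ω.PosDef) {v : ℝ} {V : Ext d} :
    IsGB2ThenIW (gb2Law (a / 2) ((w - d - 1) / 2) Ω 0) v V ↔
      v = (a * w + w * (d + 1) - 2 * (d + 1) ^ 2) / (a + w - 2 * (d + 1)) ∧
      V = (a * (a - d - 1) / (a + w - 2 * (d + 1))) • Ω := by
  have hd0 : (0 : ℝ) ≤ d := d.cast_nonneg
  have w2 : 0 < w - 2 * d - 2 := by linarith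
  have a1 : 0 < a - d - 1 := by linarith
  have s0 : 0 < a + w - 2 * (d + 1) := by linarith
  obtain ⟨h1, h2⟩ := qMean_gb2Law hd ha hw hΩ
  have hiff := fun v V => isIWMatch_iff hd hΩ (div_pos (by linarith) w2) h1 h2 (v := v) (V := V)
  have hv : ∀ v : ℝ, (v - d - 1 = a / (w - 2 * d - 2) * ((w - d - 1) / (a - d - 1)) *
      (v - 2 * d - 2)) ↔
      v = (a * w + w * (d + 1) - 2 * (d + 1) ^ 2) / (a + w - 2 * (d + 1)) := by
    intro v
    rw [eq_div_iff s0.ne', div_mul_div_comm, div_mul_eq_mul_div, eq_div_iff (mul_pos w2 a1).ne']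
    have hp : (0 : ℝ) < d + 1 := by linarith
    constructor
    · intro h
      have : ((d : ℝ) + 1) * (v * (a + w - 2 * (d + 1)) -
          (a * w + w * (d + 1) - 2 * (d + 1) ^ 2)) = 0 := by linear_combination -h
      rcases mul_eq_zero.1 this with h | h <;> linarith
    · intro h
      linear_combination -((d : ℝ) + 1) * h
  have key : IsIWMatch (gb2Law (a / 2) ((w - d - 1) / 2) Ω 0) v V ↔
      v = (a * w + w * (d + 1) - 2 * (d + 1) ^ 2) / (a + w - 2 * (d + 1)) ∧
      V = (a * (a - d - 1) / (a + w - 2 * (d + 1))) • Ω := by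
    rw [hiff, hv]
    have hsub : v = (a * w + w * (d + 1) - 2 * (d + 1) ^ 2) / (a + w - 2 * (d + 1)) →
        v - 2 * d - 2 = (a - d - 1) * (w - 2 * d - 2) / (a + w - 2 * (d + 1)) := by
      rintro rfl
      rw [eq_div_iff s0.ne', sub_mul, sub_mul, div_mul_cancel₀ _ s0.ne']
      ring
    have hcoef : v = (a * w + w * (d + 1) - 2 * (d + 1) ^ 2) / (a + w - 2 * (d + 1)) →
        a / (w - 2 * d - 2) * (v - 2 * d - 2) = a * (a - d - 1) / (a + w - 2 * (d + 1)) := by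
      intro h
      rw [hsub h]
      field_simp
    constructor
    · rintro ⟨-, hV, h⟩
      exact ⟨h, by rw [hV, hcoef h]⟩
    · rintro ⟨h, hV⟩
      refine ⟨?_, by rw [hV, hcoef h], h⟩
      have := hsub h
      have : 0 < v - 2 * d - 2 := by rw [this]; positivity
      linarith
  rw [← key]
  constructor
  · rintro ⟨α, β, Ω', -, -, -, h, hm⟩
    rwa [h]
  · intro hm
    exact ⟨a / 2, (w - d - 1) / 2, Ω, by linarith, by linarith, hΩ, rfl, hm⟩

end Mixture

/-! ### The approximate message for a fixed extent transformation. -/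

section MessageApprox

variable {d : ℕ}

lemma lintegral_iwLaw_conj {v : ℝ} (hv : 2 * (d : ℝ) < v) {V : Ext d} (hV : V.PosDef)
    {B : Ext d} (hB : B.det ≠ 0) {F : Ext d → ℝ≥0∞} (hF : Measurable F) :
    ∫⁻ X, F X ∂iwLaw v (B * V * Bᵀ) = ∫⁻ X, F (B * X * Bᵀ) ∂iwLaw v V := by
  have hBu : IsUnit B.det := isUnit_iff_ne_zero.2 hB
  have hBV : (B * V * Bᵀ).PosDef := (posDef_conj_iff hB).2 hV
  have hC : B⁻¹ᵀ.det ≠ 0 := by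
    rw [Matrix.det_transpose, Matrix.det_nonsing_inv, Ring.inverse_eq_inv']
    exact inv_ne_zero hB
  have h1 : (B * V * Bᵀ)⁻¹ = B⁻¹ᵀ * V⁻¹ * B⁻¹ᵀᵀ := by rw [inv_conj, Matrix.transpose_transpose]
  rw [lintegral_iwLaw hv hBV hF, lintegral_iwLaw (F := fun X => F (B * X * Bᵀ)) hv hV
    (hF.comp (measurable_conj B)), h1, lintegral_wishartLaw_conj (F := fun X => F X⁻¹)
    (by linarith) hV.inv hC (hF.comp measurable_inv)]
  refine lintegral_congr fun X => ?_
  have e : (B⁻¹ᵀ)⁻¹ = Bᵀ := by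
    rw [Matrix.transpose_nonsing_inv, Matrix.nonsing_inv_nonsing_inv _
      (by rwa [Matrix.det_transpose])]
  rw [inv_conj, e, Matrix.transpose_transpose]

lemma isMessageApprox_scalars {n w : ℝ} (hn : 2 * (d : ℝ) + 2 < n) (hw : 2 * (d : ℝ) + 2 < w) :
    0 < n + w - 3 * (d + 1) ∧
    (1 + (w - 3 * (d + 1)) / n)⁻¹ = n / (n + w - 3 * (d + 1)) ∧
    2 * (d : ℝ) + 2 < (1 + (w - 3 * (d + 1)) / n)⁻¹ * (w - 2 * (d + 1) ^ 2 / n) := by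
  have hd0 : (0 : ℝ) ≤ d := d.cast_nonneg
  have s0 : 0 < n + w - 3 * (d + 1) := by linarith
  have n0 : 0 < n := by linarith
  have e : (1 + (w - 3 * (d + 1)) / n)⁻¹ = n / (n + w - 3 * (d + 1)) := by
    rw [one_add_div n0.ne', inv_div]
    congr 1; ring
  refine ⟨s0, e, ?_⟩
  rw [e, div_mul_eq_mul_div, lt_div_iff₀ s0]
  have e2 : n * (w - 2 * (d + 1) ^ 2 / n) = n * w - 2 * (d + 1) ^ 2 := by field_simp
  rw [e2]
  -- The gap between the two sides is exactly (n-2d-2)(w-2d-2).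
  nlinarith [mul_pos (show 0 < n - 2 * d - 2 by linarith) (show 0 < w - 2 * d - 2 by linarith)]

/-- The closed form message approximation for a fixed extent transformation. -/
lemma isMessageApprox_iff {n w : ℝ} (hd : 0 < d) (hn : 2 * (d : ℝ) + 2 < n)
    (hw : 2 * (d : ℝ) + 2 < w) {W : Ext d} (hW : W.PosDef) {B : Ext d} (hB : B.det ≠ 0) {g : ℝ}
    {Γ : Ext d} :
    IsMessageApprox (iwLaw w W) n B g Γ ↔
      g = (1 + (w - 3 * (d + 1)) / n)⁻¹ * (w - 2 * (d + 1) ^ 2 / n) ∧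
      Γ = (1 + (w - 3 * (d + 1)) / n)⁻¹ • (B⁻¹ * W * B⁻¹ᵀ) := by
  have hd0 : (0 : ℝ) ≤ d := d.cast_nonneg
  obtain ⟨s0, hη, -⟩ := isMessageApprox_scalars hn hw
  have n0 : 0 < n := by linarith
  have n1 : 0 < n - d - 1 := by linarith
  have n2 : 0 < n - 2 * d - 2 := by linarith
  set c := n / ((n - d - 1) * (n - 2 * d - 2)) with hc
  have hc0 : 0 < c := by positivity
  have hΦ := posDef_inv_conj hB hW
  have hΩ : (c • (B⁻¹ * W * B⁻¹ᵀ)).PosDef := hΦ.smul hc0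
  -- Absorbing √c makes the matched scale a congruence of Y. The mixture over IW(w, W) becomes one
  -- over IW(w, cB⁻¹WB⁻ᵀ), with the scale itself as mixing variable.
  have hD : ∀ Y : Ext d, c • (B⁻¹ * Y * B⁻¹ᵀ) = (√c • B⁻¹) * Y * (√c • B⁻¹)ᵀ := by
    intro Y
    rw [Matrix.transpose_smul, Matrix.smul_mul, Matrix.smul_mul, Matrix.mul_smul, smul_smul,
      Real.mul_self_sqrt hc0.le]
  have hDdet : (√c • B⁻¹).det ≠ 0 := by
    rw [Matrix.det_smul, Matrix.det_nonsing_inv, Ring.inverse_eq_inv']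
    exact mul_ne_zero (pow_ne_zero _ (Real.sqrt_pos.2 hc0).ne') (inv_ne_zero hB)
  have hmix : ∀ A : Ext d → Ext d, (∀ Y : Ext d, Y.PosDef → A Y = c • (B⁻¹ * Y * B⁻¹ᵀ)) →
      mixtureLaw (fun Y => wishartPdf (n - d - 1) (A Y)) (iwLaw w W) =
        gb2Law ((n - d - 1) / 2) ((w - d - 1) / 2) (c • (B⁻¹ * W * B⁻¹ᵀ)) 0 := by
    intro A hA
    rw [← mixtureLaw_wishartPdf hd (by linarith) (by linarith) hΩ, mixtureLaw, mixtureLaw]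
    congr 1
    ext X
    rw [hD, lintegral_iwLaw_conj (F := fun Y => ENNReal.ofReal (wishartPdf (n - d - 1) Y X))
      (by linarith) hW hDdet
      ((measurable_wishartPdf_uncurry _).comp measurable_prodMk_right).ennreal_ofReal]
    refine lintegral_congr_ae ?_
    filter_upwards [ae_lawOf_posDef _] with Y hY
    rw [hA Y hY, hD]
  have hfin : ∀ A : Ext d → Ext d, (∀ Y : Ext d, Y.PosDef → A Y = c • (B⁻¹ * Y * B⁻¹ᵀ)) →
      (IsGB2ThenIW (mixtureLaw (fun Y => wishartPdf (n - d - 1) (A Y)) (iwLaw w W)) g Γ ↔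
      g = (1 + (w - 3 * (d + 1)) / n)⁻¹ * (w - 2 * (d + 1) ^ 2 / n) ∧
      Γ = (1 + (w - 3 * (d + 1)) / n)⁻¹ • (B⁻¹ * W * B⁻¹ᵀ)) := by
    intro A hA
    rw [hmix A hA, isGB2ThenIW_iff hd (by linarith) hw hΩ, hη, smul_smul]
    have e1 : n - d - 1 + w - 2 * (d + 1) = n + w - 3 * (d + 1) := by ring
    have e2 : ((n - d - 1) * w + w * (d + 1) - 2 * (d + 1) ^ 2) / (n - d - 1 + w - 2 * (d + 1)) =
        n / (n + w - 3 * (d + 1)) * (w - 2 * (d + 1) ^ 2 / n) := by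
      rw [e1, div_mul_eq_mul_div]
      congr 1
      field_simp
      ring
    have e3 : (n - d - 1) * (n - d - 1 - d - 1) / (n - d - 1 + w - 2 * (d + 1)) * c =
        n / (n + w - 3 * (d + 1)) := by
      rw [e1, hc, show n - d - 1 - d - 1 = n - 2 * d - 2 by ring]
      generalize n + w - 3 * (d + 1) = s at s0
      generalize n - d - 1 = r₁ at n1
      generalize n - 2 * d - 2 = r₂ at n2
      field_simp
    rw [e2, e3]
  constructor
  · rintro ⟨a, A, hA, hG⟩
    have hA' := fun Y hY => (isWishartMatch_likelihoodLaw_iff hd hn hB hY).1 (hA Y hY)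
    -- Any positive definite Y determines a. The map A is determined only on the cone, which carries
    -- the mixing law.
    obtain rfl : a = n - d - 1 := (hA' 1 Matrix.PosDef.one).1
    exact (hfin A fun Y hY => (hA' Y hY).2).1 hG
  · intro h
    exact ⟨n - d - 1, fun Y => c • (B⁻¹ * Y * B⁻¹ᵀ),
      fun Y hY => (isWishartMatch_likelihoodLaw_iff hd hn hB hY).2 ⟨rfl, rfl⟩,
      (hfin _ fun _ _ => rfl).2 h⟩

end MessageApprox

/-! ### Jensen's inequality for the matrix inverse and the trace bound. -/

section Jensen

variable {d : ℕ} {α : Type*} [MeasurableSpace α] {κ : Measure α}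

/-- The entrywise mean of a random matrix. -/
def matMean (κ : Measure α) (F : α → Ext d) : Ext d := Matrix.of fun i j => ∫ x, F x i j ∂κ

lemma integrable_quad {F : α → Ext d} (hF : ∀ i j, Integrable (fun x => F x i j) κ)
    (u v : Fin d → ℝ) : Integrable (fun x => u ⬝ᵥ F x *ᵥ v) κ := by
  simp only [dotProduct, Matrix.mulVec]
  exact integrable_finsetSum _ fun i _ => (integrable_finsetSum _ fun j _ =>
    (hF i j).mul_const _).const_mul _

lemma quad_matMean {F : α → Ext d} (hF : ∀ i j, Integrable (fun x => F x i j) κ)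
    (u v : Fin d → ℝ) : u ⬝ᵥ matMean κ F *ᵥ v = ∫ x, u ⬝ᵥ F x *ᵥ v ∂κ := by
  simp only [dotProduct, Matrix.mulVec, matMean, Matrix.of_apply]
  rw [integral_finsetSum _ fun i _ => (integrable_finsetSum _ fun j _ =>
    (hF i j).mul_const _).const_mul _]
  refine Finset.sum_congr rfl fun i _ => ?_
  rw [integral_const_mul, integral_finsetSum _ fun j _ => (hF i j).mul_const _]
  simp only [integral_mul_const]

lemma isHermitian_matMean {F : α → Ext d} (hF : ∀ x, (F x).IsSymm) :
    (matMean κ F).IsHermitian := by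
  rw [Matrix.IsHermitian, Matrix.conjTranspose_eq_transpose_of_trivial]
  ext i j
  simp only [matMean, Matrix.transpose_apply, Matrix.of_apply]
  congr 1
  ext x
  exact (hF x).apply i j

lemma posDef_matMean [IsProbabilityMeasure κ] {F : α → Ext d}
    (hF : ∀ i j, Integrable (fun x => F x i j) κ) (hpos : ∀ x, (F x).PosDef) :
    (matMean κ F).PosDef := by
  refine Matrix.PosDef.of_dotProduct_mulVec_pos (isHermitian_matMean fun x => (hpos x).isSymm)
    fun u hu => ?_
  have hq : ∀ x, 0 < u ⬝ᵥ F x *ᵥ u := fun x => by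
    simpa using (hpos x).dotProduct_mulVec_pos hu
  rw [star_trivial, quad_matMean hF,
    integral_pos_iff_support_of_nonneg (fun x => (hq x).le) (integrable_quad hF u u)]
  have : Function.support (fun x => u ⬝ᵥ F x *ᵥ u) = Set.univ :=
    Set.eq_univ_of_forall fun x => (hq x).ne'
  rw [this, measure_univ]
  exact one_pos

/-- Jensen's inequality for the matrix inverse: `E[F⁻¹] ≥ E[F]⁻¹`. -/
lemma posSemidef_matMean_inv_sub [IsProbabilityMeasure κ] {F : α → Ext d}
    (hF : ∀ i j, Integrable (fun x => F x i j) κ)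
    (hF' : ∀ i j, Integrable (fun x => (F x)⁻¹ i j) κ) (hpos : ∀ x, (F x).PosDef) :
    (matMean κ (fun x => (F x)⁻¹) - (matMean κ F)⁻¹).PosSemidef := by
  have hC := posDef_matMean hF hpos
  have hH : (matMean κ (fun x => (F x)⁻¹)).IsHermitian :=
    isHermitian_matMean fun x => (hpos x).inv.isSymm
  refine Matrix.PosSemidef.of_dotProduct_mulVec_nonneg (hH.sub hC.inv.isHermitian) fun u => ?_
  set v := (matMean κ F)⁻¹ *ᵥ u with hv
  have hCv : matMean κ F *ᵥ v = u := by
    rw [hv, Matrix.mulVec_mulVec,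
      Matrix.mul_nonsing_inv _ (isUnit_iff_ne_zero.2 hC.det_pos.ne'), Matrix.one_mulVec]
  -- A supporting affine function of F for F ↦ uᵀF⁻¹u, obtained by expanding the F(x)-square of
  -- F(x)⁻¹u - v ≥ 0. Integrating it with v = E[F]⁻¹u gives the inequality.
  have hpt : ∀ x, 2 * (u ⬝ᵥ v) - v ⬝ᵥ F x *ᵥ v ≤ u ⬝ᵥ (F x)⁻¹ *ᵥ u := by
    intro x
    have hu : IsUnit (F x).det := isUnit_iff_ne_zero.2 (hpos x).det_pos.ne'
    have h := quad_nonneg (hpos x).posSemidef ((F x)⁻¹ *ᵥ u - v)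
    have e1 : F x *ᵥ ((F x)⁻¹ *ᵥ u) = u := by
      rw [Matrix.mulVec_mulVec, Matrix.mul_nonsing_inv _ hu, Matrix.one_mulVec]
    have e2 : ((F x)⁻¹ *ᵥ u) ⬝ᵥ F x *ᵥ v = u ⬝ᵥ v := by
      rw [Matrix.dotProduct_mulVec, ← Matrix.mulVec_transpose, (hpos x).isSymm.eq, e1]
    rw [Matrix.mulVec_sub, e1, sub_dotProduct, dotProduct_sub, dotProduct_sub, e2,
      dotProduct_comm v u, dotProduct_comm _ u] at h
    linarith
  have hint := integral_mono ((integrable_const (2 * (u ⬝ᵥ v))).sub (integrable_quad hF v v))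
    (integrable_quad hF' u u) hpt
  rw [star_trivial, Matrix.sub_mulVec, dotProduct_sub, quad_matMean hF', ← hv]
  have e3 : ∫ x, (2 * (u ⬝ᵥ v) - v ⬝ᵥ F x *ᵥ v) ∂κ = u ⬝ᵥ v := by
    rw [integral_sub (integrable_const _) (integrable_quad hF v v), ← quad_matMean hF, hCv,
      integral_const, dotProduct_comm v u]
    simp
    ring
  have : u ⬝ᵥ v ≤ ∫ x, u ⬝ᵥ (F x)⁻¹ *ᵥ u ∂κ := e3 ▸ hint
  linarith

lemma trace_mul_pos (hd : 0 < d) {P Q : Ext d} (hP : P.PosDef) (hQ : Q.PosDef) :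
    0 < (P * Q).trace := by
  obtain ⟨R, hR, rfl⟩ := hP.exists_eq_mul_transpose
  have : Nonempty (Fin d) := ⟨⟨0, hd⟩⟩
  have h := (posDef_conj_iff (B := Rᵀ) (by rwa [Matrix.det_transpose])).2 hQ
  rw [Matrix.transpose_transpose] at h
  rw [Matrix.mul_assoc, Matrix.trace_mul_comm]
  exact h.trace_pos

/-- Since CD - 1 = (C - D⁻¹)D, invertibility upgrades C - D⁻¹ to positive definite. The trace is
then d plus the positive number tr{D⁻¹(C - D⁻¹)⁻¹}. -/
lemma lt_trace_mul_inv_sub_one (hd : 0 < d) {C D : Ext d} (hD : D.PosDef)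
    (hCD : (C - D⁻¹).PosSemidef) (hu : IsUnit (C * D - 1).det) :
    (d : ℝ) < (C * D * (C * D - 1)⁻¹).trace := by
  have hDu : IsUnit D.det := isUnit_iff_ne_zero.2 hD.det_pos.ne'
  have e : C * D - 1 = (C - D⁻¹) * D := by rw [sub_mul, Matrix.nonsing_inv_mul _ hDu]
  have hpd : (C - D⁻¹).PosDef := by
    refine posDef_iff_posSemidef_det.2 ⟨hCD, fun h => hu.ne_zero ?_⟩
    rw [e, Matrix.det_mul, h, zero_mul]
  have e2 : C * D * (C * D - 1)⁻¹ = 1 + D⁻¹ * (C - D⁻¹)⁻¹ := by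
    rw [← Matrix.mul_inv_rev, ← e]
    conv_lhs => rw [show C * D = (C * D - 1) + 1 by abel]
    rw [add_mul, add_sub_cancel_right, Matrix.mul_nonsing_inv _ hu, one_mul]
  rw [e2, Matrix.trace_add, Matrix.trace_one, Fintype.card_fin]
  linarith [trace_mul_pos hd hD.inv hpd.inv]

end Jensen

/-! ### The approximate message averaged over the kinematic state. -/

section AveragedApprox

variable {d : ℕ}

/-- For W(h, H) the matrix C is h/(h-d-1) times the identity, so tr{C(C-I)⁻¹} = dh/(d+1). Being
linear in h, this explains the factor (d+1)/d and gives uniqueness; the lower bound on the trace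
makes the solution admissible. -/
lemma isWishartTraceMatch_iff (hd : 0 < d) {μ : Measure (Ext d)} {m I : Ext d}
    (hμ : HasMoments μ) (hm : meanMat μ = m) (hI : meanInv μ = I) (hpos : m.PosDef)
    (hu : IsUnit (I * m - 1).det) (htr : (d : ℝ) < (I * m * (I * m - 1)⁻¹).trace) {h : ℝ}
    {H : Ext d} :
    IsWishartTraceMatch μ h H ↔
      h = ((d : ℝ) + 1) / d * (I * m * (I * m - 1)⁻¹).trace ∧ H = h⁻¹ • m := by
  have hd0 : (0 : ℝ) < d := by exact_mod_cast hd
  have key : ∀ h : ℝ, ∀ H : Ext d, (d : ℝ) + 1 < h → H.PosDef →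
      meanMat (wishartLaw h H) = h • H ∧
      (meanInv (wishartLaw h H) * meanMat (wishartLaw h H) *
        (meanInv (wishartLaw h H) * meanMat (wishartLaw h H) - 1)⁻¹).trace =
      d / ((d : ℝ) + 1) * h := by
    intro h H hh hH
    obtain ⟨-, hM', hI'⟩ := (qMean_wishartLaw (by linarith) (by linarith) hH).hasMoments
      (qMean_inv_wishartLaw hd hh hH)
    refine ⟨hM', ?_⟩
    have h1 : h - d - 1 ≠ 0 := by linarith
    have h0 : h ≠ 0 := by linarith
    have e : (h - d - 1)⁻¹ * h - 1 = (d + 1) / (h - d - 1) := by field_simp; ring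
    have e0 : ((d : ℝ) + 1) / (h - d - 1) ≠ 0 := div_ne_zero (by linarith) h1
    have e1 : (h - d - 1)⁻¹ • H⁻¹ * h • H = ((h - d - 1)⁻¹ * h) • (1 : Ext d) := by
      rw [Matrix.smul_mul, Matrix.mul_smul, smul_smul,
        Matrix.nonsing_inv_mul _ (isUnit_iff_ne_zero.2 hH.det_pos.ne')]
    have e2 : ((h - d - 1)⁻¹ * h) • (1 : Ext d) - 1 = ((d + 1) / (h - d - 1)) • (1 : Ext d) := by
      rw [← e, sub_smul, one_smul]
    rw [hM', hI', e1, e2, inv_smul_real _ (by simp) e0, inv_one, Matrix.smul_mul, Matrix.mul_smul,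
      mul_one, smul_smul, Matrix.trace_smul, Matrix.trace_one, Fintype.card_fin, smul_eq_mul]
    field_simp
  rw [IsWishartTraceMatch, hm, hI]
  constructor
  · rintro ⟨hh, hH, -, e1, -, e2⟩
    obtain ⟨k1, k2⟩ := key h H hh hH
    rw [k1] at e1
    rw [k2] at e2
    refine ⟨?_, ?_⟩
    · rw [e2]; field_simp
    · rw [e1, smul_smul, inv_mul_cancel₀ (by linarith), one_smul]
  · rintro ⟨rfl, rfl⟩
    set t := (I * m * (I * m - 1)⁻¹).trace
    have hh : (d : ℝ) + 1 < (d + 1) / d * t := by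
      rw [div_mul_eq_mul_div, lt_div_iff₀ hd0]
      exact mul_lt_mul_of_pos_left htr (by linarith)
    have h0 : 0 < (d + 1) / d * t := by linarith
    have hH : (((d + 1) / d * t)⁻¹ • m).PosDef := hpos.smul (inv_pos.2 h0)
    obtain ⟨k1, k2⟩ := key _ _ hh hH
    refine ⟨hh, hH, hμ, ?_, hu, ?_⟩
    · rw [k1, smul_smul, mul_inv_cancel₀ h0.ne', one_smul]
    · rw [k2]; field_simp

lemma averagedApprox_scalars {g h : ℝ} (hg : 2 * (d : ℝ) + 2 < g) (hh : (d : ℝ) + 1 < h) :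
    (h * g + g * (d + 1) - 2 * (d + 1) ^ 2) / (h + g - 2 * (d + 1)) =
      (1 + (g - 3 * d - 3) / (h + d + 1))⁻¹ * (g - 2 * (d + 1) ^ 2 / (h + d + 1)) ∧
    h * (h - d - 1) / (h + g - 2 * (d + 1)) * h⁻¹ = (1 + (g - d - 1) / (h - d - 1))⁻¹ := by
  have hd0 : (0 : ℝ) ≤ d := d.cast_nonneg
  have s0 : h + g - 2 * (d + 1) ≠ 0 := by linarith
  have h1 : h + d + 1 ≠ 0 := by linarith
  have h2 : h - d - 1 ≠ 0 := by linarith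
  have h0 : h ≠ 0 := by linarith
  constructor
  · rw [one_add_div h1, inv_div, div_mul_eq_mul_div, show h + d + 1 + (g - 3 * d - 3) =
      h + g - 2 * (d + 1) by ring]
    congr 1
    field_simp
    ring
  · rw [one_add_div h2, inv_div, show h - d - 1 + (g - d - 1) = h + g - 2 * (d + 1) by ring]
    field_simp

variable {nx : ℕ}

lemma measurable_conj_inv {α : Type*} [MeasurableSpace α] {M : α → Ext d} (hM : Measurable M)
    (W : Ext d) : Measurable fun x => (M x)⁻¹ * W * (M x)⁻¹ᵀ := by
  have h : ∀ i j, Measurable fun x => (M x)⁻¹ i j := fun i j =>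
    (measurable_entry_inv i j).comp hM
  refine measurable_ext_iff.2 fun i j => ?_
  simp only [Matrix.mul_apply, Matrix.transpose_apply, Finset.sum_mul]
  exact Finset.measurable_fun_sum _ fun k _ => Finset.measurable_fun_sum _ fun l _ =>
    ((h i l).mul_const _).mul (h j k)

/-- The closed form approximation of the averaged extent message. -/
lemma isAveragedMessageApprox_iff (hd : 0 < d) {n w : ℝ} (hn : 2 * (d : ℝ) + 2 < n)
    (hw : 2 * (d : ℝ) + 2 < w) {W : Ext d} (hW : W.PosDef) {M : Kin nx → Ext d}
    (hM : Measurable M) (hMdet : ∀ x, (M x).det ≠ 0) {κ : Measure (Kin nx)}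
    [IsProbabilityMeasure κ] {C₃ C₄ : Ext d}
    (h3 : ∀ i j, Integrable (fun x => ((M x)ᵀ * W⁻¹ * M x) i j) κ)
    (h4 : ∀ i j, Integrable (fun x => ((M x)⁻¹ * W * (M x)⁻¹ᵀ) i j) κ)
    (hC₃ : C₃ = matMean κ fun x => (M x)ᵀ * W⁻¹ * M x)
    (hC₄ : C₄ = matMean κ fun x => (M x)⁻¹ * W * (M x)⁻¹ᵀ)
    (hu : IsUnit (C₃ * C₄ - 1).det) {η g h : ℝ} (hη : η = 1 + (w - 3 * (d + 1)) / n)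
    (hg : g = η⁻¹ * (w - 2 * (d + 1) ^ 2 / n))
    (hh : h = ((d : ℝ) + 1) / d * (C₃ * C₄ * (C₃ * C₄ - 1)⁻¹).trace) {g₂ : ℝ} {V₂ : Ext d} :
    (d : ℝ) + 1 < h ∧
    (IsAveragedMessageApprox (iwLaw w W) n M κ g₂ V₂ ↔
      g₂ = (1 + (g - 3 * d - 3) / (h + d + 1))⁻¹ * (g - 2 * (d + 1) ^ 2 / (h + d + 1)) ∧
      V₂ = (η⁻¹ * (1 + (g - d - 1) / (h - d - 1))⁻¹) • C₄) := by
  have hd0 : (0 : ℝ) < d := by exact_mod_cast hd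
  obtain ⟨s0, e, hg2⟩ := isMessageApprox_scalars hn hw
  rw [← hη, ← hg] at hg2
  rw [← hη] at e
  have n0 : 0 < n := by linarith
  have hη0 : 0 < η⁻¹ := by rw [e]; positivity
  have hηne : η ≠ 0 := fun h0 => by simp [h0] at hη0
  have hpd : ∀ x, ((M x)⁻¹ * W * (M x)⁻¹ᵀ).PosDef := fun x => posDef_inv_conj (hMdet x) hW
  have hinv : ∀ x, ((M x)⁻¹ * W * (M x)⁻¹ᵀ)⁻¹ = (M x)ᵀ * W⁻¹ * M x := by
    intro x
    rw [inv_conj, Matrix.nonsing_inv_nonsing_inv _ (isUnit_iff_ne_zero.2 (hMdet x))]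
  have h3' : ∀ i j, Integrable (fun x => ((M x)⁻¹ * W * (M x)⁻¹ᵀ)⁻¹ i j) κ := by
    simpa only [hinv] using h3
  have hC4pos : C₄.PosDef := hC₄ ▸ posDef_matMean h4 hpd
  have hJ : (C₃ - C₄⁻¹).PosSemidef := by
    have := posSemidef_matMean_inv_sub h4 h3' hpd
    simp only [hinv] at this
    rwa [← hC₃, ← hC₄] at this
  have htr := lt_trace_mul_inv_sub_one hd hC4pos hJ hu
  have hhp : (d : ℝ) + 1 < h := by
    rw [hh, div_mul_eq_mul_div, lt_div_iff₀ hd0]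
    exact mul_lt_mul_of_pos_left htr (by linarith)
  refine ⟨hhp, ?_⟩
  set Γ₀ : Kin nx → Ext d := fun x => η⁻¹ • ((M x)⁻¹ * W * (M x)⁻¹ᵀ) with hΓ₀
  have hΓm : Measurable Γ₀ := by
    have := measurable_conj_inv hM W
    exact measurable_ext_iff.2 fun i j => (measurable_ext_iff.1 this i j).const_mul _
  have hΓinv : ∀ x, (Γ₀ x)⁻¹ = η • ((M x)ᵀ * W⁻¹ * M x) := by
    intro x
    rw [hΓ₀, inv_smul_real _ (hpd x).det_pos.ne' hη0.ne', hinv, inv_inv]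
  have hmom : HasMoments (κ.map Γ₀) := by
    intro i j
    constructor
    · rw [integrable_map_measure (measurable_entry i j).aestronglyMeasurable hΓm.aemeasurable]
      exact (h4 i j).const_mul _
    · rw [integrable_map_measure (measurable_entry_inv i j).aestronglyMeasurable hΓm.aemeasurable]
      simp only [Function.comp_def, hΓinv]
      exact (h3 i j).const_mul _
  have hmM : meanMat (κ.map Γ₀) = η⁻¹ • C₄ := by
    ext i j
    rw [meanMat, Matrix.of_apply, integral_map hΓm.aemeasurable
      (measurable_entry i j).aestronglyMeasurable, hC₄]
    exact integral_const_mul _ _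
  have hmI : meanInv (κ.map Γ₀) = η • C₃ := by
    ext i j
    rw [meanInv, Matrix.of_apply, integral_map hΓm.aemeasurable
      (measurable_entry_inv i j).aestronglyMeasurable, hC₃]
    simp only [hΓinv]
    exact integral_const_mul _ _
  -- The scalar η cancels in E[Γ⁻¹]E[Γ], so h involves only C₃C₄.
  have hprod : (η • C₃) * (η⁻¹ • C₄) = C₃ * C₄ := by
    rw [Matrix.smul_mul, Matrix.mul_smul, smul_smul, mul_inv_cancel₀ hηne, one_smul]
  have hmatch := fun h H => isWishartTraceMatch_iff hd hmom hmM hmI (hC4pos.smul hη0)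
    (by rwa [hprod]) (by rwa [hprod]) (h := h) (H := H)
  rw [hprod] at hmatch
  have hH₀ : (h⁻¹ • η⁻¹ • C₄).PosDef := (hC4pos.smul hη0).smul (inv_pos.2 (by linarith))
  have hfin : IsGB2ThenIW (mixtureLaw (fun G => iwPdf g G) (wishartLaw h (h⁻¹ • η⁻¹ • C₄))) g₂ V₂ ↔
      g₂ = (1 + (g - 3 * d - 3) / (h + d + 1))⁻¹ * (g - 2 * (d + 1) ^ 2 / (h + d + 1)) ∧
      V₂ = (η⁻¹ * (1 + (g - d - 1) / (h - d - 1))⁻¹) • C₄ := by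
    obtain ⟨a1, a2⟩ := averagedApprox_scalars hg2 hhp
    rw [mixtureLaw_iwPdf hd (by linarith) (by linarith) hH₀, isGB2ThenIW_iff hd hhp hg2 hH₀, a1,
      smul_smul, a2, smul_smul, mul_comm η⁻¹]
  rw [← hfin]
  constructor
  · rintro ⟨g', Γ, h', H, hΓ, hT, hB⟩
    have hΓ' := fun x => (isMessageApprox_iff hd hn hw hW (hMdet x)).1 (hΓ x)
    have hg' : g' = g := by rw [(hΓ' 0).1, ← hη, hg]
    have hΓe : Γ = Γ₀ := funext fun x => by rw [(hΓ' x).2, ← hη]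
    rw [hΓe] at hT
    obtain ⟨t1, t2⟩ := (hmatch _ _).1 hT
    rw [← hh] at t1
    rw [hg', t2, t1] at hB
    exact hB
  · intro hB
    refine ⟨g, Γ₀, h, _, fun x => (isMessageApprox_iff hd hn hw hW (hMdet x)).2 ?_,
      (hmatch _ _).2 ⟨hh, rfl⟩, hB⟩
    rw [← hη]
    exact ⟨hg, rfl⟩

end AveragedApprox

/-! ### Possibly degenerate Gaussian laws: densities and backward conditioning. -/

section Gaussian

open scoped RealInnerProductSpace

variable {nx : ℕ}

/-- A matrix acting on kinematic vectors. -/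
abbrev matCLM (A : Matrix (Fin nx) (Fin nx) ℝ) : Kin nx →L[ℝ] Kin nx :=
  Matrix.toEuclideanCLM (𝕜 := ℝ) A

lemma inner_eq_dotProduct (x y : Kin nx) : ⟪x, y⟫ = x.ofLp ⬝ᵥ y.ofLp := by
  rw [EuclideanSpace.inner_eq_star_dotProduct, star_trivial, dotProduct_comm]

lemma charFunDual_multivariateGaussian {m : Kin nx} {P : Matrix (Fin nx) (Fin nx) ℝ}
    (hP : P.PosSemidef) (u : Kin nx) :
    charFunDual (multivariateGaussian m P) (innerSL ℝ u) =
      Complex.exp (((u.ofLp ⬝ᵥ m.ofLp : ℝ) : ℂ) * Complex.I -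
        ((u.ofLp ⬝ᵥ P *ᵥ u.ofLp : ℝ) : ℂ) / 2) := by
  have : innerSL ℝ u = InnerProductSpace.toDualMap ℝ (Kin nx) u := by ext; simp
  rw [this, ← charFun_eq_charFunDual_toDualMap, charFun_multivariateGaussian hP,
    inner_eq_dotProduct]

lemma innerSL_comp_matCLM (A : Matrix (Fin nx) (Fin nx) ℝ) (u : Kin nx) :
    (innerSL ℝ u).comp (matCLM A) = innerSL ℝ (matCLM Aᵀ u) := by
  ext x
  simp only [ContinuousLinearMap.comp_apply, innerSL_apply_apply, inner_eq_dotProduct,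
    Matrix.ofLp_toEuclideanCLM]
  rw [Matrix.dotProduct_mulVec, Matrix.mulVec_transpose]

lemma multivariateGaussian_add_eq_map (a m : Kin nx) (P : Matrix (Fin nx) (Fin nx) ℝ) :
    multivariateGaussian (a + m) P = (multivariateGaussian m P).map (fun x => a + x) := by
  rw [multivariateGaussian, multivariateGaussian, Measure.map_map (by fun_prop) (by fun_prop)]
  congr 1
  ext x : 1
  simp [add_assoc]

lemma exists_innerSL_coprod (L : StrongDual ℝ (Kin nx × Kin nx)) :
    ∃ u v : Kin nx, L = (innerSL ℝ u).coprod (innerSL ℝ v) := by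
  refine ⟨(InnerProductSpace.toDual ℝ _).symm (L.comp (.inl ℝ _ _)),
    (InnerProductSpace.toDual ℝ _).symm (L.comp (.inr ℝ _ _)), ?_⟩
  ext p <;> simp

variable {m b m' b' : Kin nx} {P Q F G P' R : Matrix (Fin nx) (Fin nx) ℝ}

lemma charFunDual_map_prod (hP : P.PosSemidef) (hQ : Q.PosSemidef)
    (D : Kin nx × Kin nx →L[ℝ] Kin nx × Kin nx) (L : StrongDual ℝ (Kin nx × Kin nx)) {u v : Kin nx}
    (hL : L.comp D = (innerSL ℝ u).coprod (innerSL ℝ v)) :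
    charFunDual (((multivariateGaussian m P).prod (multivariateGaussian b Q)).map D) L =
      Complex.exp (((u.ofLp ⬝ᵥ m.ofLp + v.ofLp ⬝ᵥ b.ofLp : ℝ) : ℂ) * Complex.I -
        ((u.ofLp ⬝ᵥ P *ᵥ u.ofLp + v.ofLp ⬝ᵥ Q *ᵥ v.ofLp : ℝ) : ℂ) / 2) := by
  have e1 : ((innerSL ℝ u).coprod (innerSL ℝ v)).comp (.inl ℝ (Kin nx) (Kin nx)) = innerSL ℝ u := by
    ext; simp
  have e2 : ((innerSL ℝ u).coprod (innerSL ℝ v)).comp (.inr ℝ (Kin nx) (Kin nx)) = innerSL ℝ v := by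
    ext; simp
  rw [charFunDual_map, hL, charFunDual_prod, e1, e2, charFunDual_multivariateGaussian hP,
    charFunDual_multivariateGaussian hQ, ← Complex.exp_add]
  congr 1
  push_cast
  ring

/-- A linear Gaussian model in forward and in backward form. -/
lemma map_forward_eq_map_backward (hP : P.PosSemidef) (hQ : Q.PosSemidef) (hR : R.PosSemidef)
    (hm' : m' = matCLM F m + b) (hP' : P' = F * P * Fᵀ + Q) (hG : G * P' = P * Fᵀ)
    (hb' : b' = m - matCLM G m') (hRe : R = P - G * P' * Gᵀ) :
    ((multivariateGaussian m P).prod (multivariateGaussian b Q)).map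
        (fun p => (p.1, matCLM F p.1 + p.2)) =
      ((multivariateGaussian m' P').prod (multivariateGaussian b' R)).map
        (fun p => (matCLM G p.1 + p.2, p.1)) := by
  have hPs : P.IsSymm := hP.isSymm
  have hP's : P'.IsSymm := by
    rw [hP', Matrix.IsSymm, Matrix.transpose_add, hQ.isSymm.eq, Matrix.transpose_mul,
      Matrix.transpose_mul, hPs.eq, Matrix.transpose_transpose, Matrix.mul_assoc]
  have hP'p : P'.PosSemidef := by
    rw [hP']
    have := hP.mul_mul_conjTranspose_same F
    rw [Matrix.conjTranspose_eq_transpose_of_trivial] at this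
    exact this.add hQ
  set D₁ : Kin nx × Kin nx →L[ℝ] Kin nx × Kin nx :=
    (ContinuousLinearMap.fst ℝ _ _).prod ((matCLM F).comp (ContinuousLinearMap.fst ℝ _ _) +
      ContinuousLinearMap.snd ℝ _ _) with hD₁
  set D₂ : Kin nx × Kin nx →L[ℝ] Kin nx × Kin nx :=
    ((matCLM G).comp (ContinuousLinearMap.fst ℝ _ _) + ContinuousLinearMap.snd ℝ _ _).prod
      (ContinuousLinearMap.fst ℝ _ _) with hD₂
  change Measure.map D₁ _ = Measure.map D₂ _
  have : IsProbabilityMeasure (Measure.map D₁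
    ((multivariateGaussian m P).prod (multivariateGaussian b Q))) :=
    Measure.isProbabilityMeasure_map (by fun_prop)
  have : IsProbabilityMeasure (Measure.map D₂
    ((multivariateGaussian m' P').prod (multivariateGaussian b' R))) :=
    Measure.isProbabilityMeasure_map (by fun_prop)
  refine Measure.ext_of_charFunDual (funext fun L => ?_)
  obtain ⟨u, v, rfl⟩ := exists_innerSL_coprod L
  have h1 : ((innerSL ℝ u).coprod (innerSL ℝ v)).comp D₁ =
      (innerSL ℝ (u + matCLM Fᵀ v)).coprod (innerSL ℝ v) := by
    rw [map_add, ← innerSL_comp_matCLM]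
    ext p <;> simp [hD₁]
  have h2 : ((innerSL ℝ u).coprod (innerSL ℝ v)).comp D₂ =
      (innerSL ℝ (v + matCLM Gᵀ u)).coprod (innerSL ℝ u) := by
    rw [map_add, ← innerSL_comp_matCLM]
    ext p <;> simp [hD₂, add_comm]
  rw [charFunDual_map_prod hP hQ D₁ _ h1, charFunDual_map_prod hP'p hR D₂ _ h2]
  have tr : ∀ (A : Matrix (Fin nx) (Fin nx) ℝ) (x y : Fin nx → ℝ),
      (Aᵀ *ᵥ x) ⬝ᵥ y = x ⬝ᵥ A *ᵥ y := fun A x y => by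
    rw [Matrix.dotProduct_mulVec, Matrix.mulVec_transpose]
  have tr' : ∀ (A : Matrix (Fin nx) (Fin nx) ℝ), A.IsSymm → ∀ (x y : Fin nx → ℝ),
      y ⬝ᵥ A *ᵥ x = x ⬝ᵥ A *ᵥ y := fun A hA x y => by
    rw [← tr, hA.eq, dotProduct_comm]
  congr 3
  · congr 1
    simp only [WithLp.ofLp_add, WithLp.ofLp_sub, Matrix.ofLp_toEuclideanCLM, add_dotProduct,
      dotProduct_add, dotProduct_sub, tr, hm', hb', Matrix.mulVec_add]
    ring
  · congr 1
    simp only [WithLp.ofLp_add, Matrix.ofLp_toEuclideanCLM, add_dotProduct, dotProduct_add,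
      Matrix.mulVec_add, tr]
    have x1 : v.ofLp ⬝ᵥ F *ᵥ P *ᵥ u.ofLp = u.ofLp ⬝ᵥ P *ᵥ Fᵀ *ᵥ v.ofLp := by
      rw [← tr, tr' P hPs]
    have x2 : v.ofLp ⬝ᵥ P' *ᵥ Gᵀ *ᵥ u.ofLp = u.ofLp ⬝ᵥ G *ᵥ P' *ᵥ v.ofLp := by
      rw [← tr G, tr' P' hP's]
    rw [x1, x2]
    -- The relation GP' = PFᵀ equates the two cross covariances; the choice of R equates the
    -- covariance of the first component.
    simp only [Matrix.mulVec_mulVec, ← Matrix.mul_assoc, hG, hRe, Matrix.sub_mulVec,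
      dotProduct_sub]
    rw [hP', Matrix.add_mulVec, dotProduct_add]
    ring

lemma map_mulVec_add (hP : P.PosSemidef) (hR : R.PosSemidef) :
    ((multivariateGaussian m P).prod (multivariateGaussian b R)).map
        (fun p => matCLM G p.1 + p.2) = multivariateGaussian (matCLM G m + b) (G * P * Gᵀ + R) := by
  have hS : (G * P * Gᵀ + R).PosSemidef := by
    have := hP.mul_mul_conjTranspose_same G
    rw [Matrix.conjTranspose_eq_transpose_of_trivial] at this
    exact this.add hR
  set D : Kin nx × Kin nx →L[ℝ] Kin nx :=
    (matCLM G).comp (ContinuousLinearMap.fst ℝ _ _) + ContinuousLinearMap.snd ℝ _ _ with hD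
  change Measure.map D _ = _
  have : IsProbabilityMeasure (Measure.map D
    ((multivariateGaussian m P).prod (multivariateGaussian b R))) :=
    Measure.isProbabilityMeasure_map (by fun_prop)
  refine Measure.ext_of_charFunDual (funext fun L => ?_)
  obtain ⟨u, rfl⟩ : ∃ u, L = innerSL ℝ u :=
    ⟨(InnerProductSpace.toDual ℝ _).symm L, by ext; simp⟩
  have e1 : ((innerSL ℝ u).comp D).comp (.inl ℝ (Kin nx) (Kin nx)) = innerSL ℝ (matCLM Gᵀ u) := by
    rw [← innerSL_comp_matCLM]; ext; simp [hD]
  have e2 : ((innerSL ℝ u).comp D).comp (.inr ℝ (Kin nx) (Kin nx)) = innerSL ℝ u := by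
    ext; simp [hD]
  rw [charFunDual_map, charFunDual_prod, e1, e2, charFunDual_multivariateGaussian hP,
    charFunDual_multivariateGaussian hR, charFunDual_multivariateGaussian hS, ← Complex.exp_add]
  congr 1
  rw [Matrix.add_mulVec, dotProduct_add, quad_conj]
  have : (matCLM Gᵀ u).ofLp ⬝ᵥ m.ofLp = u.ofLp ⬝ᵥ (matCLM G m).ofLp := by
    rw [Matrix.ofLp_toEuclideanCLM, Matrix.ofLp_toEuclideanCLM, Matrix.dotProduct_mulVec,
      Matrix.mulVec_transpose]
  rw [this, WithLp.ofLp_add, dotProduct_add, Matrix.ofLp_toEuclideanCLM Gᵀ]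
  push_cast
  ring

/-- Both sides have the same characteristic function, by the Fourier transform of a Gaussian. -/
lemma stdGaussian_eq_withDensity : stdGaussian (Kin nx) = volume.withDensity fun x =>
    ENNReal.ofReal (Real.exp (-(1 / 2) * ‖x‖ ^ 2) / √((2 * Real.pi) ^ nx)) := by
  have hI := GaussianFourier.integral_rexp_neg_mul_sq_norm (V := Kin nx) (b := 1 / 2) (by norm_num)
  have hsq : √((2 * Real.pi) ^ nx) = (2 * Real.pi) ^ ((nx : ℝ) / 2) := by
    rw [Real.sqrt_eq_rpow, ← Real.rpow_natCast, ← Real.rpow_mul (by positivity)]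
    congr 1; ring
  have hpos : 0 < √((2 * Real.pi) ^ nx) := by positivity
  have hint : Integrable (fun x : Kin nx => Real.exp (-(1 / 2) * ‖x‖ ^ 2)) := by
    -- A nonintegrable function would have integral zero by convention, but the integral in `hI` is
    -- positive.
    by_contra h
    rw [integral_undef h] at hI
    have : 0 < (Real.pi / (1 / 2)) ^ (Module.finrank ℝ (Kin nx) / 2 : ℝ) := by positivity
    exact this.ne hI
  have hint' : Integrable fun x : Kin nx =>
      Real.exp (-(1 / 2) * ‖x‖ ^ 2) / √((2 * Real.pi) ^ nx) := hint.div_const _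
  have : IsFiniteMeasure ((volume : Measure (Kin nx)).withDensity fun x =>
      ENNReal.ofReal (Real.exp (-(1 / 2) * ‖x‖ ^ 2) / √((2 * Real.pi) ^ nx))) :=
    isFiniteMeasure_withDensity_ofReal hint'.2
  refine Measure.ext_of_charFun (funext fun t => ?_)
  rw [charFun_stdGaussian, charFun_apply, integral_withDensity_eq_integral_toReal_smul
    (by fun_prop) (by simp)]
  have hC := GaussianFourier.integral_cexp_neg_mul_sq_norm_add (V := Kin nx) (b := 1 / 2)
    (by norm_num) Complex.I t
  have : ∀ x : Kin nx, (ENNReal.ofReal (Real.exp (-(1 / 2) * ‖x‖ ^ 2) /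
      √((2 * Real.pi) ^ nx))).toReal • Complex.exp (⟪x, t⟫ * Complex.I) =
      (((√((2 * Real.pi) ^ nx))⁻¹ : ℝ) : ℂ) *
        Complex.exp (-(1 / 2) * ‖x‖ ^ 2 + Complex.I * ⟪t, x⟫) := by
    intro x
    rw [ENNReal.toReal_ofReal (by positivity), Complex.real_smul, Complex.exp_add,
      real_inner_comm, mul_comm Complex.I]
    push_cast
    ring
  simp_rw [this]
  rw [integral_const_mul, hC, hsq]
  have e : (Real.pi / (1 / 2) : ℂ) ^ (Module.finrank ℝ (Kin nx) / 2 : ℂ) =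
      (((2 * Real.pi) ^ ((nx : ℝ) / 2) : ℝ) : ℂ) := by
    rw [Complex.ofReal_cpow (by positivity), finrank_euclideanSpace_fin]
    push_cast
    congr 1
    ring
  rw [e, ← mul_assoc, ← Complex.ofReal_mul, inv_mul_cancel₀ (by positivity), Complex.ofReal_one,
    one_mul]
  congr 1
  rw [Complex.I_sq]
  ring

lemma measurable_gaussianPdf : Measurable (gaussianPdf m P) := by
  have : Measurable fun x : Kin nx => (x - m).ofLp ⬝ᵥ (P⁻¹ *ᵥ (x - m).ofLp) := by
    simp only [dotProduct, Matrix.mulVec]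
    fun_prop
  exact ((this.const_mul _).exp).div_const _

open scoped MatrixOrder in
-- The law is the image of the standard one under x ↦ m + √P x, which for definite P is an affine
-- bijection scaling volume by det √P.
lemma multivariateGaussian_eq_withDensity (hP : P.PosDef) :
    multivariateGaussian m P = volume.withDensity fun x => ENNReal.ofReal (gaussianPdf m P x) := by
  set S : Matrix (Fin nx) (Fin nx) ℝ := CFC.sqrt P with hS
  have hSS : S * S = P := CFC.sqrt_mul_sqrt_self P hP.posSemidef.nonneg
  have hSs : S.IsSymm :=
    (Matrix.nonneg_iff_posSemidef.1 (CFC.sqrt_nonneg P)).isSymm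
  have hSd : S.det ≠ 0 := fun h => hP.det_pos.ne' (by rw [← hSS, Matrix.det_mul, h, zero_mul])
  have hSu : IsUnit S.det := isUnit_iff_ne_zero.2 hSd
  have hdet : LinearMap.det ((matCLM S : Kin nx →L[ℝ] Kin nx) : Kin nx →ₗ[ℝ] Kin nx) = S.det := by
    rw [Matrix.coe_toEuclideanCLM_eq_toEuclideanLin]
    simp [Matrix.toEuclideanLin_eq_toLin_orthonormal]
  have hvol : (volume : Measure (Kin nx)) =
      ENNReal.ofReal |S.det| • volume.map (fun x => m + matCLM S x) := by
    have h1 : (fun x => m + matCLM S x) = (fun x => m + x) ∘ (matCLM S) := rfl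
    have h2 := Measure.map_linearMap_addHaar_eq_smul_addHaar (volume : Measure (Kin nx))
      (f := ((matCLM S : Kin nx →L[ℝ] Kin nx) : Kin nx →ₗ[ℝ] Kin nx)) (by rwa [hdet])
    rw [hdet] at h2
    rw [h1, ← Measure.map_map (by fun_prop) (by fun_prop)]
    change _ = _ • Measure.map _ (Measure.map
      (((matCLM S : Kin nx →L[ℝ] Kin nx) : Kin nx →ₗ[ℝ] Kin nx)) volume)
    rw [h2, Measure.map_smul, (measurePreserving_add_left volume m).map_eq, smul_smul,
      ← ENNReal.ofReal_mul (abs_nonneg _), ← abs_mul, mul_inv_cancel₀ hSd]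
    simp
  have hpdf : ∀ x : Kin nx, gaussianPdf m P (m + matCLM S x) =
      |S.det|⁻¹ * (Real.exp (-(1 / 2) * ‖x‖ ^ 2) / √((2 * Real.pi) ^ nx)) := by
    intro x
    have e1 : (m + matCLM S x - m).ofLp = S *ᵥ x.ofLp := by
      rw [add_sub_cancel_left, Matrix.ofLp_toEuclideanCLM]
    have e2 : (S *ᵥ x.ofLp) ⬝ᵥ P⁻¹ *ᵥ (S *ᵥ x.ofLp) = ‖x‖ ^ 2 := by
      rw [Matrix.mulVec_mulVec, ← hSS, Matrix.mul_inv_rev, Matrix.mul_assoc,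
        Matrix.nonsing_inv_mul _ hSu, mul_one, ← hSs.eq, Matrix.mulVec_transpose,
        ← Matrix.dotProduct_mulVec, hSs.eq, Matrix.mulVec_mulVec, Matrix.mul_nonsing_inv _ hSu,
        Matrix.one_mulVec, ← inner_eq_dotProduct, real_inner_self_eq_norm_sq]
    have e3 : √((2 * Real.pi) ^ nx * P.det) = |S.det| * √((2 * Real.pi) ^ nx) := by
      rw [← hSS, Matrix.det_mul, Real.sqrt_mul (by positivity), Real.sqrt_mul_self_eq_abs, mul_comm]
    rw [gaussianPdf, e1, e2, e3]
    field_simp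
  rw [multivariateGaussian, stdGaussian_eq_withDensity]
  refine Measure.ext fun s hs => ?_
  have hms : MeasurableSet ((fun x => m + matCLM S x) ⁻¹' s) :=
    (show Measurable fun x => m + matCLM S x by fun_prop) hs
  rw [Measure.map_apply (by fun_prop) hs, withDensity_apply _ hs, withDensity_apply _ hms]
  conv_rhs => rw [hvol]
  rw [Measure.restrict_smul, lintegral_smul_measure, Measure.restrict_map (by fun_prop) hs,
    lintegral_map measurable_gaussianPdf.ennreal_ofReal (by fun_prop), smul_eq_mul, ← lintegral_const_mul' _ _
      ENNReal.ofReal_ne_top]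
  refine lintegral_congr fun x => ?_
  rw [hpdf, ← ENNReal.ofReal_mul (abs_nonneg _), ← mul_assoc, mul_inv_cancel₀ (abs_ne_zero.2 hSd),
    one_mul]

lemma gaussianPdf_pos (hP : P.PosDef) (x : Kin nx) : 0 < gaussianPdf m P x := by
  have := hP.det_pos
  rw [gaussianPdf]
  positivity

lemma multivariateGaussian_withDensity_div (hP : P.PosDef) (hQ : Q.PosDef) :
    (multivariateGaussian m P).withDensity (fun x =>
      ENNReal.ofReal (gaussianPdf b Q x / gaussianPdf m P x)) = multivariateGaussian b Q := by
  rw [multivariateGaussian_eq_withDensity hP, multivariateGaussian_eq_withDensity hQ,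
    ← withDensity_mul _ measurable_gaussianPdf.ennreal_ofReal
      (show Measurable fun x => ENNReal.ofReal (gaussianPdf b Q x / gaussianPdf m P x) from
        (measurable_gaussianPdf.div measurable_gaussianPdf).ennreal_ofReal)]
  congr 1
  ext x
  rw [Pi.mul_apply, ← ENNReal.ofReal_mul (gaussianPdf_pos hP x).le,
    mul_div_cancel₀ _ (gaussianPdf_pos hP x).ne']

/-- The Joseph form of the backward covariance. -/
lemma posSemidef_sub_gain (hP : P.PosSemidef) (hQ : Q.PosSemidef) (hP' : P' = F * P * Fᵀ + Q)
    (hG : G * P' = P * Fᵀ) : (P - G * P' * Gᵀ).PosSemidef := by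
  have h1 := hP.mul_mul_conjTranspose_same (1 - G * F)
  have h2 := hQ.mul_mul_conjTranspose_same G
  rw [Matrix.conjTranspose_eq_transpose_of_trivial] at h1 h2
  have e : P - G * P' * Gᵀ = (1 - G * F) * P * (1 - G * F)ᵀ + G * Q * Gᵀ := by
    have hP's : P'.IsSymm := by
      rw [hP', Matrix.IsSymm, Matrix.transpose_add, hQ.isSymm.eq, Matrix.transpose_mul,
        Matrix.transpose_mul, hP.isSymm.eq, Matrix.transpose_transpose, Matrix.mul_assoc]
    have e1 : P * (G * F)ᵀ = G * P' * Gᵀ := by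
      rw [Matrix.transpose_mul, ← Matrix.mul_assoc, hG]
    have e2 : G * F * P = G * P' * Gᵀ := by
      have := congrArg Matrix.transpose e1
      rwa [Matrix.transpose_mul, Matrix.transpose_transpose, hP.isSymm.eq, Matrix.transpose_mul,
        Matrix.transpose_mul, Matrix.transpose_transpose, hP's.eq, ← Matrix.mul_assoc] at this
    have e3 : G * F * P * (G * F)ᵀ + G * Q * Gᵀ = G * P' * Gᵀ := by
      rw [hP', Matrix.transpose_mul]
      noncomm_ring
    calc P - G * P' * Gᵀ = P - G * F * P - P * (G * F)ᵀ +
          (G * F * P * (G * F)ᵀ + G * Q * Gᵀ) := by rw [e3, e1, e2]; abel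
      _ = _ := by rw [Matrix.transpose_sub, Matrix.transpose_one]; noncomm_ring
  rw [e]
  exact h1.add h2

end Gaussian

/-! ### The Rauch–Tung–Striebel smoother. -/

section RTS

variable {nx d : ℕ} {filt pred fin : GIW nx d} {T : Transition nx d}

lemma matCLM_jacobian (m x : Kin nx) : matCLM (T.jacobian m) x = fderiv ℝ T.f m x := by
  ext i
  rw [Matrix.ofLp_toEuclideanCLM]
  have hx : x = ∑ j, x j • EuclideanSpace.single j (1 : ℝ) := by
    ext k
    simp [Finset.sum_apply, Pi.single_apply]
  conv_rhs => rw [hx, map_sum]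
  simp [Matrix.mulVec, dotProduct, Transition.jacobian, mul_comm]

lemma linearizeAt_f (m x : Kin nx) : (T.linearizeAt m).f x =
    matCLM (T.jacobian m) x + (T.f m - matCLM (T.jacobian m) m) := by
  rw [matCLM_jacobian, matCLM_jacobian]
  simp only [Transition.linearizeAt, map_sub]
  abel

lemma gain_mul (hpredP : pred.P.PosDef) :
    gain filt pred T * pred.P = filt.P * (T.jacobian filt.m)ᵀ := by
  rw [gain, Matrix.mul_assoc, Matrix.nonsing_inv_mul _ (isUnit_iff_ne_zero.2 hpredP.det_pos.ne'),
    mul_one]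

/-- Written as the covariance of Gy + e, with y of covariance P_{k+1|K} and e independent, of the
backward error covariance. This form shows semidefiniteness. -/
lemma smoothCov_eq : smoothCov filt pred fin T =
    gain filt pred T * fin.P * (gain filt pred T)ᵀ +
      (filt.P - gain filt pred T * pred.P * (gain filt pred T)ᵀ) := by
  rw [smoothCov]
  noncomm_ring

lemma smoothMean_eq : smoothMean filt pred fin T =
    matCLM (gain filt pred T) fin.m + (filt.m - matCLM (gain filt pred T) pred.m) := by
  have : WithLp.toLp 2 (gain filt pred T *ᵥ (fin.m - pred.m).ofLp) =
      matCLM (gain filt pred T) (fin.m - pred.m) := rfl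
  rw [smoothMean, this, map_sub]
  abel

lemma posSemidef_smoothCov (hfilt : filt.Valid) (hfin : fin.Valid) (hpredP : pred.P.PosDef)
    (hQ : T.Q.PosSemidef)
    (hP : pred.P = T.jacobian filt.m * filt.P * (T.jacobian filt.m)ᵀ + T.Q) :
    (smoothCov filt pred fin T).PosSemidef := by
  have h1 := hfin.1.mul_mul_conjTranspose_same (gain filt pred T)
  rw [Matrix.conjTranspose_eq_transpose_of_trivial] at h1
  rw [smoothCov_eq]
  exact h1.add (posSemidef_sub_gain hfilt.1 hQ hP (gain_mul hpredP))

/-- The kinematic smoothing equation yields the Rauch–Tung–Striebel smoother. -/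
lemma kinSmoothed_eq (hfilt : filt.Valid) (hfin : fin.Valid) (hpredP : pred.P.PosDef)
    (hfinP : fin.P.PosDef) (hQ : T.Q.PosSemidef) (hm : pred.m = T.f filt.m)
    (hP : pred.P = T.jacobian filt.m * filt.P * (T.jacobian filt.m)ᵀ + T.Q) :
    kinSmoothed filt pred fin (T.linearizeAt filt.m) =
      multivariateGaussian (smoothMean filt pred fin T) (smoothCov filt pred fin T) := by
  have hR := posSemidef_sub_gain hfilt.1 hQ hP (gain_mul hpredP)
  set G := gain filt pred T with hG
  set F := T.jacobian filt.m with hF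
  set b := T.f filt.m - matCLM F filt.m with hb
  set b' := filt.m - matCLM G pred.m with hb'
  set R := filt.P - G * pred.P * Gᵀ with hRe
  have hJ := map_forward_eq_map_backward hfilt.1 hQ hR (m := filt.m) (b := b) (m' := pred.m)
    (b' := b') (by rw [hm, hb]; abel) hP (gain_mul hpredP) rfl rfl
  have hφ : Measurable fun y : Kin nx =>
      ENNReal.ofReal (gaussianPdf fin.m fin.P y / gaussianPdf pred.m pred.P y) :=
    (measurable_gaussianPdf.div measurable_gaussianPdf).ennreal_ofReal
  refine Measure.ext fun s hs => ?_
  -- Integrating Φ against the forward joint law gives the smoothed mass of s; against the backward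
  -- one, the weight depends only on the Gaussian starting point y.
  set Φ : Kin nx × Kin nx → ℝ≥0∞ := fun p => s.indicator 1 p.1 *
    ENNReal.ofReal (gaussianPdf fin.m fin.P p.2 / gaussianPdf pred.m pred.P p.2) with hΦ
  have hΦm : Measurable Φ := ((measurable_one.indicator hs).comp measurable_fst).mul
    (hφ.comp measurable_snd)
  have hker : ∀ x, (T.linearizeAt filt.m).kinLaw x =
      (multivariateGaussian b T.Q).map (fun z => matCLM F x + z) := by
    intro x
    rw [← multivariateGaussian_add_eq_map, ← linearizeAt_f]
    rfl
  have hl := congrArg (fun μ => ∫⁻ p, Φ p ∂μ) hJ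
  rw [lintegral_map hΦm (by fun_prop), lintegral_map hΦm (by fun_prop),
    lintegral_prod _ (by fun_prop), lintegral_prod _ (by fun_prop)] at hl
  have hleft : kinSmoothed filt pred fin (T.linearizeAt filt.m) s =
      ∫⁻ x, ∫⁻ z, Φ (x, matCLM F x + z) ∂multivariateGaussian b T.Q
        ∂multivariateGaussian filt.m filt.P := by
    rw [kinSmoothed, withDensity_apply _ hs, ← lintegral_indicator hs]
    refine lintegral_congr fun x => ?_
    have := lintegral_map (μ := multivariateGaussian b T.Q) hφ
      (show Measurable fun z => matCLM F x + z by fun_prop)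
    rw [← hker] at this
    by_cases hx : x ∈ s
    · simp only [Set.indicator_of_mem hx, hΦ, Pi.one_apply, one_mul]
      exact this
    · simp [hΦ, hx]
  rw [hleft, hl]
  have hh : Measurable fun y : Kin nx =>
      ∫⁻ e, s.indicator 1 (matCLM G y + e) ∂multivariateGaussian b' R :=
    Measurable.lintegral_prod_right' (f := fun p : Kin nx × Kin nx =>
      s.indicator (1 : Kin nx → ℝ≥0∞) (matCLM G p.1 + p.2))
      ((measurable_one.indicator hs).comp (by fun_prop))
  calc ∫⁻ y, ∫⁻ e, Φ (matCLM G y + e, y) ∂multivariateGaussian b' R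
        ∂multivariateGaussian pred.m pred.P
      = ∫⁻ y, ∫⁻ e, s.indicator 1 (matCLM G y + e) ∂multivariateGaussian b' R
          ∂multivariateGaussian fin.m fin.P := by
        -- The weight turns the predicted law of y into the smoothed one and leaves the backward
        -- error untouched.
        rw [← multivariateGaussian_withDensity_div hpredP hfinP,
          lintegral_withDensity_eq_lintegral_mul _ hφ hh]
        refine lintegral_congr fun y => ?_
        rw [Pi.mul_apply, ← lintegral_const_mul' _ _ ENNReal.ofReal_ne_top]
        exact lintegral_congr fun e => mul_comm _ _
    _ = ((multivariateGaussian fin.m fin.P).prod (multivariateGaussian b' R)).map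
          (fun p => matCLM G p.1 + p.2) s := by
        rw [← lintegral_indicator_one hs, lintegral_map (measurable_one.indicator hs)
          (by fun_prop), lintegral_prod (fun p : Kin nx × Kin nx =>
            s.indicator (1 : Kin nx → ℝ≥0∞) (matCLM G p.1 + p.2))
            ((measurable_one.indicator hs).comp (by fun_prop)).aemeasurable]
    _ = _ := by rw [map_mulVec_add hfin.1 hR, smoothMean_eq, smoothCov_eq]

end RTS

/-! ### Closest product laws in Kullback–Leibler divergence. -/

section KullbackLeibler

open InformationTheory

variable {α β : Type*} [MeasurableSpace α] [MeasurableSpace β]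

/-- Data processing in both directions, the swap being its own inverse. -/
lemma klDiv_map_swap (s t : Measure (α × β)) [IsFiniteMeasure s] [IsFiniteMeasure t] :
    klDiv (s.map Prod.swap) (t.map Prod.swap) = klDiv s t := by
  refine le_antisymm (klDiv_map_le s t measurable_swap) ?_
  have h := klDiv_map_le (s.map Prod.swap) (t.map Prod.swap) (measurable_swap (α := β) (β := α))
  rwa [Measure.map_map measurable_swap measurable_swap, Measure.map_map measurable_swap
    measurable_swap, Prod.swap_swap_eq, Measure.map_id, Measure.map_id] at h

/-- The chain rule for s, disintegrated over its first marginal, against the constant kernel q₂. -/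
lemma klDiv_prod_eq_add [StandardBorelSpace β] [Nonempty β] (s : Measure (α × β))
    [IsProbabilityMeasure s] (q₁ : Measure α) (q₂ : Measure β) [IsProbabilityMeasure q₁]
    [IsProbabilityMeasure q₂] :
    klDiv s (q₁.prod q₂) = klDiv s.fst q₁ + klDiv s (s.fst.prod q₂) := by
  have h := klDiv_compProd_eq_add (μ := s.fst) (ν := q₁) (κ := s.condKernel)
    (η := Kernel.const α q₂)
  rwa [s.disintegrate, Measure.compProd_const, Measure.compProd_const] at h

/-- The divergence from a product law splits into the divergences of the marginals and the mutual
information. -/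
lemma klDiv_prod_eq [StandardBorelSpace α] [Nonempty α] [StandardBorelSpace β] [Nonempty β]
    (s : Measure (α × β)) [IsProbabilityMeasure s] (q₁ : Measure α) (q₂ : Measure β)
    [IsProbabilityMeasure q₁] [IsProbabilityMeasure q₂] :
    klDiv s (q₁.prod q₂) =
      klDiv s.fst q₁ + (klDiv s.snd q₂ + klDiv s (s.fst.prod s.snd)) := by
  have : IsProbabilityMeasure (s.map Prod.swap) :=
    Measure.isProbabilityMeasure_map measurable_swap.aemeasurable
  have h := klDiv_prod_eq_add (s.map Prod.swap) q₂ s.fst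
  have e : s.snd.prod s.fst = (s.fst.prod s.snd).map Prod.swap := Measure.prod_swap.symm
  rw [← Measure.prod_swap, klDiv_map_swap, Measure.fst_map_swap, e, klDiv_map_swap] at h
  rw [klDiv_prod_eq_add, h]

/-- The integrand t log t + 1 - t is continuous, hence bounded on the compact range of a bounded
density. -/
lemma klDiv_withDensity_ne_top {ν : Measure α} [IsProbabilityMeasure ν] {f : α → ℝ≥0∞}
    (hf : Measurable f) {C : ℝ} (hfC : ∀ᵐ x ∂ν, f x ≤ ENNReal.ofReal C) :
    klDiv (ν.withDensity f) ν ≠ ∞ := by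
  have hfin : IsFiniteMeasure (ν.withDensity f) := by
    refine isFiniteMeasure_withDensity ?_
    refine ((lintegral_mono_ae hfC).trans_lt ?_).ne
    simp
  rw [klDiv_eq_lintegral_klFun_of_ac (withDensity_absolutelyContinuous _ _)]
  obtain ⟨K, hK⟩ := (isCompact_Icc (a := 0) (b := max C 0)).exists_bound_of_continuousOn
    continuous_klFun.continuousOn
  refine ((lintegral_mono_ae (g := fun _ => ENNReal.ofReal K) ?_).trans_lt ?_).ne
  · filter_upwards [hfC, Measure.rnDeriv_withDensity ν hf] with x hx hx'
    rw [hx']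
    refine ENNReal.ofReal_le_ofReal ((le_abs_self _).trans (hK _ ⟨ENNReal.toReal_nonneg, ?_⟩))
    refine (ENNReal.toReal_mono ENNReal.ofReal_ne_top hx).trans ?_
    rw [ENNReal.toReal_ofReal']
  · simp

/-- If the joint law has a bounded density with respect to some product law, the product of its
marginals is the unique closest product law in Kullback–Leibler divergence. -/
lemma klDiv_prod_marginals_lt [StandardBorelSpace α] [Nonempty α] [StandardBorelSpace β]
    [Nonempty β] {s : Measure (α × β)} [IsProbabilityMeasure s] {ν₁ : Measure α} {ν₂ : Measure β}
    [IsProbabilityMeasure ν₁] [IsProbabilityMeasure ν₂] {f : α × β → ℝ≥0∞} (hf : Measurable f)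
    {C : ℝ} (hfC : ∀ᵐ x ∂ν₁.prod ν₂, f x ≤ ENNReal.ofReal C)
    (hs : s = (ν₁.prod ν₂).withDensity f) (q₁ : Measure α) (q₂ : Measure β)
    [IsProbabilityMeasure q₁] [IsProbabilityMeasure q₂] (hq : q₁ ≠ s.fst ∨ q₂ ≠ s.snd) :
    klDiv s (s.fst.prod s.snd) < klDiv s (q₁.prod q₂) := by
  have hfin : klDiv s (s.fst.prod s.snd) ≠ ∞ := by
    -- The mutual information is a summand of the divergence from the reference product. Its
    -- finiteness is what makes the inequality strict.
    have h := klDiv_withDensity_ne_top hf hfC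
    rw [← hs, klDiv_prod_eq] at h
    exact fun h' => h (by simp [h'])
  have hpos : klDiv s.fst q₁ + klDiv s.snd q₂ ≠ 0 := by
    intro h0
    rw [add_eq_zero, klDiv_eq_zero_iff, klDiv_eq_zero_iff] at h0
    rcases hq with h | h
    · exact h h0.1.symm
    · exact h h0.2.symm
  rw [klDiv_prod_eq s q₁ q₂, ← add_assoc, add_comm]
  exact ENNReal.lt_add_right hfin hpos

end KullbackLeibler

/-! ### Marginals and normalization of a density on a product. -/

section NormalizedDensity

open InformationTheory

variable {α β : Type*} [MeasurableSpace α] [MeasurableSpace β]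

lemma withDensity_univ (μ : Measure α) (f : α → ℝ≥0∞) :
    μ.withDensity f Set.univ = ∫⁻ x, f x ∂μ := by
  rw [withDensity_apply _ MeasurableSet.univ, Measure.restrict_univ]

lemma fst_withDensity_prod (κ : Measure α) (ρ : Measure β) [SFinite κ] [SFinite ρ]
    {L : α × β → ℝ≥0∞} (hL : Measurable L) :
    ((κ.prod ρ).withDensity L).fst = κ.withDensity fun x => ∫⁻ y, L (x, y) ∂ρ := by
  refine Measure.ext fun s hs => ?_
  rw [Measure.fst_apply hs, withDensity_apply _ (measurable_fst hs), withDensity_apply _ hs,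
    ← lintegral_indicator (measurable_fst hs), ← lintegral_indicator hs,
    lintegral_prod _ (hL.indicator (measurable_fst hs)).aemeasurable]
  refine lintegral_congr fun x => ?_
  by_cases hx : x ∈ s
  · rw [Set.indicator_of_mem hx]
    exact lintegral_congr fun y => Set.indicator_of_mem (show (x, y) ∈ Prod.fst ⁻¹' s from hx) _
  · rw [Set.indicator_of_notMem hx]
    refine lintegral_eq_zero_of_ae_eq_zero (ae_of_all _ fun y => ?_)
    exact Set.indicator_of_notMem (show (x, y) ∉ Prod.fst ⁻¹' s from hx) _

lemma snd_withDensity_prod (κ : Measure α) (ρ : Measure β) [SFinite κ] [SFinite ρ]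
    {L : α × β → ℝ≥0∞} (hL : Measurable L) :
    ((κ.prod ρ).withDensity L).snd = ρ.withDensity fun y => ∫⁻ x, L (x, y) ∂κ := by
  refine Measure.ext fun s hs => ?_
  rw [Measure.snd_apply hs, withDensity_apply _ (measurable_snd hs), withDensity_apply _ hs,
    ← lintegral_indicator (measurable_snd hs), ← lintegral_indicator hs,
    lintegral_prod_symm' _ (hL.indicator (measurable_snd hs))]
  refine lintegral_congr fun y => ?_
  by_cases hy : y ∈ s
  · rw [Set.indicator_of_mem hy]
    exact lintegral_congr fun x => Set.indicator_of_mem (show (x, y) ∈ Prod.snd ⁻¹' s from hy) _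
  · rw [Set.indicator_of_notMem hy]
    refine lintegral_eq_zero_of_ae_eq_zero (ae_of_all _ fun x => ?_)
    exact Set.indicator_of_notMem (show (x, y) ∉ Prod.snd ⁻¹' s from hy) _

lemma fst_normalize (μ : Measure (α × β)) : (normalize μ).fst = normalize μ.fst := by
  rw [normalize, normalize, Measure.fst_univ, Measure.fst, Measure.fst, Measure.map_smul]

lemma snd_normalize (μ : Measure (α × β)) : (normalize μ).snd = normalize μ.snd := by
  rw [normalize, normalize, Measure.snd_univ, Measure.snd, Measure.snd, Measure.map_smul]

variable {κ : Measure α} {ρ : Measure β} [IsProbabilityMeasure κ] [IsProbabilityMeasure ρ]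
  {L : α × β → ℝ≥0∞}

lemma isProbabilityMeasure_normalize {μ : Measure α} (h0 : μ Set.univ ≠ 0)
    (h1 : μ Set.univ ≠ ∞) : IsProbabilityMeasure (normalize μ) :=
  ⟨by rw [normalize, Measure.smul_apply, smul_eq_mul, ENNReal.inv_mul_cancel h0 h1]⟩

lemma normalize_withDensity_of_ae_const {f : α → ℝ≥0∞} {c : ℝ≥0∞} (hf : ∀ᵐ x ∂κ, f x = c)
    (h0 : ∫⁻ x, f x ∂κ ≠ 0) (h1 : ∫⁻ x, f x ∂κ ≠ ∞) : normalize (κ.withDensity f) = κ := by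
  have hc : ∫⁻ x, f x ∂κ = c := by
    rw [lintegral_congr_ae hf, lintegral_const, measure_univ, mul_one]
  rw [hc] at h0 h1
  rw [normalize, withDensity_univ, hc, withDensity_congr_ae hf, withDensity_const, smul_smul,
    ENNReal.inv_mul_cancel h0 h1, one_smul]

lemma normalize_prod_withDensity_snd {g : β → ℝ≥0∞} (hg : Measurable g) :
    normalize ((κ.prod ρ).withDensity fun p => g p.2) =
      κ.prod (normalize (ρ.withDensity g)) := by
  have h : (κ.prod ρ).withDensity (fun p => g p.2) = κ.prod (ρ.withDensity g) :=
    (prod_withDensity_right hg).symm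
  rw [normalize, normalize, h, Measure.prod_smul_right]
  congr 2
  rw [← Set.univ_prod_univ, Measure.prod_prod, measure_univ, one_mul]

lemma klDiv_normalize_marginals_lt [StandardBorelSpace α] [Nonempty α] [StandardBorelSpace β]
    [Nonempty β] (hL : Measurable L) {C : ℝ} (hC : ∀ᵐ p ∂κ.prod ρ, L p ≤ ENNReal.ofReal C)
    (h0 : ∫⁻ p, L p ∂κ.prod ρ ≠ 0) {s : Measure (α × β)}
    (hs : s = normalize ((κ.prod ρ).withDensity L)) [IsProbabilityMeasure s] (q₁ : Measure α)
    (q₂ : Measure β) [IsProbabilityMeasure q₁] [IsProbabilityMeasure q₂]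
    (hq : q₁ ≠ s.fst ∨ q₂ ≠ s.snd) :
    klDiv s (s.fst.prod s.snd) < klDiv s (q₁.prod q₂) := by
  set Z := ∫⁻ p, L p ∂κ.prod ρ
  have hZ : Z⁻¹ ≠ ∞ := ENNReal.inv_ne_top.2 h0
  refine klDiv_prod_marginals_lt (ν₁ := κ) (ν₂ := ρ) (f := fun p => Z⁻¹ * L p)
    (C := (Z⁻¹ * ENNReal.ofReal C).toReal) (hL.const_mul _) ?_ ?_ q₁ q₂ hq
  · filter_upwards [hC] with p hp
    rw [ENNReal.ofReal_toReal (ENNReal.mul_ne_top hZ ENNReal.ofReal_ne_top)]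
    gcongr
  · rw [hs, normalize, withDensity_univ, ← withDensity_smul _ hL]
    rfl

end NormalizedDensity

/-! ### Boundedness of inverse Wishart densities. -/

section Bound

variable {d : ℕ}

lemma det_le_trace_pow {A : Ext d} (hA : A.PosSemidef) : A.det ≤ A.trace ^ d := by
  rw [hA.isHermitian.det_eq_prod_eigenvalues, hA.isHermitian.trace_eq_sum_eigenvalues]
  simp only [RCLike.ofReal_real_eq_id, id]
  calc ∏ i, hA.isHermitian.eigenvalues i
      ≤ ∏ _i : Fin d, ∑ j, hA.isHermitian.eigenvalues j :=
        Finset.prod_le_prod (fun i _ => hA.eigenvalues_nonneg i) fun i _ =>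
          Finset.single_le_sum (fun j _ => hA.eigenvalues_nonneg j) (Finset.mem_univ i)
    _ = _ := by simp

lemma rpow_mul_exp_le {a t : ℝ} (ha : 0 < a) (ht : 0 ≤ t) :
    t ^ a * Real.exp (-(1 / 2) * t) ≤ (2 * a) ^ a := by
  have h1 : t / (2 * a) ≤ Real.exp (t / (2 * a)) :=
    (le_add_of_nonneg_right zero_le_one).trans (Real.add_one_le_exp _)
  have h2 : (t / (2 * a)) ^ a ≤ Real.exp (t / 2) := by
    refine (Real.rpow_le_rpow (by positivity) h1 ha.le).trans_eq ?_
    rw [← Real.exp_mul]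
    congr 1; field_simp
  rw [Real.div_rpow ht (by positivity), div_le_iff₀ (by positivity)] at h2
  calc t ^ a * Real.exp (-(1 / 2) * t)
      ≤ Real.exp (t / 2) * (2 * a) ^ a * Real.exp (-(1 / 2) * t) := by gcongr
    _ = (2 * a) ^ a * Real.exp (t / 2 + -(1 / 2) * t) := by rw [Real.exp_add]; ring
    _ = (2 * a) ^ a := by rw [show t / 2 + -(1 / 2) * t = 0 by ring, Real.exp_zero, mul_one]

/-- With W = BBᵀ and A = BᵀY⁻¹B, the kernel is a constant times det(A)^(w/2) exp(-tr(A)/2). Since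
det A ≤ (tr A)^d, it is dominated by a bounded function of tr A. -/
lemma exists_iwPdf_le (hd : 0 < d) {w : ℝ} (hw : 2 * (d : ℝ) < w) {W : Ext d} (hW : W.PosDef) :
    ∃ C : ℝ, ∀ Y : Ext d, Y.PosDef → iwPdf w W Y ≤ C := by
  have hd0 : (0 : ℝ) < d := by exact_mod_cast hd
  obtain ⟨B, hB, rfl⟩ := hW.exists_eq_mul_transpose
  have hZ := iw_const_pos hw hW
  set z := (B * Bᵀ)⁻¹.det ^ ((w - d - 1) / 2) * wishartZ d (w - d - 1)
  have hw0 : 0 < w := by linarith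
  have hBB : 0 < B.det * B.det := mul_self_pos.2 hB
  refine ⟨(2 * (d * (w / 2))) ^ (d * (w / 2)) * ((B.det * B.det) ^ (w / 2))⁻¹ / z, fun Y hY => ?_⟩
  rw [iwPdf_eq hw hW]
  refine div_le_div_of_nonneg_right ?_ hZ.le
  have hY0 := hY.det_pos
  have hA : (Bᵀ * Y⁻¹ * Bᵀᵀ).PosDef := (posDef_conj_iff (by rwa [Matrix.det_transpose])).2 hY.inv
  have htr : (Y⁻¹ * (B * Bᵀ)).trace = (Bᵀ * Y⁻¹ * Bᵀᵀ).trace := by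
    rw [Matrix.transpose_transpose, Matrix.mul_assoc Bᵀ, Matrix.trace_mul_comm Bᵀ,
      Matrix.mul_assoc]
  have hdet : (Bᵀ * Y⁻¹ * Bᵀᵀ).det = (B.det * B.det) * Y.det⁻¹ := by
    rw [det_conj, Matrix.det_transpose, Matrix.det_nonsing_inv, Ring.inverse_eq_inv']
  have hle := det_le_trace_pow hA.posSemidef
  have ht0 := hA.posSemidef.trace_nonneg
  rw [iwKernel, htr]
  set t := (Bᵀ * Y⁻¹ * Bᵀᵀ).trace
  rw [hdet] at hle
  have h1 : (B.det * B.det) ^ (w / 2) * Y.det ^ (-w / 2) ≤ t ^ (d * (w / 2)) := by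
    rw [neg_div, Real.rpow_neg hY0.le, ← Real.inv_rpow hY0.le, ← Real.mul_rpow hBB.le
      (inv_nonneg.2 hY0.le), Real.rpow_mul ht0, Real.rpow_natCast]
    exact Real.rpow_le_rpow (by positivity) hle (by positivity)
  have h2 : Y.det ^ (-w / 2) ≤ t ^ (d * (w / 2)) * ((B.det * B.det) ^ (w / 2))⁻¹ := by
    rw [le_mul_inv_iff₀ (by positivity), mul_comm]
    exact h1
  calc Y.det ^ (-w / 2) * Real.exp (-(1 / 2) * t)
      ≤ t ^ (d * (w / 2)) * ((B.det * B.det) ^ (w / 2))⁻¹ * Real.exp (-(1 / 2) * t) := by gcongr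
    _ = (t ^ (d * (w / 2)) * Real.exp (-(1 / 2) * t)) * ((B.det * B.det) ^ (w / 2))⁻¹ := by ring
    _ ≤ _ := by
      gcongr
      exact rpow_mul_exp_le (by positivity) ht0

end Bound

/-! ### The exact smoothed law and its extent message. -/

section ExactSmoothing

variable {nx d : ℕ} {filt pred fin : GIW nx d} {T : Transition nx d}

lemma sFinite_lawOf (p : Ext d → ℝ) : SFinite (lawOf p) := by
  unfold lawOf
  infer_instance

lemma measurable_iwPdf_div (v₁ v₂ : ℝ) (V₁ V₂ : Ext d) :
    Measurable fun Y => ENNReal.ofReal (iwPdf v₁ V₁ Y / iwPdf v₂ V₂ Y) :=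
  ((measurable_iwPdf _ _).div (measurable_iwPdf _ _)).ennreal_ofReal

/-- The extent message up to a constant, in closed form. -/
def extMessageKernel (pred fin : GIW nx d) (T : Transition nx d) (p : Kin nx × Ext d) : ℝ≥0∞ :=
  ENNReal.ofReal ((|(T.M p.1).det| ^ (d + 1))⁻¹) *
    ∫⁻ Y, ENNReal.ofReal (iwPdf T.n (T.n • ((T.M p.1)⁻¹ * Y * ((T.M p.1)⁻¹)ᵀ)) p.2)
      ∂iwLaw (dofDiff pred fin) (scaleDiff pred fin)

lemma measurable_extMessageKernel (hM : Measurable T.M) :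
    Measurable (extMessageKernel pred fin T) := by
  have : SFinite (iwLaw (dofDiff pred fin) (scaleDiff pred fin)) := sFinite_lawOf _
  refine Measurable.mul ?_ ?_
  · have : Measurable fun p : Kin nx × Ext d => |(T.M p.1).det| :=
      (measurable_det.comp (hM.comp measurable_fst)).norm
    exact ((this.pow_const _).inv).ennreal_ofReal
  · have hS : Measurable fun q : (Kin nx × Ext d) × Ext d =>
        T.n • ((T.M q.1.1)⁻¹ * q.2 * ((T.M q.1.1)⁻¹)ᵀ) := by
      have h : ∀ i j, Measurable fun q : (Kin nx × Ext d) × Ext d => (T.M q.1.1)⁻¹ i j :=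
        fun i j => (measurable_entry_inv i j).comp (hM.comp (measurable_fst.comp measurable_fst))
      have h2 : ∀ i j, Measurable fun q : (Kin nx × Ext d) × Ext d => q.2 i j :=
        fun i j => (measurable_entry i j).comp measurable_snd
      refine measurable_ext_iff.2 fun i j => ?_
      simp only [Matrix.smul_apply, smul_eq_mul, Matrix.mul_apply, Matrix.transpose_apply,
        Finset.sum_mul]
      exact (Finset.measurable_fun_sum _ fun k _ => Finset.measurable_fun_sum _ fun l _ =>
        ((h i l).mul (h2 l k)).mul (h j k)).const_mul _
    have hF : Measurable fun q : (Kin nx × Ext d) × Ext d =>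
        ENNReal.ofReal (iwPdf T.n (T.n • ((T.M q.1.1)⁻¹ * q.2 * ((T.M q.1.1)⁻¹)ᵀ)) q.1.2) :=
      ((measurable_iwPdf_uncurry T.n).comp
        (hS.prodMk (measurable_snd.comp measurable_fst))).ennreal_ofReal
    exact hF.lintegral_prod_right' (ν := iwLaw (dofDiff pred fin) (scaleDiff pred fin))

/-- Two exchanges up to constants free of x and X: the density ratio becomes IW(w, W), and the
Wishart density in Y becomes an inverse Wishart density in X. The result is also jointly measurable
in (x, X). -/
lemma extMessage_eq (hd : 0 < d) (hpred : pred.Valid) (hfin : fin.Valid)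
    (hMdet : ∀ x, IsUnit (T.M x).det) (hn : 2 * (d : ℝ) < T.n) (hw : 2 * (d : ℝ) < dofDiff pred fin)
    (hW : (scaleDiff pred fin).PosDef) :
    ∃ c : ℝ≥0∞, c ≠ 0 ∧ c ≠ ∞ ∧ ∀ (x : Kin nx) (X : Ext d), X.PosDef →
      extMessage pred fin T x X = c * extMessageKernel pred fin T (x, X) := by
  obtain ⟨c₁, hc₁, h₁⟩ := iwPdf_div_iwPdf hfin.2.1 hpred.2.1 hw hfin.2.2 hpred.2.2 hW
  obtain ⟨c₂, hc₂, h₂⟩ := wishartPdf_eq_iwPdf hd hn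
  refine ⟨ENNReal.ofReal (c₁ * c₂), by simpa using mul_pos hc₁ hc₂, ENNReal.ofReal_ne_top,
    fun x X hX => ?_⟩
  have hB : (T.M x).det ≠ 0 := (hMdet x).ne_zero
  have hK : Measurable fun Y : Ext d =>
      ENNReal.ofReal (iwPdf T.n (T.n • ((T.M x)⁻¹ * Y * ((T.M x)⁻¹)ᵀ)) X) := by
    have := measurable_conj ((T.M x)⁻¹)
    exact ((measurable_iwPdf_uncurry T.n).comp ((measurable_ext_iff.2 fun i j =>
      (measurable_ext_iff.1 this i j).const_mul T.n).prodMk measurable_const)).ennreal_ofReal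
  rw [extMessage, extMessageKernel, Transition.extLaw, wishartLaw,
    lintegral_lawOf (measurable_wishartPdf _ _) (measurable_iwPdf_div _ _ _ _), iwLaw,
    lintegral_lawOf (measurable_iwPdf _ _) hK, ← mul_assoc, ← ENNReal.ofReal_mul (by positivity),
    ← lintegral_const_mul' _ _ ENNReal.ofReal_ne_top]
  refine lintegral_congr_ae ?_
  filter_upwards [ae_extVolume_posDef] with Y hY
  have p₁ := iwPdf_pos hw hW hY
  have p₂ := iwPdf_pos hn ((posDef_inv_conj hB hY).smul (show 0 < T.n by
    have : (0 : ℝ) ≤ d := d.cast_nonneg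
    linarith)) hX
  rw [h₁ Y hY, h₂ _ X Y hB hX hY, ← ENNReal.ofReal_mul (by positivity),
    ← ENNReal.ofReal_mul (by positivity), ← ENNReal.ofReal_mul (by positivity)]
  congr 1
  simp only [dofDiff, scaleDiff]
  ring

lemma extMessage_pos (hpred : pred.Valid) (hfin : fin.Valid) (hMdet : ∀ x, IsUnit (T.M x).det)
    (hn : 2 * (d : ℝ) < T.n) {x : Kin nx} {X : Ext d} (hX : X.PosDef) :
    IsProbabilityMeasure (T.extLaw x X) ∧ extMessage pred fin T x X ≠ 0 := by
  have hd0 : (0 : ℝ) ≤ d := d.cast_nonneg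
  have hS : (T.n⁻¹ • (T.M x * X * (T.M x)ᵀ)).PosDef :=
    ((posDef_conj_iff (hMdet x).ne_zero).2 hX).smul (inv_pos.2 (by linarith))
  have hp : IsProbabilityMeasure (T.extLaw x X) :=
    isProbabilityMeasure_wishartLaw (by linarith) hS
  refine ⟨hp, fun h0 => ?_⟩
  rw [extMessage, lintegral_eq_zero_iff (measurable_iwPdf_div _ _ _ _)] at h0
  have hpd : ∀ᵐ Y ∂T.extLaw x X, Y.PosDef := ae_lawOf_posDef _
  obtain ⟨Y, hY, hY'⟩ := (h0.and hpd).exists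
  have := div_pos (iwPdf_pos hfin.2.1 hfin.2.2 hY') (iwPdf_pos hpred.2.1 hpred.2.2 hY')
  rw [Pi.zero_apply, ENNReal.ofReal_eq_zero] at hY
  linarith

lemma extMessage_le (hd : 0 < d) (hpred : pred.Valid) (hfin : fin.Valid)
    (hMdet : ∀ x, IsUnit (T.M x).det) (hn : 2 * (d : ℝ) < T.n)
    (hw : 2 * (d : ℝ) < dofDiff pred fin) (hW : (scaleDiff pred fin).PosDef) :
    ∃ C : ℝ, ∀ (x : Kin nx) (X : Ext d), X.PosDef →
      extMessage pred fin T x X ≤ ENNReal.ofReal C := by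
  obtain ⟨c, hc, h⟩ := iwPdf_div_iwPdf hfin.2.1 hpred.2.1 hw hfin.2.2 hpred.2.2 hW
  obtain ⟨C, hC⟩ := exists_iwPdf_le hd hw hW
  refine ⟨c * C, fun x X hX => ?_⟩
  have := (extMessage_pos hpred hfin hMdet hn (x := x) hX).1
  have hpd : ∀ᵐ Y ∂T.extLaw x X, Y.PosDef := ae_lawOf_posDef _
  refine (lintegral_mono_ae (g := fun _ => ENNReal.ofReal (c * C)) ?_).trans_eq (by simp)
  filter_upwards [hpd] with Y hY
  rw [h Y hY]
  exact ENNReal.ofReal_le_ofReal (mul_le_mul_of_nonneg_left (hC Y hY) hc.le)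

lemma kinLaw_linearizeAt (m x : Kin nx) : (T.linearizeAt m).kinLaw x =
    (multivariateGaussian (T.f m - matCLM (T.jacobian m) m) T.Q).map
      (fun z => matCLM (T.jacobian m) x + z) := by
  rw [← multivariateGaussian_add_eq_map, ← linearizeAt_f]
  rfl

/-- The joint smoothed law has the extent message as density with respect to the product of the
kinematic smoothed law and the filtered extent law. -/
lemma smoothedUnnorm_eq (hfilt : filt.Valid)
    (hpredP : pred.P.PosDef) (hfinP : fin.P.PosDef) {m : Kin nx} {L : Kin nx × Ext d → ℝ≥0∞}
    (hL : Measurable L)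
    (hLe : ∀ (x : Kin nx) (X : Ext d), X.PosDef →
      extMessage pred fin (T.linearizeAt m) x X = L (x, X)) :
    smoothedUnnorm filt pred fin (T.linearizeAt m) =
      ((kinSmoothed filt pred fin (T.linearizeAt m)).prod filt.extLaw).withDensity L := by
  have : IsProbabilityMeasure filt.extLaw := isProbabilityMeasure_iwLaw hfilt.2.1 hfilt.2.2
  have : IsProbabilityMeasure filt.kinLaw := by unfold GIW.kinLaw; infer_instance
  have hφ : Measurable fun y : Kin nx =>
      ENNReal.ofReal (gaussianPdf fin.m fin.P y / gaussianPdf pred.m pred.P y) :=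
    (measurable_gaussianPdf.div measurable_gaussianPdf).ennreal_ofReal
  set κφ : Kin nx → ℝ≥0∞ := fun x => ∫⁻ x', ENNReal.ofReal
    (gaussianPdf fin.m fin.P x' / gaussianPdf pred.m pred.P x') ∂(T.linearizeAt m).kinLaw x with hκφ
  have hκm : Measurable κφ := by
    -- The transition law is a translate of one fixed Gaussian, which gives measurability in x by
    -- Tonelli.
    have e : κφ = fun x => ∫⁻ z, ENNReal.ofReal
        (gaussianPdf fin.m fin.P (matCLM (T.jacobian m) x + z) /
          gaussianPdf pred.m pred.P (matCLM (T.jacobian m) x + z))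
        ∂multivariateGaussian (T.f m - matCLM (T.jacobian m) m) T.Q := by
      ext x
      rw [hκφ]
      simp only [kinLaw_linearizeAt]
      exact lintegral_map hφ (by fun_prop)
    rw [e]
    exact Measurable.lintegral_prod_right' (f := fun p : Kin nx × Kin nx => ENNReal.ofReal
        (gaussianPdf fin.m fin.P (matCLM (T.jacobian m) p.1 + p.2) /
          gaussianPdf pred.m pred.P (matCLM (T.jacobian m) p.1 + p.2)))
      (hφ.comp (by fun_prop))
  have hprod : (kinSmoothed filt pred fin (T.linearizeAt m)).prod filt.extLaw =
      filt.law.withDensity fun ξ => κφ ξ.1 :=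
    prod_withDensity_left hκm
  rw [hprod, ← withDensity_mul _ (show Measurable fun ξ : Kin nx × Ext d => κφ ξ.1 from
    hκm.comp measurable_fst) hL, smoothedUnnorm]
  refine withDensity_congr_ae ?_
  have hpd : ∀ᵐ ξ ∂filt.law, ξ.2.PosDef :=
    Measure.quasiMeasurePreserving_snd.ae (ae_lawOf_posDef _)
  filter_upwards [hpd] with ξ hξ
  rw [Pi.mul_apply, ← hLe ξ.1 ξ.2 hξ, hκφ, extMessage]
  have : SFinite ((T.linearizeAt m).extLaw ξ.1 ξ.2) := sFinite_lawOf _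
  -- Given ξ, the next kinematic and extent states are independent and the density ratio is a
  -- product, so the integral splits.
  rw [← lintegral_prod_mul hφ.aemeasurable (measurable_iwPdf_div _ _ _ _).aemeasurable]
  refine lintegral_congr fun ξ' => ?_
  rw [← ENNReal.ofReal_mul (div_pos (gaussianPdf_pos hfinP _) (gaussianPdf_pos hpredP _)).le,
    div_mul_div_comm]
  rfl

end ExactSmoothing

/-! ### Uniqueness and closed form of the factorized smoothed law. -/

section Factorized

variable {nx d : ℕ} {filt pred fin : GIW nx d} {T : Transition nx d}

lemma isFactorizedSmoothingConst_iff (hd : 0 < d) (hfilt : filt.Valid) (hpred : pred.Valid)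
    (hfin : fin.Valid) (hn : 2 * (d : ℝ) + 2 < T.n) (hw : 2 * (d : ℝ) + 2 < dofDiff pred fin)
    (hW : (scaleDiff pred fin).PosDef) (hcov : (smoothCov filt pred fin T).PosSemidef)
    (hkin : kinSmoothed filt pred fin (T.linearizeAt filt.m) =
      multivariateGaussian (smoothMean filt pred fin T) (smoothCov filt pred fin T))
    {A : Ext d} (hA : A.det ≠ 0) :
    (tableConst filt pred fin T A).Valid ∧ ∀ ν : Measure (Kin nx × Ext d),
      IsFactorizedSmoothingConst filt pred fin (T.linearizeAt filt.m) A ν ↔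
        ν = (tableConst filt pred fin T A).law := by
  have hd0 : (0 : ℝ) ≤ d := d.cast_nonneg
  obtain ⟨s0, e, hg⟩ := isMessageApprox_scalars hn hw
  have hG : ((1 + (dofDiff pred fin - 3 * (d + 1)) / T.n)⁻¹ •
      (A⁻¹ * scaleDiff pred fin * A⁻¹ᵀ)).PosDef :=
    (posDef_inv_conj hA hW).smul (by rw [e]; exact div_pos (by linarith) s0)
  refine ⟨⟨hcov, ?_, hfilt.2.2.add hG⟩, fun ν => ?_⟩
  · have := hfilt.2.1
    simp only [tableConst, eta1]
    linarith
  · have hlaw : (tableConst filt pred fin T A).law =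
        (kinSmoothed filt pred fin (T.linearizeAt filt.m)).prod (extPosterior filt
          ((1 + (dofDiff pred fin - 3 * (d + 1)) / T.n)⁻¹ *
            (dofDiff pred fin - 2 * (d + 1) ^ 2 / T.n))
          ((1 + (dofDiff pred fin - 3 * (d + 1)) / T.n)⁻¹ •
            (A⁻¹ * scaleDiff pred fin * A⁻¹ᵀ))) := by
      rw [extPosterior_eq hfilt (by linarith) hG, hkin]
      rfl
    rw [hlaw, IsFactorizedSmoothingConst, ratioLaw_eq hpred hfin (by linarith) hW]
    constructor
    · rintro ⟨g, G, h, rfl⟩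
      obtain ⟨rfl, rfl⟩ := (isMessageApprox_iff hd hn hw hW hA).1 h
      rfl
    · rintro rfl
      exact ⟨_, _, (isMessageApprox_iff hd hn hw hW hA).2 ⟨rfl, rfl⟩, rfl⟩

lemma isFactorizedSmoothing_iff (hd : 0 < d) (hfilt : filt.Valid) (hpred : pred.Valid)
    (hfin : fin.Valid) (hn : 2 * (d : ℝ) + 2 < T.n) (hw : 2 * (d : ℝ) + 2 < dofDiff pred fin)
    (hW : (scaleDiff pred fin).PosDef) (hM : Measurable T.M) (hMdet : ∀ x, IsUnit (T.M x).det)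
    (hcov : (smoothCov filt pred fin T).PosSemidef)
    (hkin : kinSmoothed filt pred fin (T.linearizeAt filt.m) =
      multivariateGaussian (smoothMean filt pred fin T) (smoothCov filt pred fin T))
    (h3 : ∀ i j, Integrable (fun x => c3Fun pred fin T x i j) (smoothKin filt pred fin T))
    (h4 : ∀ i j, Integrable (fun x => c4Fun pred fin T x i j) (smoothKin filt pred fin T))
    (hu : IsUnit (C3 filt pred fin T * C4 filt pred fin T - 1).det) :
    (tableGeneral filt pred fin T).Valid ∧ ∀ ν : Measure (Kin nx × Ext d),
      IsFactorizedSmoothing filt pred fin (T.linearizeAt filt.m) ν ↔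
        ν = (tableGeneral filt pred fin T).law := by
  have hd0 : (0 : ℝ) ≤ d := d.cast_nonneg
  have : IsProbabilityMeasure (smoothKin filt pred fin T) := by unfold smoothKin; infer_instance
  have hiff := fun g₂ V₂ => (isAveragedMessageApprox_iff hd hn hw hW hM
    (fun x => (hMdet x).ne_zero) h3 h4 (C₃ := C3 filt pred fin T) (C₄ := C4 filt pred fin T) rfl rfl
    hu (η := eta1 pred fin T) (g := gPar pred fin T) (h := hPar filt pred fin T) rfl rfl rfl
    (g₂ := g₂) (V₂ := V₂)).2
  set g₂ := (1 + (gPar pred fin T - 3 * d - 3) / (hPar filt pred fin T + d + 1))⁻¹ *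
    (gPar pred fin T - 2 * (d + 1) ^ 2 / (hPar filt pred fin T + d + 1)) with hg₂
  set V₂ := ((eta1 pred fin T)⁻¹ *
    (1 + (gPar pred fin T - d - 1) / (hPar filt pred fin T - d - 1))⁻¹) • C4 filt pred fin T with hV₂
  -- Admissibility of the closed form parameters is read off from the match they realize, so their
  -- bounds need no separate computation.
  obtain ⟨_, _, _, _, _, _, _, _, _, _, _, _, _, hmatch⟩ := (hiff g₂ V₂).2 ⟨rfl, rfl⟩
  have hg := hmatch.1
  have hV := hmatch.2.1
  refine ⟨⟨hcov, ?_, hfilt.2.2.add hV⟩, fun ν => ?_⟩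
  · have := hfilt.2.1
    change 2 * (d : ℝ) < filt.v + g₂
    linarith
  · have hlaw : (tableGeneral filt pred fin T).law =
        (kinSmoothed filt pred fin (T.linearizeAt filt.m)).prod (extPosterior filt g₂ V₂) := by
      rw [extPosterior_eq hfilt (by linarith) hV, hkin]
      rfl
    rw [hlaw, IsFactorizedSmoothing, ratioLaw_eq hpred hfin (by linarith) hW]
    have hsk : kinSmoothed filt pred fin (T.linearizeAt filt.m) = smoothKin filt pred fin T := hkin
    rw [hsk]
    constructor
    · rintro ⟨g, G, h, rfl⟩
      obtain ⟨rfl, rfl⟩ := (hiff g G).1 h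
      rfl
    · rintro rfl
      exact ⟨_, _, (hiff _ _).2 ⟨rfl, rfl⟩, rfl⟩

end Factorized

end GIWSmoothing

end

/-! ### Assembly of the theorem. -/

open GIWSmoothing in
theorem theorem2 {nx d : ℕ} (hd : 0 < d)
    (filt pred fin : GIW nx d) (T : Transition nx d)
    -- the three given densities are factorised Gaussian inverse Wishart
    (hfilt : filt.Valid) (hpred : pred.Valid) (hfin : fin.Valid)
    (hpredP : pred.P.PosDef) (hfinP : fin.P.PosDef)
    -- the transition is Gaussian Wishart
    (hQ : T.Q.PosSemidef) (hM : Measurable T.M) (hMdet : ∀ x, IsUnit (T.M x).det)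
    -- the predicted kinematic density is the (extended) Kalman prediction
    (hf : DifferentiableAt ℝ T.f filt.m)
    (hm : pred.m = T.f filt.m)
    (hP : pred.P = T.jacobian filt.m * filt.P * (T.jacobian filt.m)ᵀ + T.Q)
    -- the expected values that are matched exist
    (hn : 2 * (d : ℝ) + 2 < T.n)
    (hw : 2 * (d : ℝ) + 2 < dofDiff pred fin) (hW : (scaleDiff pred fin).PosDef) :
    let T' := T.linearizeAt filt.m
    let s := smoothed filt pred fin T'
    -- the smoothed law is a probability measure
    IsProbabilityMeasure s ∧
    -- the product of its marginals is the unique factorized law that minimizes the KL divergence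
    (∀ (q₁ : Measure (Kin nx)) (q₂ : Measure (Ext d)),
      IsProbabilityMeasure q₁ → IsProbabilityMeasure q₂ → (q₁ ≠ s.fst ∨ q₂ ≠ s.snd) →
      InformationTheory.klDiv s (s.fst.prod s.snd) < InformationTheory.klDiv s (q₁.prod q₂)) ∧
    -- the kinematic smoothing equation gives exactly the RTS smoother
    kinSmoothed filt pred fin T' =
      multivariateGaussian (smoothMean filt pred fin T) (smoothCov filt pred fin T) ∧
    -- the kinematic marginal is the RTS law weighted by the extent evidence
    s.fst = normalize ((kinSmoothed filt pred fin T').withDensity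
      (extEvidence filt pred fin T')) ∧
    (∀ c : ℝ≥0∞, (∀ᵐ x ∂kinSmoothed filt pred fin T', extEvidence filt pred fin T' x = c) →
      s.fst = kinSmoothed filt pred fin T') ∧
    -- the extent marginal is the filtered law weighted by the averaged extent message
    s.snd = normalize (filt.extLaw.withDensity fun X =>
      ∫⁻ x, extMessage pred fin T' x X ∂kinSmoothed filt pred fin T') ∧
    -- exact form of the extent message
    (∃ c : ℝ≥0∞, c ≠ 0 ∧ c ≠ ∞ ∧ ∀ (x : Kin nx) (X : Ext d), X.PosDef →
      extMessage pred fin T' x X =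
        c * ENNReal.ofReal ((|(T.M x).det| ^ (d + 1))⁻¹) *
          ∫⁻ Y, ENNReal.ofReal (iwPdf T.n (T.n • ((T.M x)⁻¹ * Y * ((T.M x)⁻¹)ᵀ)) X)
            ∂iwLaw (dofDiff pred fin) (scaleDiff pred fin)) ∧
    -- constant extent transformation
    (∀ A : Ext d, (∀ x, T.M x = A) →
      s.fst = kinSmoothed filt pred fin T' ∧
      s = s.fst.prod s.snd ∧
      (tableConst filt pred fin T A).Valid ∧
      ∀ ν : Measure (Kin nx × Ext d),
        IsFactorizedSmoothingConst filt pred fin T' A ν ↔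
          ν = (tableConst filt pred fin T A).law) ∧
    -- state dependent extent transformation
    ((∀ i j, Integrable (fun x => c3Fun pred fin T x i j) (smoothKin filt pred fin T)) →
      (∀ i j, Integrable (fun x => c4Fun pred fin T x i j) (smoothKin filt pred fin T)) →
      IsUnit (C3 filt pred fin T * C4 filt pred fin T - 1).det →
      (tableGeneral filt pred fin T).Valid ∧
      ∀ ν : Measure (Kin nx × Ext d),
        IsFactorizedSmoothing filt pred fin T' ν ↔
          ν = (tableGeneral filt pred fin T).law) := by
  intro T' s
  have hn' : 2 * (d : ℝ) < T'.n := by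
    have : T'.n = T.n := rfl
    linarith
  have hw' : 2 * (d : ℝ) < dofDiff pred fin := by linarith
  have hMdet' : ∀ x, IsUnit (T'.M x).det := hMdet
  have hcov : (smoothCov filt pred fin T).PosSemidef :=
    posSemidef_smoothCov hfilt hfin hpredP hQ hP
  have hkin : kinSmoothed filt pred fin T' =
      multivariateGaussian (smoothMean filt pred fin T) (smoothCov filt pred fin T) :=
    kinSmoothed_eq hfilt hfin hpredP hfinP hQ hm hP
  obtain ⟨c, hc0, hctop, hmsg⟩ := extMessage_eq (T := T') hd hpred hfin hMdet' hn' hw' hW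
  obtain ⟨C, hC⟩ := extMessage_le (T := T') hd hpred hfin hMdet' hn' hw' hW
  have hE : IsProbabilityMeasure filt.extLaw := isProbabilityMeasure_iwLaw hfilt.2.1 hfilt.2.2
  have hEpd : ∀ᵐ X ∂filt.extLaw, X.PosDef := ae_lawOf_posDef _
  set κ := kinSmoothed filt pred fin T' with hκ
  have hκp : IsProbabilityMeasure κ := by rw [hkin]; infer_instance
  -- A jointly measurable version of the message, equal to it for positive definite X and hence
  -- almost everywhere.
  set L : Kin nx × Ext d → ℝ≥0∞ := fun p => c * extMessageKernel pred fin T' p with hLdef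
  have hL : Measurable L := (measurable_extMessageKernel (T := T') hM).const_mul c
  have hun : smoothedUnnorm filt pred fin T' = (κ.prod filt.extLaw).withDensity L :=
    smoothedUnnorm_eq hfilt hpredP hfinP hL hmsg
  have hs : s = normalize ((κ.prod filt.extLaw).withDensity L) := by rw [← hun]; rfl
  have hpd : ∀ᵐ p ∂κ.prod filt.extLaw, p.2.PosDef :=
    Measure.quasiMeasurePreserving_snd.ae hEpd
  have hLC : ∀ᵐ p ∂κ.prod filt.extLaw, L p ≤ ENNReal.ofReal C := by
    filter_upwards [hpd] with p hp
    exact (hmsg p.1 p.2 hp).symm.trans_le (hC p.1 p.2 hp)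
  have h0 : ∫⁻ p, L p ∂κ.prod filt.extLaw ≠ 0 := by
    intro h
    rw [lintegral_eq_zero_iff hL] at h
    obtain ⟨p, hp, hp'⟩ := (h.and hpd).exists
    exact (extMessage_pos (T := T') hpred hfin hMdet' hn' hp').2 ((hmsg p.1 p.2 hp').trans hp)
  have h1 : ∫⁻ p, L p ∂κ.prod filt.extLaw ≠ ∞ :=
    ((lintegral_mono_ae hLC).trans_lt (by simp)).ne
  have hsp : IsProbabilityMeasure s := by
    rw [hs]
    exact isProbabilityMeasure_normalize (by rwa [withDensity_univ]) (by rwa [withDensity_univ])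
  have hevid : ∀ x, ∫⁻ X, L (x, X) ∂filt.extLaw = extEvidence filt pred fin T' x := fun x =>
    lintegral_congr_ae (hEpd.mono fun X hX => (hmsg x X hX).symm)
  have hfst : s.fst = normalize (κ.withDensity (extEvidence filt pred fin T')) := by
    rw [hs, fst_normalize, fst_withDensity_prod _ _ hL]
    simp only [hevid]
  have hZ : ∫⁻ x, extEvidence filt pred fin T' x ∂κ = ∫⁻ p, L p ∂κ.prod filt.extLaw := by
    rw [lintegral_prod _ hL.aemeasurable]
    exact lintegral_congr fun x => (hevid x).symm
  have hconst : ∀ c : ℝ≥0∞, (∀ᵐ x ∂κ, extEvidence filt pred fin T' x = c) → s.fst = κ :=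
    fun c hc => by
      rw [hfst]
      exact normalize_withDensity_of_ae_const hc (by rwa [hZ]) (by rwa [hZ])
  refine ⟨hsp, fun q₁ q₂ _ _ hq => klDiv_normalize_marginals_lt hL hLC h0 hs q₁ q₂ hq, hkin, hfst,
    hconst, ?_, ⟨c, hc0, hctop, fun x X hX => ?_⟩, fun A hA => ?_, fun h3 h4 hu =>
      isFactorizedSmoothing_iff hd hfilt hpred hfin hn hw hW hM hMdet hcov hkin h3 h4 hu⟩
  · rw [hs, snd_normalize, snd_withDensity_prod _ _ hL]
    congr 1
    exact withDensity_congr_ae (hEpd.mono fun X hX =>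
      lintegral_congr fun x => (hmsg x X hX).symm)
  · rw [hmsg x X hX, mul_assoc]
    rfl
  · have hAdet : A.det ≠ 0 := hA 0 ▸ (hMdet 0).ne_zero
    have hM' : ∀ x, T'.M x = A := hA
    -- For constant M the closed form no longer involves x; the evidence is constant and the joint
    -- density depends on X alone, so the law is a product.
    have hx : ∀ x X, L (x, X) = L (0, X) := fun x X => by
      simp only [hLdef, extMessageKernel, hM']
    have hfst' : s.fst = κ := hconst (∫⁻ X, L (0, X) ∂filt.extLaw) (ae_of_all _ fun x => by
      rw [← hevid]
      exact lintegral_congr fun X => hx x X)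
    have hg : Measurable fun X => L (0, X) := hL.comp measurable_prodMk_left
    have hsplit : s = κ.prod (normalize (filt.extLaw.withDensity fun X => L (0, X))) := by
      rw [hs, ← normalize_prod_withDensity_snd hg]
      congr 2
      ext p
      exact hx p.1 p.2
    refine ⟨hfst', ?_,
      isFactorizedSmoothingConst_iff hd hfilt hpred hfin hn hw hW hcov hkin hAdet⟩
    have hρ : IsProbabilityMeasure (normalize (filt.extLaw.withDensity fun X => L (0, X))) := by
      have hi : ∫⁻ p, L p ∂κ.prod filt.extLaw = ∫⁻ X, L (0, X) ∂filt.extLaw := by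
        rw [lintegral_prod _ hL.aemeasurable]
        simp only [hx, lintegral_const, measure_univ, mul_one]
      rw [hi] at h0 h1
      exact isProbabilityMeasure_normalize (by rwa [withDensity_univ])
        (by rwa [withDensity_univ])
    have hsnd : s.snd = normalize (filt.extLaw.withDensity fun X => L (0, X)) := by
      rw [hsplit, Measure.snd_prod]
    rw [hfst', hsnd, ← hsplit]
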